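/- Let $\mathcal{L}^2$ be the algebra of Hilbert–Schmidt operators on $L^2((0,\infty);\mathbb{C})$, that is, of the integral operators $\Phi f(x)=\int_0^\infty \phi(x,y)f(y)\,dy$ with kernel $[\Phi]_{x,y}=\phi(x,y)\in L^2((0,\infty)^2)$, with the norm $\|\Phi\|_{\mathcal{L}^2}=\|\phi\|_{L^2((0,\infty)^2)}$. For $t\ge 0$ let $S_t$ be the right translation on $L^2((0,\infty);\mathbb{C})$, $S_tf(x)=f(x-t)$ for $x>t$ and $S_tf(x)=0$ for $0<x\le t$, and let $S_t^\dagger$ be its adjoint. The infinitesimal generator of a strongly continuous semigroup $(T_t)_{t\ge 0}$ on $\mathcal{L}^2$ is $\Phi\mapsto\lim_{h\to0+}h^{-1}(T_h\Phi-\Phi)$, with domain the set of $\Phi$ for which this limit exists in $\mathcal{L}^2$. (i) Let $\sigma^\sharp_t(\Phi)=S_t\Phi S_t^\dagger$. Then $(\sigma^\sharp_t)_{t\ge0}$ is a strongly continuous one-parameter semigroup of isometric algebra homomorphisms of $\mathcal{L}^2$. The domain of its infinitesimal generator $\partial^\sharp$ is an algebra (it is a linear subspace closed under products), and $\partial^\sharp$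 is a derivation: $\partial^\sharp(\Phi\Psi)=(\partial^\sharp\Phi)\Psi+\Phi(\partial^\sharp\Psi)$ for all $\Phi,\Psi$ in the domain. (ii) Let $\sigma_t(\Phi)=S_t^\dagger\Phi S_t$. Then $(\sigma_t)_{t\ge0}$ is a strongly continuous one-parameter semigroup of contractions of $\mathcal{L}^2$. It preserves the upper-triangular form of the Gelfand–Levitan–Marchenko equation: if $\Phi,T\in\mathcal{L}^2$ have kernels $\phi,T(\cdot,\cdot)$ with $$\phi(x,y)+T(x,y)+\int_x^\infty T(x,z)\phi(z,y)\,dz=0\qquad\text{for almost all } 0<x<y,$$ then the kernels of $\sigma_t(\Phi)$ and $\sigma_t(T)$ satisfy the same equation for almost all $0<x<y$; and if $T(x,y)=0$ for almost all $0<y<x$, then the kernel of $\sigma_t(T)$ has the same property. (iii) Let $\partial$ be the infinitesimal generator of $(\sigma_t)_{t\ge0}$ and let $$\varpi(\Phi,\Psi)=\partial(\Phi\Psi)-(\partial\Phi)\Psi-\Phi(\partial\Psi)$$ whenever $\Phi,\Psi$ and $\Phi\Psi$ belong to the domain of $\partial$. Then $\varpi$ satisfies the cocycle relation $$\Upsilon\varpi(\Phi,\Psi)-\varpi(\Upsilon\Phi,\Psi)+\varpi(\Upsilon,\Phi\Psi)-\varpi(\Upsilon,\Phi)\Psi=0$$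 whenever $\Upsilon,\Phi,\Psi,\Upsilon\Phi,\Phi\Psi,\Upsilon\Phi\Psi$ belong to the domain of $\partial$. Moreover, if $\Phi,\Psi,\Phi\Psi$ belong to the domain of $\partial$, then for all $\Upsilon,\Lambda\in\mathcal{L}^2$ the boundary values $[\Upsilon\Phi]_{x,0}$ and $[\Psi\Lambda]_{0,y}$ exist in $L^2(0,\infty)$ and $$[\Upsilon\varpi(\Phi,\Psi)\Lambda]_{x,y}=[\Upsilon\Phi]_{x,0}\,[\Psi\Lambda]_{0,y}\qquad\text{for almost all } x,y>0.$$ Here $a\in L^2(0,\infty)$ is the boundary value $x\mapsto[P]_{x,0}$ of $P\in\mathcal{L}^2$ if $h^{-1}\int_0^h\int_0^\infty|[P]_{x,y}-a(x)|^2\,dx\,dy\to0$ as $h\to0+$, and $b\in L^2(0,\infty)$ is the boundary value $y\mapsto[P]_{0,y}$ if $h^{-1}\int_0^h\int_0^\infty|[P]_{x,y}-b(y)|^2\,dy\,dx\to0$ as $h\to0+$. (iv) Let $n\ge1$ and let $\Gamma_{\phi_1},\dots,\Gamma_{\phi_{2n}}$ be bounded Hankel operators on $L^2((0,\infty);\mathbb{C})$,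 $\Gamma_{\phi_j}f(x)=\int_0^\infty\phi_j(x+y)f(y)\,dy$ (where for each $f\in L^2$ the integral converges absolutely for almost every $x>0$), whose product $G_n=\Gamma_{\phi_1}\cdots\Gamma_{\phi_{2n}}$ belongs to $\mathcal{L}^2$ (for instance, Hilbert–Schmidt Hankel operators). If $G_n$ belongs to the domain of $\partial$, then $\partial(G_n)$ has finite rank; and $G_n$ does belong to the domain of $\partial$ if $\phi_1,\dots,\phi_{2n}\in L^2(0,\infty)$. -/

import Mathlib

open MeasureTheory Set Filter Topology
open scoped NNReal ENNReal

namespace Poppe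

/-- Lebesgue measure on the half-line `(0, ∞)`, as a measure on `ℝ` that does not charge the
complement. -/
noncomputable abbrev halfLine : Measure ℝ := volume.restrict (Ioi 0)

/-- Lebesgue measure on the quadrant `(0, ∞) × (0, ∞)`. -/
noncomputable abbrev quadrant : Measure (ℝ × ℝ) := halfLine.prod halfLine

/-- The Hilbert space `L²((0, ∞); ℂ)`. -/
abbrev L2 : Type := Lp ℂ 2 halfLine

/-- `T` is the integral operator `(T f)(x) = ∫₀^∞ k(x, y) f(y) dy`: for every `f ∈ L²(0, ∞)` the
integral converges absolutely for almost every `x > 0` and represents `T f`. -/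
def HasKernel (T : L2 →L[ℂ] L2) (k : ℝ × ℝ → ℂ) : Prop :=
  ∀ f : L2, ∀ᵐ x ∂halfLine, Integrable (fun y => k (x, y) * f y) halfLine ∧
    T f x = ∫ y, k (x, y) * f y ∂halfLine

theorem HasKernel.congr {T : L2 →L[ℂ] L2} {k l : ℝ × ℝ → ℂ} (hT : HasKernel T k)
    (h : k =ᵐ[quadrant] l) : HasKernel T l := by
  intro f
  filter_upwards [hT f, Measure.ae_ae_of_ae_prod h] with x hx hkl
  have e : (fun y => k (x, y) * f y) =ᵐ[halfLine] fun y => l (x, y) * f y := by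
    filter_upwards [hkl] with y hy
    rw [hy]
  exact ⟨hx.1.congr e, by rw [hx.2, integral_congr_ae e]⟩

theorem sq_norm_integral_mul_le {f g : ℝ → ℂ} (hf : MemLp f 2 halfLine)
    (hg : MemLp g 2 halfLine) :
    ‖∫ z, f z * g z ∂halfLine‖ ^ 2 ≤
      (∫ z, ‖f z‖ ^ 2 ∂halfLine) * ∫ z, ‖g z‖ ^ 2 ∂halfLine := by
  have h1 : ‖∫ z, f z * g z ∂halfLine‖ ≤ ∫ z, ‖f z‖ * ‖g z‖ ∂halfLine := by
    refine (norm_integral_le_integral_norm _).trans (le_of_eq ?_)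
    simp only [norm_mul]
  have h2 := integral_mul_norm_le_Lp_mul_Lq (μ := halfLine) (f := f) (g := g)
    (p := 2) (q := 2) ((Real.holderConjugate_iff).2 (by norm_num))
    (by simpa using hf) (by simpa using hg)
  simp only [Real.rpow_two, ← Real.sqrt_eq_rpow] at h2
  have hA : 0 ≤ ∫ z, ‖f z‖ ^ 2 ∂halfLine := integral_nonneg fun z => by positivity
  have hB : 0 ≤ ∫ z, ‖g z‖ ^ 2 ∂halfLine := integral_nonneg fun z => by positivity
  calc ‖∫ z, f z * g z ∂halfLine‖ ^ 2
      ≤ (√(∫ z, ‖f z‖ ^ 2 ∂halfLine) * √(∫ z, ‖g z‖ ^ 2 ∂halfLine)) ^ 2 := by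
        gcongr
        exact h1.trans h2
    _ = _ := by rw [mul_pow, Real.sq_sqrt hA, Real.sq_sqrt hB]

theorem memLp_row {k : ℝ × ℝ → ℂ} (hk : MemLp k 2 quadrant) :
    ∀ᵐ x ∂halfLine, MemLp (fun y => k (x, y)) 2 halfLine := by
  have h := ((memLp_two_iff_integrable_sq_norm hk.1).1 hk).prod_right_ae
  have h' : ∀ᵐ x ∂halfLine, AEStronglyMeasurable (fun y => k (x, y)) halfLine :=
    hk.1.prodMk_left
  filter_upwards [h, h'] with x hx hx'
  exact (memLp_two_iff_integrable_sq_norm hx').2 hx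

theorem memLp_col {k : ℝ × ℝ → ℂ} (hk : MemLp k 2 quadrant) :
    ∀ᵐ y ∂halfLine, MemLp (fun x => k (x, y)) 2 halfLine := by
  have : MemLp (fun p : ℝ × ℝ => k p.swap) 2 quadrant :=
    hk.comp_measurePreserving Measure.measurePreserving_swap
  exact memLp_row this

/-- An integral operator with square-integrable kernel determines its kernel almost everywhere. -/
theorem HasKernel.ae_eq {T : L2 →L[ℂ] L2} {k l : ℝ × ℝ → ℂ} (hk : MemLp k 2 quadrant)
    (hl : MemLp l 2 quadrant) (hTk : HasKernel T k) (hTl : HasKernel T l) :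
    k =ᵐ[quadrant] l := by
  have hd : MemLp (k - l) 2 quadrant := hk.sub hl
  have : Fact ((2 : ℝ≥0∞) ≠ ∞) := ⟨by norm_num⟩
  obtain ⟨s, hsc, hsd⟩ := TopologicalSpace.exists_countable_dense L2
  have hs : ∀ᵐ x ∂halfLine, ∀ f ∈ s, ∫ y, (k - l) (x, y) * f y ∂halfLine = 0 := by
    rw [ae_ball_iff hsc]
    intro f _
    filter_upwards [hTk f, hTl f] with x h1 h2
    simp only [Pi.sub_apply, sub_mul]
    rw [integral_sub h1.1 h2.1, ← h1.2, ← h2.2, sub_self]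
  have key : ∀ᵐ x ∂halfLine, ∀ᵐ y ∂halfLine, (k - l) (x, y) = 0 := by
    filter_upwards [hs, memLp_row hd] with x hx hm
    have hms : MemLp (fun y => star ((k - l) (x, y))) 2 halfLine := hm.star
    set g : L2 := MemLp.toLp (fun y => star ((k - l) (x, y))) hms with hg
    have hgz : g = 0 := by
      refine hsd.eq_zero_of_inner_left (𝕜 := ℂ) (fun v hv => ?_)
      rw [L2.inner_def]
      rw [← hx v hv]
      refine integral_congr_ae ?_
      filter_upwards [MemLp.coeFn_toLp hms] with y hy
      rw [hg, hy]
      simp [mul_comm]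
    have h0 : (g : ℝ → ℂ) =ᵐ[halfLine] 0 := by rw [hgz]; exact Lp.coeFn_zero _ _ _
    filter_upwards [h0, MemLp.coeFn_toLp hms] with y h1 h2
    rw [hg, h2] at h1
    exact star_eq_zero.1 h1
  have hae : (k - l) =ᵐ[quadrant] 0 := by
    have hm := hd.1
    have key' : ∀ᵐ x ∂halfLine, ∀ᵐ y ∂halfLine, hm.mk _ (x, y) = 0 := by
      filter_upwards [key, Measure.ae_ae_of_ae_prod hm.ae_eq_mk] with x h1 h2
      filter_upwards [h1, h2] with y h3 h4
      rw [← h4, h3]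
    have : ∀ᵐ p ∂quadrant, hm.mk _ p = 0 :=
      (Measure.ae_prod_iff_ae_ae
        (hm.stronglyMeasurable_mk.measurable (measurableSet_singleton 0))).2 key'
    filter_upwards [this, hm.ae_eq_mk] with p h1 h2
    rw [h2, h1]; rfl
  filter_upwards [hae] with p hp
  exact sub_eq_zero.1 hp

/-- Composition of kernels: the product of two integral operators with square-integrable kernels
is again one. -/
theorem HasKernel.mul {S T : L2 →L[ℂ] L2} {k l : ℝ × ℝ → ℂ} (hk : MemLp k 2 quadrant)
    (hl : MemLp l 2 quadrant) (hS : HasKernel S k) (hT : HasKernel T l) :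
    MemLp (fun p : ℝ × ℝ => ∫ z, k (p.1, z) * l (z, p.2) ∂halfLine) 2 quadrant ∧
      HasKernel (S * T) (fun p => ∫ z, k (p.1, z) * l (z, p.2) ∂halfLine) := by
  constructor
  · have hki := (memLp_two_iff_integrable_sq_norm hk.1).1 hk
    have hli := (memLp_two_iff_integrable_sq_norm hl.1).1 hl
    have hm : AEStronglyMeasurable
        (fun p : ℝ × ℝ => ∫ z, k (p.1, z) * l (z, p.2) ∂halfLine) quadrant := by
      have h1 : AEStronglyMeasurable (fun q : (ℝ × ℝ) × ℝ => k (q.1.1, q.2))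
          (quadrant.prod halfLine) :=
        hk.1.comp_quasiMeasurePreserving
          (QuasiMeasurePreserving.prodMap Measure.quasiMeasurePreserving_fst
            (Measure.QuasiMeasurePreserving.id halfLine))
      have h2 : AEStronglyMeasurable (fun q : (ℝ × ℝ) × ℝ => l (q.2, q.1.2))
          (quadrant.prod halfLine) := by
        have h3 : Measure.QuasiMeasurePreserving
            (fun q : (ℝ × ℝ) × ℝ => (q.1.2, q.2)) (quadrant.prod halfLine) quadrant :=
          QuasiMeasurePreserving.prodMap Measure.quasiMeasurePreserving_snd
            (Measure.QuasiMeasurePreserving.id halfLine)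
        exact hl.1.comp_quasiMeasurePreserving
          (Measure.measurePreserving_swap.quasiMeasurePreserving.comp h3)
      exact (h1.mul h2).integral_prod_right'
    rw [memLp_two_iff_integrable_sq_norm hm]
    have hA : Integrable (fun x => ∫ z, ‖k (x, z)‖ ^ 2 ∂halfLine) halfLine :=
      hki.integral_prod_left
    have hB : Integrable (fun y => ∫ z, ‖l (z, y)‖ ^ 2 ∂halfLine) halfLine :=
      hli.integral_prod_right
    refine (hA.mul_prod hB).mono' (hm.norm.pow 2) ?_
    have r1 : ∀ᵐ p ∂quadrant, MemLp (fun z => k (p.1, z)) 2 halfLine :=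
      Measure.quasiMeasurePreserving_fst.ae (memLp_row hk)
    have r2 : ∀ᵐ p ∂quadrant, MemLp (fun z => l (z, p.2)) 2 halfLine :=
      Measure.quasiMeasurePreserving_snd.ae (memLp_col hl)
    filter_upwards [r1, r2] with p h1 h2
    rw [Real.norm_of_nonneg (by positivity)]
    exact sq_norm_integral_mul_le h1 h2
  · intro f
    filter_upwards [hS (T f), memLp_row hk] with x h1 h2
    have hint : Integrable (fun q : ℝ × ℝ => (k (x, q.1) * f q.2) * l q) quadrant := by
      have hf := Lp.memLp f
      have hkf : MemLp (fun q : ℝ × ℝ => k (x, q.1) * f q.2) 2 quadrant := by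
        have hme : AEStronglyMeasurable (fun q : ℝ × ℝ => k (x, q.1) * f q.2) quadrant :=
          (h2.1.comp_quasiMeasurePreserving Measure.quasiMeasurePreserving_fst).mul
            (hf.1.comp_quasiMeasurePreserving Measure.quasiMeasurePreserving_snd)
        rw [memLp_two_iff_integrable_sq_norm hme]
        have := ((memLp_two_iff_integrable_sq_norm h2.1).1 h2).mul_prod
          ((memLp_two_iff_integrable_sq_norm hf.1).1 hf)
        simpa only [norm_mul, mul_pow] using this
      exact hkf.integrable_mul hl
    have e : ∀ y, (∫ z, k (x, z) * l (z, y) ∂halfLine) * f y =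
        ∫ z, (k (x, z) * f y) * l (z, y) ∂halfLine := by
      intro y
      rw [← integral_mul_const]
      congr 1; ext z; ring
    simp only [e]
    refine ⟨hint.integral_prod_right, ?_⟩
    change S (T f) x = _
    rw [h1.2, integral_integral_swap (μ := halfLine) (ν := halfLine)
      (f := fun y z => (k (x, z) * f y) * l (z, y)) hint.swap]
    refine integral_congr_ae ?_
    filter_upwards [hT f] with z hz
    rw [hz.2, ← integral_const_mul]
    congr 1; ext y; ring

/-- The algebra `𝓛²` of Hilbert–Schmidt operators on `L²((0, ∞); ℂ)`: the integral operators whose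
kernel is square-integrable over the quadrant. -/
noncomputable def hilbertSchmidt : NonUnitalSubalgebra ℂ (L2 →L[ℂ] L2) where
  carrier := {T | ∃ k : ℝ × ℝ → ℂ, MemLp k 2 quadrant ∧ HasKernel T k}
  zero_mem' := by
    refine ⟨0, MemLp.zero, fun f => ?_⟩
    filter_upwards [Lp.coeFn_zero ℂ 2 halfLine] with x hx
    refine ⟨by simp, ?_⟩
    change (0 : L2) x = _
    simpa using hx
  add_mem' := by
    rintro S T ⟨k, hk, hS⟩ ⟨l, hl, hT⟩
    refine ⟨k + l, hk.add hl, fun f => ?_⟩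
    filter_upwards [hS f, hT f, Lp.coeFn_add (S f) (T f)] with x h1 h2 h3
    simp only [Pi.add_apply, add_mul]
    refine ⟨h1.1.add h2.1, ?_⟩
    rw [integral_add h1.1 h2.1, ← h1.2, ← h2.2]
    exact h3
  smul_mem' := by
    rintro c T ⟨k, hk, hT⟩
    refine ⟨c • k, hk.const_smul c, fun f => ?_⟩
    filter_upwards [hT f, Lp.coeFn_smul c (T f)] with x h1 h2
    simp only [Pi.smul_apply, smul_eq_mul, mul_assoc]
    refine ⟨h1.1.const_mul c, ?_⟩
    rw [integral_const_mul, ← h1.2]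
    exact h2
  mul_mem' := by
    rintro S T ⟨k, hk, hS⟩ ⟨l, hl, hT⟩
    exact ⟨_, hS.mul hk hl hT⟩

/-- The Hilbert–Schmidt operators as a type of its own, which carries the Hilbert–Schmidt norm
(below) and not the operator norm. -/
def HS : Type := hilbertSchmidt

namespace HS

noncomputable instance : NonUnitalRing HS := inferInstanceAs (NonUnitalRing hilbertSchmidt)
noncomputable instance : Module ℂ HS := inferInstanceAs (Module ℂ hilbertSchmidt)

/-- The bounded operator on `L²((0, ∞); ℂ)` underlying a Hilbert–Schmidt operator. -/
def op (Φ : HS) : L2 →L[ℂ] L2 := Subtype.val Φ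

theorem op_injective : Function.Injective op := Subtype.val_injective

@[simp] theorem op_add (Φ Ψ : HS) : (Φ + Ψ).op = Φ.op + Ψ.op := rfl
@[simp] theorem op_smul (c : ℂ) (Φ : HS) : (c • Φ).op = c • Φ.op := rfl
@[simp] theorem op_mul (Φ Ψ : HS) : (Φ * Ψ).op = Φ.op * Ψ.op := rfl

theorem exists_kernel (Φ : HS) : ∃ k : ℝ × ℝ → ℂ, MemLp k 2 quadrant ∧ HasKernel Φ.op k :=
  Subtype.prop Φ

/-- The kernel `[Φ]_{x,y}` (the bracket) of a Hilbert–Schmidt operator, an element of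
`L²((0, ∞) × (0, ∞))`. -/
noncomputable def bracket (Φ : HS) : Lp ℂ 2 quadrant := Φ.exists_kernel.choose_spec.1.toLp _

theorem hasKernel_bracket (Φ : HS) : HasKernel Φ.op Φ.bracket :=
  Φ.exists_kernel.choose_spec.2.congr (MemLp.coeFn_toLp Φ.exists_kernel.choose_spec.1).symm

theorem bracket_ae_eq {Φ : HS} {k : ℝ × ℝ → ℂ} (hk : MemLp k 2 quadrant)
    (h : HasKernel Φ.op k) : Φ.bracket =ᵐ[quadrant] k :=
  Φ.hasKernel_bracket.ae_eq (Lp.memLp _) hk h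

/-- The bracket as a linear map `𝓛² → L²((0, ∞) × (0, ∞))`. -/
noncomputable def bracketₗ : HS →ₗ[ℂ] Lp ℂ 2 quadrant where
  toFun := bracket
  map_add' Φ Ψ := by
    refine Lp.ext ((bracket_ae_eq ((Lp.memLp Φ.bracket).add (Lp.memLp Ψ.bracket)) ?_).trans
      (Lp.coeFn_add _ _).symm)
    intro f
    filter_upwards [Φ.hasKernel_bracket f, Ψ.hasKernel_bracket f,
      Lp.coeFn_add (Φ.op f) (Ψ.op f)] with x h1 h2 h3
    simp only [Pi.add_apply, add_mul]
    refine ⟨h1.1.add h2.1, ?_⟩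
    rw [integral_add h1.1 h2.1, ← h1.2, ← h2.2]
    exact h3
  map_smul' c Φ := by
    refine Lp.ext ((bracket_ae_eq ((Lp.memLp Φ.bracket).const_smul c) ?_).trans
      (Lp.coeFn_smul _ _).symm)
    intro f
    filter_upwards [Φ.hasKernel_bracket f, Lp.coeFn_smul c (Φ.op f)] with x h1 h2
    simp only [Pi.smul_apply, smul_eq_mul, mul_assoc]
    refine ⟨h1.1.const_mul c, ?_⟩
    rw [integral_const_mul, ← h1.2]
    exact h2

theorem bracketₗ_injective : Function.Injective bracketₗ := by
  intro Φ Ψ h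
  have h' : Φ.bracket = Ψ.bracket := h
  refine op_injective (ContinuousLinearMap.ext fun f => Lp.ext ?_)
  filter_upwards [Φ.hasKernel_bracket f, Ψ.hasKernel_bracket f] with x h1 h2
  rw [h1.2, h2.2, h']

/-- The Hilbert–Schmidt norm `‖Φ‖ = (∫∫ |[Φ]_{x,y}|² dx dy)^{1/2} = (trace ΦΦ†)^{1/2}`. -/
noncomputable instance : NormedAddCommGroup HS :=
  NormedAddCommGroup.induced HS (Lp ℂ 2 quadrant) bracketₗ bracketₗ_injective

noncomputable instance : NormedSpace ℂ HS := NormedSpace.induced ℂ HS (Lp ℂ 2 quadrant) bracketₗ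

theorem norm_def (Φ : HS) : ‖Φ‖ = ‖Φ.bracket‖ := rfl

end HS

theorem measurePreserving_add (t : ℝ≥0) :
    MeasurePreserving (fun x : ℝ => x + t) halfLine (volume.restrict (Ioi (t : ℝ))) := by
  have h := (measurePreserving_add_right (volume : Measure ℝ) (t : ℝ)).restrict_preimage
    (measurableSet_Ioi (a := (t : ℝ)))
  simpa using h

theorem measurePreserving_sub (t : ℝ≥0) :
    MeasurePreserving (fun x : ℝ => x - t) (volume.restrict (Ioi (t : ℝ))) halfLine := by
  have h := (measurePreserving_sub_right (volume : Measure ℝ) (t : ℝ)).restrict_preimage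
    (measurableSet_Ioi (a := (0 : ℝ)))
  simpa using h

/-- The right translate `x ↦ f(x - t)` for `x > t`, extended by `0`. -/
noncomputable def shiftFun (t : ℝ≥0) (f : ℝ → ℂ) : ℝ → ℂ :=
  (Ioi (t : ℝ)).indicator fun x => f (x - t)

theorem restrict_halfLine (t : ℝ≥0) :
    halfLine.restrict (Ioi (t : ℝ)) = volume.restrict (Ioi (t : ℝ)) := by
  rw [Measure.restrict_restrict measurableSet_Ioi,
    inter_eq_left.2 (Ioi_subset_Ioi t.coe_nonneg)]

theorem memLp_shiftFun (t : ℝ≥0) {f : ℝ → ℂ} (hf : MemLp f 2 halfLine) :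
    MemLp (shiftFun t f) 2 halfLine := by
  rw [shiftFun, memLp_indicator_iff_restrict measurableSet_Ioi, restrict_halfLine]
  exact hf.comp_measurePreserving (measurePreserving_sub t)

theorem shiftFun_congr (t : ℝ≥0) {f g : ℝ → ℂ} (h : f =ᵐ[halfLine] g) :
    shiftFun t f =ᵐ[halfLine] shiftFun t g := by
  have h' := (measurePreserving_sub t).quasiMeasurePreserving.ae_eq_comp h
  rw [← restrict_halfLine] at h'
  filter_upwards [(ae_restrict_iff' measurableSet_Ioi).1 h'] with x hx
  by_cases hxt : x ∈ Ioi (t : ℝ)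
  · simpa [shiftFun, hxt] using hx hxt
  · simp [shiftFun, hxt]

theorem eLpNorm_shiftFun (t : ℝ≥0) {f : ℝ → ℂ} (hf : MemLp f 2 halfLine) :
    eLpNorm (shiftFun t f) 2 halfLine = eLpNorm f 2 halfLine := by
  rw [shiftFun, eLpNorm_indicator_eq_eLpNorm_restrict measurableSet_Ioi, restrict_halfLine]
  exact eLpNorm_comp_measurePreserving hf.1 (measurePreserving_sub t)

/-- The right translation `S_t` on `L²((0, ∞); ℂ)`: `(S_t f)(x) = f(x - t)` for `x > t` and
`(S_t f)(x) = 0` for `0 < x ≤ t`. -/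
noncomputable def shift (t : ℝ≥0) : L2 →L[ℂ] L2 :=
  LinearMap.mkContinuous
    { toFun := fun f => (memLp_shiftFun t (Lp.memLp f)).toLp _
      map_add' := fun f g => by
        rw [← MemLp.toLp_add, MemLp.toLp_eq_toLp_iff]
        refine (shiftFun_congr t (Lp.coeFn_add f g)).trans (Eventually.of_forall fun x => ?_)
        by_cases hxt : x ∈ Ioi (t : ℝ) <;> simp [shiftFun, hxt]
      map_smul' := fun c f => by
        rw [RingHom.id_apply, ← MemLp.toLp_const_smul, MemLp.toLp_eq_toLp_iff]
        refine (shiftFun_congr t (Lp.coeFn_smul c f)).trans (Eventually.of_forall fun x => ?_)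
        by_cases hxt : x ∈ Ioi (t : ℝ) <;> simp [shiftFun, hxt] }
    1 fun f => by
      simp only [LinearMap.coe_mk, AddHom.coe_mk, one_mul]
      rw [Lp.norm_toLp, eLpNorm_shiftFun t (Lp.memLp f), Lp.norm_def]

/-- The adjoint `S_t†`. -/
noncomputable def shiftAdj (t : ℝ≥0) : L2 →L[ℂ] L2 := ContinuousLinearMap.adjoint (shift t)

theorem shift_ae (t : ℝ≥0) (f : L2) : shift t f =ᵐ[halfLine] shiftFun t f :=
  MemLp.coeFn_toLp (memLp_shiftFun t (Lp.memLp f))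

theorem ae_halfLine_of_ae_Ioi (t : ℝ≥0) {p : ℝ → Prop} (h : ∀ᵐ x ∂halfLine, p x) :
    ∀ᵐ x ∂halfLine, p (x + t) := by
  have h' : ∀ᵐ x ∂(volume.restrict (Ioi (t : ℝ))), p x := by
    rw [← restrict_halfLine]; exact ae_restrict_of_ae h
  exact (measurePreserving_add t).quasiMeasurePreserving.ae h'

theorem integral_shiftFun_mul (t : ℝ≥0) (f g : ℝ → ℂ) :
    ∫ x, g x * shiftFun t f x ∂halfLine = ∫ x, g (x + t) * f x ∂halfLine := by
  have h := (measurePreserving_add t).integral_comp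
    (MeasurableEquiv.addRight (t : ℝ)).measurableEmbedding (fun x => g x * f (x - t))
  simp only [add_sub_cancel_right] at h
  rw [h, ← restrict_halfLine, ← integral_indicator (μ := halfLine) measurableSet_Ioi]
  refine congrArg (fun u => integral halfLine u) (funext fun x => ?_)
  by_cases hxt : x ∈ Ioi (t : ℝ) <;> simp [shiftFun, hxt]

theorem integrable_shiftFun_mul (t : ℝ≥0) (f g : ℝ → ℂ) :
    Integrable (fun x => g x * shiftFun t f x) halfLine ↔
      Integrable (fun x => g (x + t) * f x) halfLine := by
  have h := (measurePreserving_add t).integrable_comp_emb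
    (MeasurableEquiv.addRight (t : ℝ)).measurableEmbedding (g := fun x => g x * f (x - t))
  have e : (fun x => g x * f (x - t)) ∘ (fun x : ℝ => x + t) = fun x => g (x + t) * f x := by
    ext x; simp
  rw [e] at h
  have h3 := integrable_indicator_iff (μ := halfLine) (f := fun x => g x * f (x - t))
    (measurableSet_Ioi (a := (t : ℝ)))
  rw [h, ← restrict_halfLine]
  refine Iff.trans (iff_of_eq ?_) h3
  refine congrArg (fun u => Integrable u halfLine) (funext fun x => ?_)
  by_cases hxt : x ∈ Ioi (t : ℝ) <;> simp [shiftFun, hxt]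

theorem memLp_add (t : ℝ≥0) {f : ℝ → ℂ} (hf : MemLp f 2 halfLine) :
    MemLp (fun x => f (x + t)) 2 halfLine := by
  have h : MemLp f 2 (volume.restrict (Ioi (t : ℝ))) := by
    rw [← restrict_halfLine]; exact hf.restrict _
  exact h.comp_measurePreserving (measurePreserving_add t)

/-- `S_t†` is the left translation `(S_t† f)(x) = f(x + t)`. -/
theorem shiftAdj_ae (t : ℝ≥0) (f : L2) : ∀ᵐ x ∂halfLine, shiftAdj t f x = f (x + t) := by
  have hL := memLp_add t (Lp.memLp f)
  have : shiftAdj t f = hL.toLp _ := by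
    refine ext_inner_left ℂ fun g => ?_
    rw [shiftAdj, ContinuousLinearMap.adjoint_inner_right, L2.inner_def, L2.inner_def]
    have h1 : ∫ x, inner ℂ (shift t g x) (f x) ∂halfLine =
        ∫ x, f x * shiftFun t (fun x => star (g x)) x ∂halfLine := by
      refine integral_congr_ae ?_
      filter_upwards [shift_ae t g] with x hx
      rw [hx]
      by_cases hxt : x ∈ Ioi (t : ℝ) <;> simp [shiftFun, hxt]
    rw [h1, integral_shiftFun_mul]
    refine integral_congr_ae ?_
    filter_upwards [hL.coeFn_toLp] with x hx
    rw [hx]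
    simp
  rw [this]
  exact hL.coeFn_toLp

theorem memLp_kernel_sub (t : ℝ≥0) {k : ℝ × ℝ → ℂ} (hk : MemLp k 2 quadrant) :
    MemLp ((Ioi (t : ℝ) ×ˢ Ioi (t : ℝ)).indicator fun p => k (p.1 - t, p.2 - t)) 2 quadrant := by
  rw [memLp_indicator_iff_restrict (measurableSet_Ioi.prod measurableSet_Ioi),
    ← Measure.prod_restrict, restrict_halfLine]
  exact hk.comp_measurePreserving ((measurePreserving_sub t).prod (measurePreserving_sub t))

theorem memLp_kernel_add (t : ℝ≥0) {k : ℝ × ℝ → ℂ} (hk : MemLp k 2 quadrant) :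
    MemLp (fun p : ℝ × ℝ => k (p.1 + t, p.2 + t)) 2 quadrant := by
  have h : MemLp k 2
      ((volume.restrict (Ioi (t : ℝ))).prod (volume.restrict (Ioi (t : ℝ)))) := by
    rw [← restrict_halfLine, Measure.prod_restrict]; exact hk.restrict _
  exact h.comp_measurePreserving ((measurePreserving_add t).prod (measurePreserving_add t))

/-- `S_t Φ S_t†` has kernel `k(x - t, y - t)` for `x, y > t`, extended by `0`. -/
theorem HasKernel.shift_mul_mul_shiftAdj (t : ℝ≥0) {T : L2 →L[ℂ] L2} {k : ℝ × ℝ → ℂ}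
    (hT : HasKernel T k) : HasKernel (shift t * T * shiftAdj t)
      ((Ioi (t : ℝ) ×ˢ Ioi (t : ℝ)).indicator fun p => k (p.1 - t, p.2 - t)) := by
  intro f
  have h1 := (measurePreserving_sub t).quasiMeasurePreserving.ae (hT (shiftAdj t f))
  rw [← restrict_halfLine, ae_restrict_iff' measurableSet_Ioi] at h1
  filter_upwards [h1, shift_ae t (T (shiftAdj t f))] with x hx hS
  have e : ∀ y, (Ioi (t : ℝ) ×ˢ Ioi (t : ℝ)).indicator
      (fun p : ℝ × ℝ => k (p.1 - t, p.2 - t)) (x, y) * f y =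
      (Ioi (t : ℝ)).indicator (fun _ => (1 : ℂ)) x *
        (f y * shiftFun t (fun z => k (x - t, z)) y) := by
    intro y
    clear h1 hS hx
    by_cases hxt : x ∈ Ioi (t : ℝ) <;> by_cases hyt : y ∈ Ioi (t : ℝ) <;>
      simp [shiftFun, indicator_of_mem, indicator_of_notMem, hxt, hyt, mul_comm]
  change Integrable _ _ ∧ shift t (T (shiftAdj t f)) x = _
  simp only [e, integral_const_mul, integral_shiftFun_mul]
  rw [hS]
  by_cases hxt : x ∈ Ioi (t : ℝ)
  · have e' : (fun y => k (x - t, y) * shiftAdj t f y) =ᵐ[halfLine]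
        fun y => f (y + t) * k (x - t, y) := by
      filter_upwards [shiftAdj_ae t f] with y hy
      rw [hy, mul_comm]
    refine ⟨Integrable.const_mul ?_ _, ?_⟩
    · rw [integrable_shiftFun_mul]
      exact (hx hxt).1.congr e'
    · simp only [shiftFun, indicator_of_mem hxt, one_mul]
      rw [(hx hxt).2, integral_congr_ae e']
  · simp [shiftFun, indicator_of_notMem hxt]

/-- `S_t† Φ S_t` has kernel `k(x + t, y + t)`. -/
theorem HasKernel.shiftAdj_mul_mul_shift (t : ℝ≥0) {T : L2 →L[ℂ] L2} {k : ℝ × ℝ → ℂ}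
    (hT : HasKernel T k) : HasKernel (shiftAdj t * T * shift t)
      (fun p => k (p.1 + t, p.2 + t)) := by
  intro f
  filter_upwards [ae_halfLine_of_ae_Ioi t (hT (shift t f)), shiftAdj_ae t (T (shift t f))]
    with x hx hS
  have e : (fun y => k (x + t, y) * shift t f y) =ᵐ[halfLine]
      fun y => k (x + t, y) * shiftFun t f y := by
    filter_upwards [shift_ae t f] with y hy
    rw [hy]
  change Integrable _ _ ∧ shiftAdj t (T (shift t f)) x = _
  refine ⟨(integrable_shiftFun_mul t f fun y => k (x + t, y)).1 (hx.1.congr e), ?_⟩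
  rw [hS, hx.2, integral_congr_ae e, integral_shiftFun_mul]

/-- `σ♯_t(Φ) = S_t Φ S_t†` on `𝓛²`. -/
noncomputable def sigmaSharp (t : ℝ≥0) : HS →ₗ[ℂ] HS where
  toFun Φ := ⟨shift t * Φ.op * shiftAdj t, _, memLp_kernel_sub t Φ.exists_kernel.choose_spec.1,
    Φ.exists_kernel.choose_spec.2.shift_mul_mul_shiftAdj t⟩
  map_add' Φ Ψ := Subtype.ext (by
    change shift t * (Φ.op + Ψ.op) * shiftAdj t = _
    rw [mul_add, add_mul]; rfl)
  map_smul' c Φ := Subtype.ext (by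
    change shift t * (c • Φ.op) * shiftAdj t = _
    rw [mul_smul_comm, smul_mul_assoc]; rfl)

/-- `σ_t(Φ) = S_t† Φ S_t` on `𝓛²`. -/
noncomputable def sigma (t : ℝ≥0) : HS →ₗ[ℂ] HS where
  toFun Φ := ⟨shiftAdj t * Φ.op * shift t, _, memLp_kernel_add t Φ.exists_kernel.choose_spec.1,
    Φ.exists_kernel.choose_spec.2.shiftAdj_mul_mul_shift t⟩
  map_add' Φ Ψ := Subtype.ext (by
    change shiftAdj t * (Φ.op + Ψ.op) * shift t = _
    rw [mul_add, add_mul]; rfl)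
  map_smul' c Φ := Subtype.ext (by
    change shiftAdj t * (c • Φ.op) * shift t = _
    rw [mul_smul_comm, smul_mul_assoc]; rfl)

theorem sigmaSharp_op (t : ℝ≥0) (Φ : HS) :
    (sigmaSharp t Φ).op = shift t * Φ.op * shiftAdj t := rfl

theorem sigma_op (t : ℝ≥0) (Φ : HS) : (sigma t Φ).op = shiftAdj t * Φ.op * shift t := rfl

section Semigroup

variable {X : Type*} [NormedAddCommGroup X] [NormedSpace ℂ X]

/-- Strongly continuous one-parameter semigroups (`C₀`-semigroups) of bounded linear operators. -/
structure IsC0Semigroup (T : ℝ≥0 → X →ₗ[ℂ] X) : Prop where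
  zero : T 0 = LinearMap.id
  add : ∀ s t, T (s + t) = T s ∘ₗ T t
  bounded : ∀ t, Continuous (T t)
  strongly_continuous : ∀ x, Continuous fun t => T t x

/-- `y` is the derivative at `0+` of the orbit of `x`, that is `y = lim_{h → 0+} (T_h x - x) / h`. -/
def HasOrbitDeriv (T : ℝ≥0 → X →ₗ[ℂ] X) (x y : X) : Prop :=
  Tendsto (fun h : ℝ≥0 => ((h : ℝ) : ℂ)⁻¹ • (T h x - x)) (𝓝[>] 0) (𝓝 y)

theorem HasOrbitDeriv.unique {T : ℝ≥0 → X →ₗ[ℂ] X} {x y z : X} (h : HasOrbitDeriv T x y)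
    (h' : HasOrbitDeriv T x z) : y = z :=
  tendsto_nhds_unique h h'

theorem HasOrbitDeriv.add {T : ℝ≥0 → X →ₗ[ℂ] X} {x y x' y' : X} (h : HasOrbitDeriv T x y)
    (h' : HasOrbitDeriv T x' y') : HasOrbitDeriv T (x + x') (y + y') := by
  refine (Tendsto.add h h').congr fun s => ?_
  rw [map_add, ← smul_add]
  congr 1; abel

theorem HasOrbitDeriv.smul {T : ℝ≥0 → X →ₗ[ℂ] X} {x y : X} (c : ℂ) (h : HasOrbitDeriv T x y) :
    HasOrbitDeriv T (c • x) (c • y) := by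
  refine (Tendsto.const_smul h c).congr fun s => ?_
  rw [map_smul, ← smul_sub, smul_comm]

/-- The infinitesimal generator of `T`: its domain consists of the `x` for which
`lim_{h → 0+} (T_h x - x) / h` exists, and its value at `x` is that limit. -/
noncomputable def generator (T : ℝ≥0 → X →ₗ[ℂ] X) : X →ₗ.[ℂ] X where
  domain :=
    { carrier := {x | ∃ y, HasOrbitDeriv T x y}
      zero_mem' := ⟨0, by simp [HasOrbitDeriv]⟩
      add_mem' := fun ⟨_, h⟩ ⟨_, h'⟩ => ⟨_, h.add h'⟩
      smul_mem' := fun c _ ⟨_, h⟩ => ⟨_, h.smul c⟩ }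
  toFun :=
    { toFun := fun x => x.2.choose
      map_add' := fun x x' =>
        (x + x').2.choose_spec.unique (x.2.choose_spec.add x'.2.choose_spec)
      map_smul' := fun c x => (c • x).2.choose_spec.unique (x.2.choose_spec.smul c) }

theorem hasOrbitDeriv_generator (T : ℝ≥0 → X →ₗ[ℂ] X) (x : (generator T).domain) :
    HasOrbitDeriv T x (generator T x) :=
  x.2.choose_spec

end Semigroup

/-- The failure `ϖ(a, b) = D(ab) - (D a) b - a (D b)` of a partially defined linear operator `D`
to be a derivation, for `a`, `b` and `ab` in the domain of `D`. -/
noncomputable def cocycle (D : HS →ₗ.[ℂ] HS) (a b : HS) (ha : a ∈ D.domain) (hb : b ∈ D.domain)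
    (hab : a * b ∈ D.domain) : HS :=
  D ⟨a * b, hab⟩ - D ⟨a, ha⟩ * b - a * D ⟨b, hb⟩

/-- `a ∈ L²(0, ∞)` is the boundary value `x ↦ [Φ]_{x,0}`:
`h⁻¹ ∫_0^h (∫_0^∞ |[Φ]_{x,y} - a(x)|² dx) dy → 0` as `h → 0+`. -/
def HasBoundaryValueRight (Φ : HS) (a : L2) : Prop :=
  Tendsto (fun h : ℝ => (ENNReal.ofReal h)⁻¹ *
    ∫⁻ y in Ioc 0 h, ∫⁻ x, ‖Φ.bracket (x, y) - a x‖ₑ ^ 2 ∂halfLine) (𝓝[>] 0) (𝓝 0)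

/-- `b ∈ L²(0, ∞)` is the boundary value `y ↦ [Φ]_{0,y}`:
`h⁻¹ ∫_0^h (∫_0^∞ |[Φ]_{x,y} - b(y)|² dy) dx → 0` as `h → 0+`. -/
def HasBoundaryValueLeft (Φ : HS) (b : L2) : Prop :=
  Tendsto (fun h : ℝ => (ENNReal.ofReal h)⁻¹ *
    ∫⁻ x in Ioc 0 h, ∫⁻ y, ‖Φ.bracket (x, y) - b y‖ₑ ^ 2 ∂halfLine) (𝓝[>] 0) (𝓝 0)

/-- The Gelfand–Levitan–Marchenko equation
`φ(x, y) + T(x, y) + ∫_x^∞ T(x, z) φ(z, y) dz = 0` for almost all `0 < x < y`, where `φ` and `T`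
are the kernels of the two operators. -/
def GLM (Φ T : HS) : Prop :=
  ∀ᵐ p ∂quadrant, p.1 < p.2 →
    Φ.bracket p + T.bracket p + ∫ z in Ioi p.1, T.bracket (p.1, z) * Φ.bracket (z, p.2) = 0

/-- The kernel vanishes below the diagonal: `[T]_{x,y} = 0` for almost all `0 < y < x`. -/
def IsUpperTriangular (T : HS) : Prop :=
  ∀ᵐ p ∂quadrant, p.2 < p.1 → T.bracket p = 0

/-- `Γ` is the Hankel operator `(Γ f)(x) = ∫₀^∞ φ(x + y) f(y) dy`. -/
def IsHankel (Γ : L2 →L[ℂ] L2) (φ : ℝ → ℂ) : Prop :=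
  HasKernel Γ fun p => φ (p.1 + p.2)

end Poppe

/-!
# Pöppe's identity and the translation semigroups on Hilbert–Schmidt operators

Write `S_t` for the right translation, `P_t = 1 - S_t S_t†` for the multiplication by the indicator
function of `(0, t]`, and `∂` for the generator of `σ_t(Φ) = S_t† Φ S_t`.

*The algebra.* Hilbert–Schmidt norms are computed in a Hilbert basis (`HS.hasSum_norm_sq`); hence
`𝓛²` is a two-sided ideal of the bounded operators, and multiplying by a bounded, strongly convergent
family of operators is continuous for the Hilbert–Schmidt norm (`HS.tendsto_lmul`,
`HS.tendsto_rmul`). The statements about the two semigroups follow from the strong continuity of the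
translations and from `S_t† S_t = 1`, which makes `σ♯` multiplicative and isometric.

*Boundary values.* If `f` and the limit `g` of its difference quotients both lie in `L²(0, ∞)`, then
`f(s) = e^s ∫_s^∞ e^{-r} (f - g)(r) dr`: this is the formula for the resolvent of the generator of
the left translations at the point `1`. It gives `f(0)` and a quantitative approximation of `f` by
`e^s f(0)` near `0` (`lintegral_sub_exp_mul_traceAtZero_le`). Applied along the diagonals
`s ↦ [Φ]_{u+s,s}` of the kernel of an operator `Φ` in the domain of `∂`, it produces the boundary
value of `[Φ]` on the axis (`exists_trace`).

*The cocycle.* Since `σ_h(ΦΨ) - σ_h(Φ) σ_h(Ψ) = σ_h(Φ P_h Ψ)`, the failure of the Leibniz rule is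
`lim h⁻¹ Φ P_h Ψ`. An operator `Φ` with boundary value `a` satisfies
`h^{-1/2} Φ P_h - a ⊗ h^{-1/2} 1_{(0,h]} → 0` in Hilbert–Schmidt norm, and likewise on the left, so
that `h⁻¹ Φ P_h Ψ` tends to the rank one operator formed from the two boundary values
(`HasTraceRight.hsTendsto_mul`, `cocycle_eq_rankOne`). Pöppe's identity follows by multiplying with
`Υ` and `Λ`.

*Hankel operators: finite rank.* A Hankel operator intertwines the translations,
`S_t† Γ = Γ S_t`, so that `Γ†` maps the domain `D₀` of the generator of `S` into the domain `D₁` of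
the generator of `S†`. By the resolvent formula `D₀` has codimension at most one in `D₁`. Hence the
set of the `f` for which `f, Γ₁†f, Γ₂†Γ₁†f, …` all belong to `D₀` has finite codimension in `D₀`, and
because `D₀` is dense its orthogonal complement is finite-dimensional. The generators of `S` and `S†`
differ by a sign on `D₀`, so that for a product `G` of an even number of factors and for such `f` the
vector `G† S_h f - S_h G† f` is `o(h)` (`littleO_commutator`). Therefore `∂G` maps into that
orthogonal complement (`finiteDimensional_range_of_hankel`).

*Hankel operators: the domain.* If the symbols are square-integrable, the kernels `φ(x + y)` have
boundary values by continuity of translation in `L²`, whether or not the operators are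
Hilbert–Schmidt. The difference quotient of `σ` at an even product is a telescoping sum of terms that
contain a factor `h⁻¹ Γ P_h Γ'`, which converges as above (`exists_hsTendsto_prod`).
-/

namespace Poppe

/-! ### Hilbert–Schmidt operators as an operator ideal -/

theorem eLpNorm_two_sq {α : Type*} {m : MeasurableSpace α} {μ : Measure α} (f : α → ℂ) :
    eLpNorm f 2 μ ^ 2 = ∫⁻ x, ‖f x‖ₑ ^ 2 ∂μ := by
  have h := eLpNorm_nnreal_pow_eq_lintegral (μ := μ) (f := f) (p := 2) (by norm_num)
  simpa using h

theorem memLp_two_iff_lintegral {α : Type*} {m : MeasurableSpace α} {μ : Measure α} {f : α → ℂ}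
    (hf : AEStronglyMeasurable f μ) : MemLp f 2 μ ↔ ∫⁻ x, ‖f x‖ₑ ^ 2 ∂μ ≠ ∞ := by
  rw [← eLpNorm_two_sq, MemLp, and_iff_right hf, lt_top_iff_ne_top]
  simp

theorem Lp_enorm_sq {α : Type*} {m : MeasurableSpace α} {μ : Measure α} (f : Lp ℂ 2 μ) :
    ‖f‖ₑ ^ 2 = ∫⁻ x, ‖f x‖ₑ ^ 2 ∂μ := by
  rw [Lp.enorm_def, eLpNorm_two_sq]

theorem toLp_enorm_sq {α : Type*} {m : MeasurableSpace α} {μ : Measure α} {f : α → ℂ}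
    (hf : MemLp f 2 μ) : ‖hf.toLp f‖ₑ ^ 2 = ∫⁻ x, ‖f x‖ₑ ^ 2 ∂μ := by
  rw [Lp.enorm_def, eLpNorm_congr_ae hf.coeFn_toLp, eLpNorm_two_sq]

/-- Integration against a square-integrable row is an inner product. -/
theorem integral_mul_eq_inner {r : ℝ → ℂ} (hr : MemLp r 2 halfLine) (f : L2) :
    ∫ y, r y * f y ∂halfLine = inner ℂ (hr.star.toLp (star r)) f := by
  rw [L2.inner_def]
  refine integral_congr_ae ?_
  filter_upwards [hr.star.coeFn_toLp] with y hy
  rw [hy]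
  simp [mul_comm]

theorem enorm_star_toLp_sq {r : ℝ → ℂ} (hr : MemLp r 2 halfLine) :
    ‖hr.star.toLp (star r)‖ₑ ^ 2 = ∫⁻ y, ‖r y‖ₑ ^ 2 ∂halfLine := by
  rw [toLp_enorm_sq]
  refine lintegral_congr fun y => ?_
  simp

theorem enorm_sq_integral_mul_le {r : ℝ → ℂ} (hr : MemLp r 2 halfLine) (f : L2) :
    ‖∫ y, r y * f y ∂halfLine‖ₑ ^ 2 ≤ (∫⁻ y, ‖r y‖ₑ ^ 2 ∂halfLine) * ‖f‖ₑ ^ 2 := by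
  rw [integral_mul_eq_inner hr, ← enorm_star_toLp_sq hr, ← mul_pow]
  gcongr
  simp only [← ofReal_norm]
  rw [← ENNReal.ofReal_mul (norm_nonneg _)]
  exact ENNReal.ofReal_le_ofReal (norm_inner_le_norm _ _)

/-- Square-integrable kernels define bounded operators. -/
theorem exists_hasKernel {k : ℝ × ℝ → ℂ} (hk : MemLp k 2 quadrant) :
    ∃ T : L2 →L[ℂ] L2, HasKernel T k := by
  have hfin : ∫⁻ p, ‖k p‖ₑ ^ 2 ∂quadrant ≠ ∞ := (memLp_two_iff_lintegral hk.1).1 hk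
  have hprod : ∫⁻ p, ‖k p‖ₑ ^ 2 ∂quadrant =
      ∫⁻ x, ∫⁻ y, ‖k (x, y)‖ₑ ^ 2 ∂halfLine ∂halfLine :=
    lintegral_prod _ (hk.1.enorm.pow_const 2)
  have hrow := memLp_row hk
  have hb : ∀ f : L2, ∫⁻ x, ‖∫ y, k (x, y) * f y ∂halfLine‖ₑ ^ 2 ∂halfLine ≤
      (∫⁻ p, ‖k p‖ₑ ^ 2 ∂quadrant) * ‖f‖ₑ ^ 2 := by
    intro f
    rw [hprod, ← lintegral_mul_const' _ _ (by finiteness)]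
    refine lintegral_mono_ae ?_
    filter_upwards [hrow] with x hx
    exact enorm_sq_integral_mul_le hx f
  have hmem : ∀ f : L2, MemLp (fun x => ∫ y, k (x, y) * f y ∂halfLine) 2 halfLine := by
    intro f
    have hm : AEStronglyMeasurable (fun x => ∫ y, k (x, y) * f y ∂halfLine) halfLine := by
      refine AEStronglyMeasurable.integral_prod_right' (f := fun p => k p * f p.2) ?_
      exact hk.1.mul ((Lp.memLp f).1.comp_quasiMeasurePreserving
        Measure.quasiMeasurePreserving_snd)
    rw [memLp_two_iff_lintegral hm]
    exact ne_top_of_le_ne_top (by finiteness) (hb f)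
  have hint : ∀ f : L2, ∀ᵐ x ∂halfLine, Integrable (fun y => k (x, y) * f y) halfLine := by
    intro f
    filter_upwards [hrow] with x hx
    exact hx.integrable_mul (Lp.memLp f)
  let T₀ : L2 →ₗ[ℂ] L2 :=
    { toFun := fun f => (hmem f).toLp _
      map_add' := fun f g => by
        rw [← MemLp.toLp_add, MemLp.toLp_eq_toLp_iff]
        filter_upwards [hint f, hint g] with x h1 h2
        rw [Pi.add_apply, ← integral_add h1 h2]
        refine integral_congr_ae ?_
        filter_upwards [Lp.coeFn_add f g] with y hy
        rw [hy, Pi.add_apply, mul_add]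
      map_smul' := fun c f => by
        rw [RingHom.id_apply, ← MemLp.toLp_const_smul, MemLp.toLp_eq_toLp_iff]
        refine Eventually.of_forall fun x => ?_
        simp only [Pi.smul_apply, smul_eq_mul]
        rw [← integral_const_mul]
        refine integral_congr_ae ?_
        filter_upwards [Lp.coeFn_smul c f] with y hy
        rw [hy, Pi.smul_apply, smul_eq_mul]; ring }
  refine ⟨T₀.mkContinuous (eLpNorm k 2 quadrant).toReal fun f => ?_, fun f => ?_⟩
  · have h1 : ‖T₀ f‖ₑ ^ 2 ≤ (eLpNorm k 2 quadrant * ‖f‖ₑ) ^ 2 := by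
      rw [mul_pow, eLpNorm_two_sq]
      refine le_trans (le_of_eq ?_) (hb f)
      exact toLp_enorm_sq (hmem f)
    have h2 : ‖T₀ f‖ₑ ≤ eLpNorm k 2 quadrant * ‖f‖ₑ := (ENNReal.pow_le_pow_left_iff two_ne_zero).1 h1
    have h3 := ENNReal.toReal_mono (ENNReal.mul_ne_top hk.2.ne enorm_ne_top) h2
    simpa using h3
  · filter_upwards [hint f, (hmem f).coeFn_toLp] with x h1 h2
    exact ⟨h1, h2⟩

namespace HS

/-- The Hilbert–Schmidt operator given by a bounded operator with a square-integrable kernel. -/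
def mk (T : L2 →L[ℂ] L2) (k : ℝ × ℝ → ℂ) (hk : MemLp k 2 quadrant) (h : HasKernel T k) : HS :=
  ⟨T, k, hk, h⟩

@[simp] theorem op_mk (T : L2 →L[ℂ] L2) (k : ℝ × ℝ → ℂ) (hk : MemLp k 2 quadrant)
    (h : HasKernel T k) : (mk T k hk h).op = T := rfl

@[simp] theorem op_zero : (0 : HS).op = 0 := rfl
@[simp] theorem op_sub (Φ Ψ : HS) : (Φ - Ψ).op = Φ.op - Ψ.op := rfl

theorem op_sum {ι : Type*} (s : Finset ι) (Φ : ι → HS) : (∑ i ∈ s, Φ i).op = ∑ i ∈ s, (Φ i).op := by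
  classical
  induction s using Finset.induction_on with
  | empty => simp
  | insert i s hi ih => rw [Finset.sum_insert hi, Finset.sum_insert hi, op_add, ih]

theorem enorm_sq (Φ : HS) : ‖Φ‖ₑ ^ 2 = ∫⁻ p, ‖Φ.bracket p‖ₑ ^ 2 ∂quadrant := by
  rw [← Lp_enorm_sq, ← ofReal_norm, ← ofReal_norm, norm_def]

theorem enorm_sq_of_kernel {Φ : HS} {k : ℝ × ℝ → ℂ} (hk : MemLp k 2 quadrant)
    (h : HasKernel Φ.op k) : ‖Φ‖ₑ ^ 2 = ∫⁻ p, ‖k p‖ₑ ^ 2 ∂quadrant := by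
  rw [enorm_sq]
  refine lintegral_congr_ae ?_
  filter_upwards [bracket_ae_eq hk h] with p hp
  rw [hp]

theorem bracketₗ_surjective : Function.Surjective bracketₗ := by
  intro K
  obtain ⟨T, hT⟩ := exists_hasKernel (Lp.memLp K)
  exact ⟨mk T K (Lp.memLp K) hT, Lp.ext (bracket_ae_eq (Lp.memLp K) hT)⟩

theorem norm_bracketₗ (Φ : HS) : ‖bracketₗ Φ‖ = ‖Φ‖ := rfl

instance : CompleteSpace HS := by
  have h : Isometry bracketₗ := AddMonoidHomClass.isometry_of_norm bracketₗ norm_bracketₗ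
  have : IsUniformInducing bracketₗ := h.isUniformInducing
  refine (completeSpace_iff_isComplete_range this).2 ?_
  rw [bracketₗ_surjective.range_eq]
  exact isComplete_univ

/-- The operator norm is dominated by the Hilbert–Schmidt norm. -/
theorem norm_op_apply_le (Φ : HS) (f : L2) : ‖Φ.op f‖ ≤ ‖Φ‖ * ‖f‖ := by
  have h : ‖Φ.op f‖ₑ ^ 2 ≤ (‖Φ‖ₑ * ‖f‖ₑ) ^ 2 := by
    have hk := Lp.memLp Φ.bracket
    rw [mul_pow, enorm_sq, lintegral_prod _ (hk.1.enorm.pow_const 2),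
      ← lintegral_mul_const' _ _ (by finiteness), Lp_enorm_sq]
    refine lintegral_mono_ae ?_
    filter_upwards [memLp_row hk, Φ.hasKernel_bracket f] with x hx hx'
    rw [hx'.2]
    exact enorm_sq_integral_mul_le hx f
  have h2 := (ENNReal.pow_le_pow_left_iff two_ne_zero).1 h
  have h3 := ENNReal.toReal_mono (ENNReal.mul_ne_top enorm_ne_top enorm_ne_top) h2
  simpa using h3

theorem norm_op_le (Φ : HS) : ‖Φ.op‖ ≤ ‖Φ‖ :=
  Φ.op.opNorm_le_bound (norm_nonneg _) Φ.norm_op_apply_le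

end HS

theorem countable_of_hilbertBasis {ι : Type*} (b : HilbertBasis ι ℂ L2) : Countable ι := by
  have : Fact ((2 : ℝ≥0∞) ≠ ∞) := ⟨by norm_num⟩
  refine Pairwise.countable_of_isOpen_disjoint (s := fun i => Metric.ball (b i) (1 / 2))
    (fun i j hij => ?_) (fun _ => Metric.isOpen_ball) (fun i => ⟨b i, by simp⟩)
  refine Metric.ball_disjoint_ball ?_
  have h : ‖b i - b j‖ ^ 2 = 2 := by
    rw [@norm_sub_sq ℂ, b.orthonormal.1, b.orthonormal.1, b.orthonormal.2 hij]
    norm_num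
  rw [dist_eq_norm]
  nlinarith [norm_nonneg (b i - b j)]

theorem tsum_enorm_inner_sq {ι : Type*} (b : HilbertBasis ι ℂ L2) (r : L2) :
    ∑' i, ‖inner ℂ r (b i)‖ₑ ^ 2 = ‖r‖ₑ ^ 2 := by
  have h := b.hasSum_inner_mul_inner r r
  have h' : HasSum (fun i => ‖inner ℂ r (b i)‖ ^ 2) (‖r‖ ^ 2) := by
    have := Complex.hasSum_re h
    convert this using 1
    · ext i
      rw [← inner_conj_symm (b i) r, Complex.mul_conj, Complex.normSq_eq_norm_sq,
        Complex.ofReal_re]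
    · rw [inner_self_eq_norm_sq_to_K]; norm_cast
  have e : ∀ z : ℂ, ‖z‖ₑ ^ 2 = ENNReal.ofReal (‖z‖ ^ 2) := fun z => by
    rw [ENNReal.ofReal_pow (norm_nonneg _), ofReal_norm]
  simp only [e]
  rw [← ENNReal.ofReal_tsum_of_nonneg (fun i => by positivity) h'.summable, h'.tsum_eq,
    ENNReal.ofReal_pow (norm_nonneg _), ofReal_norm]

namespace HS

/-- The Hilbert–Schmidt norm in terms of a Hilbert basis: Parseval on each row of the kernel. -/
theorem enorm_sq_eq_tsum {ι : Type*} (b : HilbertBasis ι ℂ L2) (Φ : HS) :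
    ‖Φ‖ₑ ^ 2 = ∑' i, ‖Φ.op (b i)‖ₑ ^ 2 := by
  have := countable_of_hilbertBasis b
  have hk := Lp.memLp Φ.bracket
  have h1 : ∀ i, ‖Φ.op (b i)‖ₑ ^ 2 = ∫⁻ x, ‖Φ.op (b i) x‖ₑ ^ 2 ∂halfLine := fun i => Lp_enorm_sq _
  simp only [h1]
  rw [← lintegral_tsum fun i => ((Lp.memLp (Φ.op (b i))).1.enorm.pow_const 2), enorm_sq,
    lintegral_prod _ (hk.1.enorm.pow_const 2)]
  refine lintegral_congr_ae ?_
  filter_upwards [memLp_row hk, ae_all_iff.2 fun i => Φ.hasKernel_bracket (b i)] with x hx hx'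
  rw [← enorm_star_toLp_sq hx, ← tsum_enorm_inner_sq b]
  refine tsum_congr fun i => ?_
  rw [(hx' i).2, integral_mul_eq_inner hx]

theorem hasSum_norm_sq {ι : Type*} (b : HilbertBasis ι ℂ L2) (Φ : HS) :
    HasSum (fun i => ‖Φ.op (b i)‖ ^ 2) (‖Φ‖ ^ 2) := by
  have h := enorm_sq_eq_tsum b Φ
  have e : ∀ i, ‖Φ.op (b i)‖ₑ ^ 2 = ENNReal.ofReal (‖Φ.op (b i)‖ ^ 2) := fun i => by
    rw [ENNReal.ofReal_pow (norm_nonneg _), ofReal_norm]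
  have hs : Summable (fun i => ‖Φ.op (b i)‖ ^ 2) := by
    have hne : ∑' i, ENNReal.ofReal (‖Φ.op (b i)‖ ^ 2) ≠ ∞ := by
      simp only [← e]; rw [← h]; finiteness
    have := ENNReal.summable_toReal hne
    simpa [ENNReal.toReal_ofReal (sq_nonneg _)] using this
  have h2 : ENNReal.ofReal (‖Φ‖ ^ 2) = ENNReal.ofReal (∑' i, ‖Φ.op (b i)‖ ^ 2) := by
    rw [ENNReal.ofReal_tsum_of_nonneg (fun i => by positivity) hs]
    simp only [← e]
    rw [← h, ENNReal.ofReal_pow (norm_nonneg _), ofReal_norm]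
  have h3 : ‖Φ‖ ^ 2 = ∑' i, ‖Φ.op (b i)‖ ^ 2 :=
    (ENNReal.ofReal_eq_ofReal_iff (by positivity) (tsum_nonneg fun i => by positivity)).1 h2
  rw [h3]
  exact hs.hasSum

theorem hasKernel_rankOne (a b : L2) :
    HasKernel (InnerProductSpace.rankOne ℂ a b) fun p => a p.1 * star (b p.2) := by
  intro f
  have hb : MemLp (fun y => star (b y)) 2 halfLine := (Lp.memLp b).star
  filter_upwards [Lp.coeFn_smul (inner ℂ b f) a] with x hx
  simp only [mul_assoc]
  refine ⟨(hb.integrable_mul (Lp.memLp f)).const_mul (a x), ?_⟩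
  rw [InnerProductSpace.rankOne_apply, hx, integral_const_mul, L2.inner_def]
  simp [mul_comm]

theorem memLp_rankOne (a b : L2) :
    MemLp (fun p : ℝ × ℝ => a p.1 * star (b p.2)) 2 quadrant := by
  have hm : AEStronglyMeasurable (fun p : ℝ × ℝ => a p.1 * star (b p.2)) quadrant :=
    ((Lp.memLp a).1.comp_quasiMeasurePreserving Measure.quasiMeasurePreserving_fst).mul
      ((Lp.memLp b).star.1.comp_quasiMeasurePreserving Measure.quasiMeasurePreserving_snd)
  rw [memLp_two_iff_integrable_sq_norm hm]
  have := ((memLp_two_iff_integrable_sq_norm (Lp.memLp a).1).1 (Lp.memLp a)).mul_prod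
    ((memLp_two_iff_integrable_sq_norm (Lp.memLp b).1).1 (Lp.memLp b))
  simpa only [norm_mul, mul_pow, norm_star] using this

/-- The rank one operator `f ↦ ⟪b, f⟫ a`, with kernel `a(x) conj b(y)`. -/
noncomputable def rankOne (a b : L2) : HS :=
  mk (InnerProductSpace.rankOne ℂ a b) _ (memLp_rankOne a b) (hasKernel_rankOne a b)

@[simp] theorem op_rankOne (a b : L2) : (rankOne a b).op = InnerProductSpace.rankOne ℂ a b := rfl

/-- A bounded operator whose values on a Hilbert basis are square-summable is Hilbert–Schmidt. -/
theorem exists_of_summable {ι : Type*} (b : HilbertBasis ι ℂ L2) {T : L2 →L[ℂ] L2}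
    (hT : Summable fun i => ‖T (b i)‖ ^ 2) : ∃ Φ : HS, Φ.op = T := by
  classical
  have hfin : ∀ s : Finset ι, ‖∑ i ∈ s, rankOne (T (b i)) (b i)‖ ^ 2 = ∑ i ∈ s, ‖T (b i)‖ ^ 2 := by
    intro s
    rw [← (hasSum_norm_sq b _).tsum_eq, tsum_eq_sum (s := s)]
    · refine Finset.sum_congr rfl fun j hj => ?_
      rw [op_sum, sum_apply]
      simp only [op_rankOne, InnerProductSpace.rankOne_apply,
        orthonormal_iff_ite.1 b.orthonormal, ite_smul, one_smul, zero_smul]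
      simp [hj]
    · intro j hj
      rw [op_sum, sum_apply]
      simp only [op_rankOne, InnerProductSpace.rankOne_apply,
        orthonormal_iff_ite.1 b.orthonormal, ite_smul, one_smul, zero_smul]
      simp [hj]
  have hsum : Summable fun i => rankOne (T (b i)) (b i) := by
    rw [summable_iff_vanishing_norm]
    intro ε hε
    obtain ⟨s, hs⟩ := summable_iff_vanishing_norm.1 hT (ε ^ 2) (by positivity)
    refine ⟨s, fun t ht => ?_⟩
    have := hs t ht
    rw [← hfin, Real.norm_of_nonneg (by positivity)] at this
    exact lt_of_pow_lt_pow_left₀ 2 hε.le this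
  refine ⟨∑' i, rankOne (T (b i)) (b i), ContinuousLinearMap.ext fun f => ?_⟩
  have hcont : Continuous fun Φ : HS => Φ.op f := by
    let L : HS →ₗ[ℂ] L2 :=
      { toFun := fun Φ => Φ.op f
        map_add' := fun _ _ => rfl
        map_smul' := fun _ _ => rfl }
    exact (L.mkContinuous ‖f‖ fun Φ => by
      rw [mul_comm]; exact Φ.norm_op_apply_le f).continuous
  have h1 : Tendsto (fun s : Finset ι => (∑ i ∈ s, rankOne (T (b i)) (b i)).op f) atTop
      (𝓝 ((∑' i, rankOne (T (b i)) (b i)).op f)) :=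
    (hcont.tendsto _).comp hsum.hasSum
  have h2 : HasSum (fun i => T (b.repr f i • b i)) (T f) :=
    (b.hasSum_repr f).mapL T
  refine tendsto_nhds_unique h1 (Tendsto.congr (fun s => ?_) h2)
  rw [op_sum, sum_apply]
  refine Finset.sum_congr rfl fun i _ => ?_
  simp [b.repr_apply_apply]

theorem exists_basis : ∃ (ι : Type) (_ : HilbertBasis ι ℂ L2), True := by
  obtain ⟨w, b, -⟩ := exists_hilbertBasis ℂ L2
  exact ⟨w, b, trivial⟩

theorem exists_op_eq_mul_left (B : L2 →L[ℂ] L2) (Φ : HS) : ∃ Ψ : HS, Ψ.op = B * Φ.op := by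
  obtain ⟨ι, b, -⟩ := exists_basis
  refine exists_of_summable b ?_
  refine Summable.of_nonneg_of_le (fun i => by positivity) (fun i => ?_)
    ((hasSum_norm_sq b Φ).summable.mul_left (‖B‖ ^ 2))
  rw [← mul_pow]
  gcongr
  exact B.le_opNorm _

/-- The left action `Φ ↦ BΦ` of bounded operators on Hilbert–Schmidt operators. -/
noncomputable def lmul (B : L2 →L[ℂ] L2) (Φ : HS) : HS := (exists_op_eq_mul_left B Φ).choose

@[simp] theorem op_lmul (B : L2 →L[ℂ] L2) (Φ : HS) : (lmul B Φ).op = B * Φ.op :=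
  (exists_op_eq_mul_left B Φ).choose_spec

theorem norm_lmul_le (B : L2 →L[ℂ] L2) (Φ : HS) : ‖lmul B Φ‖ ≤ ‖B‖ * ‖Φ‖ := by
  obtain ⟨ι, b, -⟩ := exists_basis
  refine le_of_sq_le_sq ?_ (by positivity)
  rw [mul_pow]
  refine hasSum_le (fun i => ?_) (hasSum_norm_sq b (lmul B Φ))
    ((hasSum_norm_sq b Φ).mul_left (‖B‖ ^ 2))
  rw [← mul_pow, op_lmul]
  gcongr
  exact B.le_opNorm _

theorem memLp_adj {k : ℝ × ℝ → ℂ} (hk : MemLp k 2 quadrant) :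
    MemLp (fun p : ℝ × ℝ => star (k p.swap)) 2 quadrant :=
  (hk.comp_measurePreserving Measure.measurePreserving_swap).star

theorem hasKernel_adjoint {T : L2 →L[ℂ] L2} {k : ℝ × ℝ → ℂ} (hk : MemLp k 2 quadrant)
    (hT : HasKernel T k) :
    HasKernel (ContinuousLinearMap.adjoint T) fun p => star (k p.swap) := by
  obtain ⟨T', hT'⟩ := exists_hasKernel (memLp_adj hk)
  suffices h : T' = ContinuousLinearMap.adjoint T by rwa [← h]
  rw [ContinuousLinearMap.eq_adjoint_iff]
  intro f g
  rw [L2.inner_def, L2.inner_def]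
  have hF : Integrable (fun p : ℝ × ℝ => k p * (star (f p.1) * g p.2)) quadrant := by
    suffices h : MemLp (fun p : ℝ × ℝ => star (f p.1) * g p.2) 2 quadrant from hk.integrable_mul h
    refine (memLp_rankOne (star f) (star g)).ae_eq ?_
    have hf := (Measure.quasiMeasurePreserving_fst (μ := halfLine) (ν := halfLine)).ae
      (Lp.coeFn_star f)
    have hg := (Measure.quasiMeasurePreserving_snd (μ := halfLine) (ν := halfLine)).ae
      (Lp.coeFn_star g)
    filter_upwards [hf, hg] with p h1 h2
    simp only [h1, h2, Pi.star_apply, star_star]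
  have h1 : ∫ x, inner ℂ (T' f x) (g x) ∂halfLine =
      ∫ y, ∫ x, k (x, y) * (star (f x) * g y) ∂halfLine ∂halfLine := by
    refine integral_congr_ae ?_
    filter_upwards [hT' f] with y hy
    rw [hy.2]
    simp only [RCLike.inner_apply, Prod.swap_prod_mk]
    rw [← integral_conj, ← integral_const_mul]
    congr 1; ext x
    simp; ring
  have h2 : ∫ x, inner ℂ (f x) (T g x) ∂halfLine =
      ∫ x, ∫ y, k (x, y) * (star (f x) * g y) ∂halfLine ∂halfLine := by
    refine integral_congr_ae ?_
    filter_upwards [hT g] with x hx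
    rw [hx.2]
    simp only [RCLike.inner_apply]
    rw [← integral_mul_const]
    congr 1; ext y
    simp; ring
  rw [h1, h2, integral_integral_swap]
  exact hF.swap

/-- The adjoint `Φ†`, with kernel `conj [Φ]_{y,x}`. -/
noncomputable def adj (Φ : HS) : HS :=
  mk (ContinuousLinearMap.adjoint Φ.op) _ (memLp_adj (Lp.memLp Φ.bracket))
    (hasKernel_adjoint (Lp.memLp Φ.bracket) Φ.hasKernel_bracket)

@[simp] theorem op_adj (Φ : HS) : (adj Φ).op = ContinuousLinearMap.adjoint Φ.op := rfl

theorem norm_eq_of_enorm_sq_eq {Φ Ψ : HS} (h : ‖Φ‖ₑ ^ 2 = ‖Ψ‖ₑ ^ 2) : ‖Φ‖ = ‖Ψ‖ := by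
  have h2 : ‖Φ‖ₑ = ‖Ψ‖ₑ := le_antisymm
    ((ENNReal.pow_le_pow_left_iff two_ne_zero).1 h.le)
    ((ENNReal.pow_le_pow_left_iff two_ne_zero).1 h.ge)
  simpa using congrArg ENNReal.toReal h2

theorem lintegral_swap_quadrant (q : ℝ × ℝ → ℝ≥0∞) :
    ∫⁻ p, q p.swap ∂quadrant = ∫⁻ p, q p ∂quadrant := by
  have hmp : MeasurePreserving Prod.swap quadrant quadrant := Measure.measurePreserving_swap
  exact hmp.lintegral_comp_emb MeasurableEquiv.prodComm.measurableEmbedding q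

@[simp] theorem norm_adj (Φ : HS) : ‖adj Φ‖ = ‖Φ‖ := by
  refine norm_eq_of_enorm_sq_eq ?_
  have hk := hasKernel_adjoint (Lp.memLp Φ.bracket) Φ.hasKernel_bracket
  rw [enorm_sq_of_kernel (Φ := adj Φ) (memLp_adj (Lp.memLp Φ.bracket)) hk, enorm_sq,
    ← lintegral_swap_quadrant fun p => ‖Φ.bracket p‖ₑ ^ 2]
  refine lintegral_congr fun p => ?_
  rw [← ofReal_norm, norm_star, ofReal_norm]

theorem adj_sub (Φ Ψ : HS) : adj (Φ - Ψ) = adj Φ - adj Ψ :=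
  op_injective (by simp)

/-- The right action `Φ ↦ ΦB` of bounded operators on Hilbert–Schmidt operators. -/
noncomputable def rmul (Φ : HS) (B : L2 →L[ℂ] L2) : HS :=
  adj (lmul (ContinuousLinearMap.adjoint B) (adj Φ))

@[simp] theorem op_rmul (Φ : HS) (B : L2 →L[ℂ] L2) : (rmul Φ B).op = Φ.op * B := by
  have h : (rmul Φ B).op = star (lmul (star B) (adj Φ)).op := rfl
  have h' : (adj Φ).op = star Φ.op := rfl
  rw [h, op_lmul, h', star_mul, star_star, star_star]

theorem norm_rmul_le (Φ : HS) (B : L2 →L[ℂ] L2) : ‖rmul Φ B‖ ≤ ‖Φ‖ * ‖B‖ := by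
  have h : rmul Φ B = adj (lmul (star B) (adj Φ)) := rfl
  rw [h, norm_adj (lmul (star B) (adj Φ)), mul_comm, ← norm_adj Φ, ← norm_star B]
  exact norm_lmul_le (star B) (adj Φ)

/-- The Hilbert–Schmidt norm is submultiplicative. -/
theorem norm_mul_le' (Φ Ψ : HS) : ‖Φ * Ψ‖ ≤ ‖Φ‖ * ‖Ψ‖ := by
  have h : Φ * Ψ = lmul Φ.op Ψ := op_injective (by simp)
  rw [h]
  exact (norm_lmul_le _ _).trans (by gcongr; exact Φ.norm_op_le)

theorem tendsto_mul {ι : Type*} {l : Filter ι} {Φ Ψ : ι → HS} {Φ₀ Ψ₀ : HS}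
    (h1 : Tendsto Φ l (𝓝 Φ₀)) (h2 : Tendsto Ψ l (𝓝 Ψ₀)) :
    Tendsto (fun i => Φ i * Ψ i) l (𝓝 (Φ₀ * Ψ₀)) := by
  rw [tendsto_iff_norm_sub_tendsto_zero] at h1 ⊢
  have h2' := tendsto_iff_norm_sub_tendsto_zero.1 h2
  have h3 : Tendsto (fun i => ‖Φ i - Φ₀‖ * ‖Ψ i‖ + ‖Φ₀‖ * ‖Ψ i - Ψ₀‖) l (𝓝 0) := by
    simpa using (h1.mul h2.norm).add (h2'.const_mul ‖Φ₀‖)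
  refine squeeze_zero (fun _ => norm_nonneg _) (fun i => ?_) h3
  have e : Φ i * Ψ i - Φ₀ * Ψ₀ = (Φ i - Φ₀) * Ψ i + Φ₀ * (Ψ i - Ψ₀) := by noncomm_ring
  rw [e]
  exact (norm_add_le _ _).trans (add_le_add (norm_mul_le' _ _) (norm_mul_le' _ _))

theorem tendsto_op_apply {ι : Type*} {l : Filter ι} {Φ : ι → HS} {Φ₀ : HS}
    (h : Tendsto Φ l (𝓝 Φ₀)) (f : L2) : Tendsto (fun i => (Φ i).op f) l (𝓝 (Φ₀.op f)) := by
  rw [tendsto_iff_norm_sub_tendsto_zero] at h ⊢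
  refine squeeze_zero (fun _ => norm_nonneg _) (fun i => ?_) (by simpa using h.mul_const ‖f‖)
  have : (Φ i).op f - Φ₀.op f = (Φ i - Φ₀).op f := rfl
  rw [this]
  exact norm_op_apply_le _ _

/-- Left multiplication by a bounded, strongly convergent family of operators converges in
Hilbert–Schmidt norm: dominated convergence along a Hilbert basis. -/
theorem tendsto_lmul_of_strong {ι : Type*} {l : Filter ι} {B : ι → L2 →L[ℂ] L2} {B₀ : L2 →L[ℂ] L2}
    {C : ℝ} (hC : ∀ i, ‖B i‖ ≤ C) (hB : ∀ f, Tendsto (fun i => B i f) l (𝓝 (B₀ f))) (Φ : HS) :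
    Tendsto (fun i => lmul (B i) Φ) l (𝓝 (lmul B₀ Φ)) := by
  obtain ⟨κ, b, -⟩ := exists_basis
  rw [tendsto_iff_norm_sub_tendsto_zero]
  have e : ∀ i, ‖lmul (B i) Φ - lmul B₀ Φ‖ ^ 2 = ∑' j, ‖(B i - B₀) (Φ.op (b j))‖ ^ 2 := by
    intro i
    rw [← (hasSum_norm_sq b _).tsum_eq]
    simp
  have hlim : Tendsto (fun i => ‖lmul (B i) Φ - lmul B₀ Φ‖ ^ 2) l (𝓝 0) := by
    simp only [e]
    have h0 : (0 : ℝ) = ∑' _ : κ, (0 : ℝ) := by simp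
    rw [h0]
    refine tendsto_tsum_of_dominated_convergence
      (bound := fun j => (C + ‖B₀‖) ^ 2 * ‖Φ.op (b j)‖ ^ 2)
      ((hasSum_norm_sq b Φ).summable.mul_left _) (fun j => ?_) (Eventually.of_forall fun i j => ?_)
    · have := (tendsto_iff_norm_sub_tendsto_zero.1 (hB (Φ.op (b j)))).pow 2
      simpa using this
    · rw [Real.norm_of_nonneg (by positivity), ← mul_pow]
      gcongr
      refine (ContinuousLinearMap.le_opNorm _ _).trans ?_
      gcongr
      exact (norm_sub_le _ _).trans (by gcongr; exact hC i)
  have := hlim.sqrt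
  simpa [Real.sqrt_sq (norm_nonneg _)] using this

theorem tendsto_rmul_of_strong {ι : Type*} {l : Filter ι} {B : ι → L2 →L[ℂ] L2} {B₀ : L2 →L[ℂ] L2}
    {C : ℝ} (hC : ∀ i, ‖B i‖ ≤ C)
    (hB : ∀ f, Tendsto (fun i => ContinuousLinearMap.adjoint (B i) f) l
      (𝓝 (ContinuousLinearMap.adjoint B₀ f))) (Φ : HS) :
    Tendsto (fun i => rmul Φ (B i)) l (𝓝 (rmul Φ B₀)) := by
  have h := tendsto_lmul_of_strong (B := fun i => ContinuousLinearMap.adjoint (B i)) (C := C)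
    (fun i => by simpa using hC i) hB (adj Φ)
  rw [tendsto_iff_norm_sub_tendsto_zero] at h ⊢
  refine h.congr fun i => ?_
  rw [rmul, rmul, ← adj_sub, norm_adj]

end HS

/-! ### The translation semigroup -/

theorem norm_shift_apply (t : ℝ≥0) (f : L2) : ‖shift t f‖ = ‖f‖ := by
  have h : shift t f = (memLp_shiftFun t (Lp.memLp f)).toLp _ := rfl
  rw [h, Lp.norm_toLp, eLpNorm_shiftFun t (Lp.memLp f), Lp.norm_def]

@[simp] theorem shiftAdj_mul_shift (t : ℝ≥0) : shiftAdj t * shift t = 1 :=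
  (shift t).norm_map_iff_adjoint_comp_self.1 (norm_shift_apply t)

@[simp] theorem shiftAdj_shift_apply (t : ℝ≥0) (f : L2) : shiftAdj t (shift t f) = f := by
  exact congrArg (fun A : L2 →L[ℂ] L2 => A f) (shiftAdj_mul_shift t)

theorem adjoint_one : ContinuousLinearMap.adjoint (1 : L2 →L[ℂ] L2) = 1 := by
  rw [← ContinuousLinearMap.star_eq_adjoint, star_one]

theorem adjoint_shift (t : ℝ≥0) : ContinuousLinearMap.adjoint (shift t) = shiftAdj t := rfl

theorem adjoint_shiftAdj (t : ℝ≥0) : ContinuousLinearMap.adjoint (shiftAdj t) = shift t :=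
  ContinuousLinearMap.adjoint_adjoint _

theorem norm_shift_le (t : ℝ≥0) : ‖shift t‖ ≤ 1 :=
  (shift t).opNorm_le_bound zero_le_one fun f => by rw [norm_shift_apply, one_mul]

theorem norm_shiftAdj_le (t : ℝ≥0) : ‖shiftAdj t‖ ≤ 1 := by
  rw [shiftAdj, LinearIsometryEquiv.norm_map]
  exact norm_shift_le t

theorem norm_shiftAdj_apply_le (t : ℝ≥0) (f : L2) : ‖shiftAdj t f‖ ≤ ‖f‖ := by
  simpa using (shiftAdj t).le_of_opNorm_le (norm_shiftAdj_le t) f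

theorem shiftAdj_zero : shiftAdj 0 = 1 := by
  ext1 f
  refine Lp.ext ?_
  filter_upwards [shiftAdj_ae 0 f] with x hx
  rw [hx]
  simp

theorem shiftAdj_add (s t : ℝ≥0) : shiftAdj (s + t) = shiftAdj s * shiftAdj t := by
  ext1 f
  refine Lp.ext ?_
  filter_upwards [shiftAdj_ae (s + t) f, shiftAdj_ae s (shiftAdj t f),
    ae_halfLine_of_ae_Ioi s (shiftAdj_ae t f)] with x h1 h2 h3
  rw [h1, mul_apply_eq_comp, h2, h3, NNReal.coe_add, add_assoc]

theorem shift_zero : shift 0 = 1 := by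
  rw [← adjoint_shiftAdj, shiftAdj_zero, adjoint_one]

theorem shift_add (s t : ℝ≥0) : shift (s + t) = shift s * shift t := by
  rw [← adjoint_shiftAdj, ← adjoint_shiftAdj s, ← adjoint_shiftAdj t, add_comm, shiftAdj_add]
  simp only [← ContinuousLinearMap.star_eq_adjoint, star_mul]

/-- Translation is continuous in `L²`, here at time `0`. -/
theorem tendsto_shift_zero (f : L2) : Tendsto (fun t => shift t f) (𝓝 0) (𝓝 f) := by
  have hF : MemLp ((Ioi (0 : ℝ)).indicator f) 2 (volume : Measure ℝ) :=
    (memLp_indicator_iff_restrict measurableSet_Ioi).2 (Lp.memLp f)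
  set F : Lp ℂ 2 (volume : Measure ℝ) := hF.toLp _ with hFdef
  let g : ℝ≥0 → C(ℝ, ℝ) := fun t => ⟨fun x => x - t, by fun_prop⟩
  have hg : Continuous g := ContinuousMap.continuous_of_continuous_uncurry _ (by
    simp only [Function.uncurry_def, g, ContinuousMap.coe_mk]
    fun_prop)
  have hgm : ∀ t, MeasurePreserving (g t) (volume : Measure ℝ) volume := fun t =>
    measurePreserving_sub_right volume (t : ℝ)
  have hlim := Filter.Tendsto.compMeasurePreservingLp (tendsto_const_nhds (x := F) (f := 𝓝 0))
    (hg.tendsto 0) hgm (hgm 0) (by norm_num)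
  have h0 : Lp.compMeasurePreserving (g 0) (hgm 0) F = F := by
    refine Lp.ext ?_
    filter_upwards [Lp.coeFn_compMeasurePreserving F (hgm 0)] with x hx
    rw [hx]; simp [g]
  rw [h0, tendsto_iff_norm_sub_tendsto_zero] at hlim
  rw [tendsto_iff_norm_sub_tendsto_zero]
  refine squeeze_zero (fun _ => norm_nonneg _) (fun t => ?_) hlim
  have h : ‖shift t f - f‖ₑ ≤ ‖Lp.compMeasurePreserving (g t) (hgm t) F - F‖ₑ := by
    rw [← ENNReal.pow_le_pow_left_iff two_ne_zero, Lp_enorm_sq, Lp_enorm_sq]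
    refine le_trans (lintegral_mono_ae ?_) (setLIntegral_le_lintegral (Ioi (0 : ℝ)) _)
    have hFae := hF.coeFn_toLp
    filter_upwards [Lp.coeFn_sub (shift t f) f, shift_ae t f,
      ae_restrict_of_ae (Lp.coeFn_sub (Lp.compMeasurePreserving (g t) (hgm t) F) F),
      ae_restrict_of_ae (Lp.coeFn_compMeasurePreserving F (hgm t)),
      ae_restrict_of_ae hFae,
      ae_restrict_of_ae ((hgm t).quasiMeasurePreserving.ae hFae),
      ae_restrict_mem measurableSet_Ioi] with x h1 h2 h3 h4 h5 h6 h7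
    rw [h1, h3, Pi.sub_apply, Pi.sub_apply, h2, h4, Function.comp_apply, h6, h5]
    refine le_of_eq ?_
    rw [indicator_of_mem h7]
    congr 3
    by_cases hx : x ∈ Ioi (t : ℝ)
    · have : x - t ∈ Ioi (0 : ℝ) := mem_Ioi.2 (sub_pos.2 (mem_Ioi.1 hx))
      simp [shiftFun, g, indicator_of_mem, hx, this]
    · have : ¬ (x - t ∈ Ioi (0 : ℝ)) := fun h => hx (mem_Ioi.2 (sub_pos.1 (mem_Ioi.1 h)))
      simp [shiftFun, g, indicator_of_notMem, hx, this]
  have h3 := ENNReal.toReal_mono enorm_ne_top h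
  simpa using h3

theorem tendsto_shiftAdj_zero (f : L2) : Tendsto (fun t => shiftAdj t f) (𝓝 0) (𝓝 f) := by
  have h := tendsto_iff_norm_sub_tendsto_zero.1 (tendsto_shift_zero f)
  rw [tendsto_iff_norm_sub_tendsto_zero]
  refine squeeze_zero (fun _ => norm_nonneg _) (fun t => ?_) h
  have e : shiftAdj t f - f = -shiftAdj t (shift t f - f) := by
    rw [map_sub, shiftAdj_shift_apply]; abel
  rw [e, norm_neg]
  exact norm_shiftAdj_apply_le _ _

section Semigroup

variable {X : Type*} [NormedAddCommGroup X] [NormedSpace ℂ X]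

/-- A contraction semigroup whose orbits are continuous at time `0` is a `C₀`-semigroup. -/
theorem IsC0Semigroup.of_contraction {T : ℝ≥0 → X →ₗ[ℂ] X} (h0 : T 0 = LinearMap.id)
    (hadd : ∀ s t, T (s + t) = T s ∘ₗ T t) (hnorm : ∀ t x, ‖T t x‖ ≤ ‖x‖)
    (hlim : ∀ x, Tendsto (fun t => T t x) (𝓝 0) (𝓝 x)) : IsC0Semigroup T where
  zero := h0
  add := hadd
  bounded t := ((T t).mkContinuous 1 fun x => by simpa using hnorm t x).continuous
  strongly_continuous x := by
    have key : ∀ s r, ‖T (s + r) x - T s x‖ ≤ ‖T r x - x‖ := fun s r => by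
      rw [hadd, LinearMap.comp_apply, ← map_sub]
      exact hnorm _ _
    rw [continuous_iff_continuousAt]
    intro s
    rw [ContinuousAt, tendsto_iff_norm_sub_tendsto_zero]
    have hd : Tendsto (fun t : ℝ≥0 => nndist t s) (𝓝 s) (𝓝 0) := by
      have : Continuous fun t : ℝ≥0 => nndist t s := by fun_prop
      simpa using this.tendsto s
    have h := (tendsto_iff_norm_sub_tendsto_zero.1 (hlim x)).comp hd
    refine squeeze_zero (fun _ => norm_nonneg _) (fun t => ?_) h
    simp only [Function.comp_apply]
    rcases le_total s t with hst | hst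
    · have e : t = s + nndist t s := by
        apply NNReal.eq
        rw [NNReal.coe_add, coe_nndist, NNReal.dist_eq, abs_of_nonneg (sub_nonneg.2 (NNReal.coe_le_coe.2 hst))]
        ring
      calc ‖T t x - T s x‖ = ‖T (s + nndist t s) x - T s x‖ := by rw [← e]
        _ ≤ _ := key _ _
    · have e : s = t + nndist t s := by
        apply NNReal.eq
        rw [NNReal.coe_add, coe_nndist, NNReal.dist_eq, abs_of_nonpos (sub_nonpos.2 (NNReal.coe_le_coe.2 hst))]
        ring
      calc ‖T t x - T s x‖ = ‖T t x - T (t + nndist t s) x‖ := by rw [← e]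
        _ ≤ _ := by rw [norm_sub_rev]; exact key _ _

theorem HasOrbitDeriv.mem_domain {T : ℝ≥0 → X →ₗ[ℂ] X} {x y : X} (h : HasOrbitDeriv T x y) :
    x ∈ (generator T).domain := ⟨y, h⟩

theorem HasOrbitDeriv.generator_eq {T : ℝ≥0 → X →ₗ[ℂ] X} {x y : X} (h : HasOrbitDeriv T x y)
    (hx : x ∈ (generator T).domain) : generator T ⟨x, hx⟩ = y :=
  (hasOrbitDeriv_generator T ⟨x, hx⟩).unique h

end Semigroup

namespace HS

theorem lmul_sub (B : L2 →L[ℂ] L2) (Φ Ψ : HS) : lmul B (Φ - Ψ) = lmul B Φ - lmul B Ψ :=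
  op_injective (by simp [mul_sub])

theorem rmul_sub (B : L2 →L[ℂ] L2) (Φ Ψ : HS) : rmul (Φ - Ψ) B = rmul Φ B - rmul Ψ B :=
  op_injective (by simp [sub_mul])

/-- Joint continuity of the left action for bounded strongly convergent families. -/
theorem tendsto_lmul {ι : Type*} {l : Filter ι} {B : ι → L2 →L[ℂ] L2} {B₀ : L2 →L[ℂ] L2}
    {C : ℝ} (hC : ∀ i, ‖B i‖ ≤ C) (hB : ∀ f, Tendsto (fun i => B i f) l (𝓝 (B₀ f)))
    {Φ : ι → HS} {Φ₀ : HS} (hΦ : Tendsto Φ l (𝓝 Φ₀)) :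
    Tendsto (fun i => lmul (B i) (Φ i)) l (𝓝 (lmul B₀ Φ₀)) := by
  have h1 := tendsto_lmul_of_strong hC hB Φ₀
  have h2 : Tendsto (fun i => lmul (B i) (Φ i - Φ₀)) l (𝓝 0) := by
    rw [tendsto_zero_iff_norm_tendsto_zero]
    refine squeeze_zero (fun _ => norm_nonneg _) (fun i => ?_)
      (by simpa using (tendsto_iff_norm_sub_tendsto_zero.1 hΦ).const_mul C)
    exact (norm_lmul_le _ _).trans (by gcongr; exact hC i)
  simpa [lmul_sub] using h2.add h1

/-- Joint continuity of the right action for bounded families with strongly convergent adjoints. -/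
theorem tendsto_rmul {ι : Type*} {l : Filter ι} {B : ι → L2 →L[ℂ] L2} {B₀ : L2 →L[ℂ] L2}
    {C : ℝ} (hC : ∀ i, ‖B i‖ ≤ C)
    (hB : ∀ f, Tendsto (fun i => ContinuousLinearMap.adjoint (B i) f) l
      (𝓝 (ContinuousLinearMap.adjoint B₀ f)))
    {Φ : ι → HS} {Φ₀ : HS} (hΦ : Tendsto Φ l (𝓝 Φ₀)) :
    Tendsto (fun i => rmul (Φ i) (B i)) l (𝓝 (rmul Φ₀ B₀)) := by
  have h1 := tendsto_rmul_of_strong hC hB Φ₀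
  have h2 : Tendsto (fun i => rmul (Φ i - Φ₀) (B i)) l (𝓝 0) := by
    rw [tendsto_zero_iff_norm_tendsto_zero]
    refine squeeze_zero (fun _ => norm_nonneg _) (fun i => ?_)
      (by simpa using (tendsto_iff_norm_sub_tendsto_zero.1 hΦ).mul_const C)
    exact (norm_rmul_le _ _).trans (by gcongr; exact hC i)
  simpa [rmul_sub] using h2.add h1

end HS

/-! ### The semigroups on the Hilbert–Schmidt operators -/

theorem sigma_eq (t : ℝ≥0) (Φ : HS) :
    sigma t Φ = HS.lmul (shiftAdj t) (HS.rmul Φ (shift t)) :=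
  HS.op_injective (by rw [sigma_op, HS.op_lmul, HS.op_rmul, mul_assoc])

theorem sigmaSharp_eq (t : ℝ≥0) (Φ : HS) :
    sigmaSharp t Φ = HS.lmul (shift t) (HS.rmul Φ (shiftAdj t)) :=
  HS.op_injective (by rw [sigmaSharp_op, HS.op_lmul, HS.op_rmul, mul_assoc])

theorem norm_lmul_rmul_le {A B : L2 →L[ℂ] L2} (hA : ‖A‖ ≤ 1) (hB : ‖B‖ ≤ 1) (Φ : HS) :
    ‖HS.lmul A (HS.rmul Φ B)‖ ≤ ‖Φ‖ := by
  have h1 := HS.norm_lmul_le A (HS.rmul Φ B)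
  have h2 := HS.norm_rmul_le Φ B
  have h3 : ‖A‖ * ‖HS.rmul Φ B‖ ≤ 1 * ‖HS.rmul Φ B‖ := by gcongr
  have h4 : ‖Φ‖ * ‖B‖ ≤ ‖Φ‖ * 1 := by gcongr
  linarith

theorem norm_sigma_le (t : ℝ≥0) (Φ : HS) : ‖sigma t Φ‖ ≤ ‖Φ‖ := by
  rw [sigma_eq]
  exact norm_lmul_rmul_le (norm_shiftAdj_le t) (norm_shift_le t) Φ

theorem sigma_sigmaSharp (t : ℝ≥0) (Φ : HS) : sigma t (sigmaSharp t Φ) = Φ := by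
  refine HS.op_injective ?_
  rw [sigma_op, sigmaSharp_op]
  simp only [← mul_assoc, shiftAdj_mul_shift, one_mul]
  rw [mul_assoc, shiftAdj_mul_shift, mul_one]

theorem norm_sigmaSharp (t : ℝ≥0) (Φ : HS) : ‖sigmaSharp t Φ‖ = ‖Φ‖ := by
  refine le_antisymm ?_ ?_
  · rw [sigmaSharp_eq]
    exact norm_lmul_rmul_le (norm_shift_le t) (norm_shiftAdj_le t) Φ
  · conv_lhs => rw [← sigma_sigmaSharp t Φ]
    exact norm_sigma_le _ _

theorem lmul_one_rmul_one (Φ : HS) : HS.lmul 1 (HS.rmul Φ 1) = Φ :=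
  HS.op_injective (by simp)

/-- The translations conjugate convergent families to convergent families, as `t → 0`. -/
theorem tendsto_sigma {l : Filter ℝ≥0} (hl : l ≤ 𝓝 0) {Φ : ℝ≥0 → HS} {Φ₀ : HS}
    (h : Tendsto Φ l (𝓝 Φ₀)) : Tendsto (fun t => sigma t (Φ t)) l (𝓝 Φ₀) := by
  simp only [sigma_eq]
  rw [← lmul_one_rmul_one Φ₀]
  refine HS.tendsto_lmul norm_shiftAdj_le (fun f => (tendsto_shiftAdj_zero f).mono_left hl)
    (HS.tendsto_rmul norm_shift_le (fun f => ?_) h)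
  rw [adjoint_one]
  exact (tendsto_shiftAdj_zero f).mono_left hl

theorem tendsto_sigmaSharp_zero (Φ : HS) : Tendsto (fun t => sigmaSharp t Φ) (𝓝 0) (𝓝 Φ) := by
  simp only [sigmaSharp_eq]
  nth_rewrite 2 [← lmul_one_rmul_one Φ]
  refine HS.tendsto_lmul norm_shift_le tendsto_shift_zero
    (HS.tendsto_rmul norm_shiftAdj_le (fun f => ?_) tendsto_const_nhds)
  rw [adjoint_one]
  simp only [adjoint_shiftAdj]
  exact tendsto_shift_zero f

theorem isC0Semigroup_sigma : IsC0Semigroup sigma := by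
  refine IsC0Semigroup.of_contraction ?_ (fun s t => ?_) norm_sigma_le
    fun Φ => tendsto_sigma le_rfl tendsto_const_nhds
  · refine LinearMap.ext fun Φ => HS.op_injective ?_
    rw [sigma_op, shiftAdj_zero, shift_zero, one_mul, mul_one, LinearMap.id_apply]
  · refine LinearMap.ext fun Φ => HS.op_injective ?_
    rw [LinearMap.comp_apply, sigma_op, sigma_op, sigma_op, shiftAdj_add, add_comm s t, shift_add]
    simp only [mul_assoc]

theorem isC0Semigroup_sigmaSharp : IsC0Semigroup sigmaSharp := by
  refine IsC0Semigroup.of_contraction ?_ (fun s t => ?_) (fun t Φ => (norm_sigmaSharp t Φ).le)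
    tendsto_sigmaSharp_zero
  · refine LinearMap.ext fun Φ => HS.op_injective ?_
    rw [sigmaSharp_op, shiftAdj_zero, shift_zero, one_mul, mul_one, LinearMap.id_apply]
  · refine LinearMap.ext fun Φ => HS.op_injective ?_
    rw [LinearMap.comp_apply, sigmaSharp_op, sigmaSharp_op, sigmaSharp_op, shift_add,
      add_comm s t, shiftAdj_add]
    simp only [mul_assoc]

theorem isometry_sigmaSharp (t : ℝ≥0) : Isometry (sigmaSharp t) :=
  AddMonoidHomClass.isometry_of_norm _ (norm_sigmaSharp t)

theorem sigmaSharp_mul (t : ℝ≥0) (Φ Ψ : HS) :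
    sigmaSharp t (Φ * Ψ) = sigmaSharp t Φ * sigmaSharp t Ψ := by
  refine HS.op_injective ?_
  simp only [sigmaSharp_op, HS.op_mul]
  have e : shift t * Φ.op * shiftAdj t * (shift t * Ψ.op * shiftAdj t) =
      shift t * Φ.op * (shiftAdj t * shift t) * Ψ.op * shiftAdj t := by
    simp only [mul_assoc]
  rw [e, shiftAdj_mul_shift, mul_one, mul_assoc (shift t) Φ.op Ψ.op]

theorem HS.mul_smul' (c : ℂ) (Φ Ψ : HS) : Φ * (c • Ψ) = c • (Φ * Ψ) :=
  HS.op_injective (by simp)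

theorem HS.smul_mul' (c : ℂ) (Φ Ψ : HS) : (c • Φ) * Ψ = c • (Φ * Ψ) :=
  HS.op_injective (by simp)

/-- The Leibniz rule for the generator of a semigroup of algebra homomorphisms. -/
theorem hasOrbitDeriv_sigmaSharp_mul {Φ Ψ Φ' Ψ' : HS} (hΦ : HasOrbitDeriv sigmaSharp Φ Φ')
    (hΨ : HasOrbitDeriv sigmaSharp Ψ Ψ') :
    HasOrbitDeriv sigmaSharp (Φ * Ψ) (Φ' * Ψ + Φ * Ψ') := by
  have h0 : Tendsto (fun h : ℝ≥0 => sigmaSharp h Ψ) (𝓝[>] 0) (𝓝 Ψ) :=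
    (tendsto_sigmaSharp_zero Ψ).mono_left nhdsWithin_le_nhds
  refine ((HS.tendsto_mul hΦ h0).add (HS.tendsto_mul (tendsto_const_nhds (x := Φ)) hΨ)).congr
    fun h => ?_
  rw [HS.mul_smul', HS.smul_mul', ← smul_add, sigmaSharp_mul]
  congr 1
  noncomm_ring

theorem bracket_sigma (t : ℝ≥0) (Φ : HS) :
    (sigma t Φ).bracket =ᵐ[quadrant] fun p => Φ.bracket (p.1 + t, p.2 + t) := by
  refine HS.bracket_ae_eq (memLp_kernel_add t (Lp.memLp Φ.bracket)) ?_
  rw [sigma_op]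
  exact Φ.hasKernel_bracket.shiftAdj_mul_mul_shift t

theorem ae_quadrant_add (t : ℝ≥0) {p : ℝ × ℝ → Prop} (h : ∀ᵐ x ∂quadrant, p x) :
    ∀ᵐ x ∂quadrant, p (x.1 + t, x.2 + t) := by
  have h' : ∀ᵐ x ∂((volume.restrict (Ioi (t : ℝ))).prod (volume.restrict (Ioi (t : ℝ)))), p x := by
    rw [← restrict_halfLine, Measure.prod_restrict]; exact ae_restrict_of_ae h
  exact ((measurePreserving_add t).prod (measurePreserving_add t)).quasiMeasurePreserving.ae h'

theorem isUpperTriangular_sigma (t : ℝ≥0) (T : HS) (h : IsUpperTriangular T) :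
    IsUpperTriangular (sigma t T) := by
  filter_upwards [bracket_sigma t T, ae_quadrant_add t h] with p h1 h2 hp
  rw [h1]
  exact h2 (by simpa using hp)

theorem glm_sigma (t : ℝ≥0) (Φ T : HS) (h : GLM Φ T) : GLM (sigma t Φ) (sigma t T) := by
  have hT : ∀ᵐ p ∂quadrant, ∀ᵐ z ∂halfLine,
      (sigma t T).bracket (p.1, z) = T.bracket (p.1 + t, z + t) :=
    Measure.quasiMeasurePreserving_fst.ae (Measure.ae_ae_of_ae_prod (bracket_sigma t T))
  have hΦ : ∀ᵐ p ∂quadrant, ∀ᵐ z ∂halfLine,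
      (sigma t Φ).bracket (z, p.2) = Φ.bracket (z + t, p.2 + t) := by
    have hs : MeasurePreserving Prod.swap quadrant quadrant := Measure.measurePreserving_swap
    exact Measure.quasiMeasurePreserving_snd.ae (Measure.ae_ae_of_ae_prod
      (hs.quasiMeasurePreserving.ae (bracket_sigma t Φ)))
  have hpos : ∀ᵐ p ∂quadrant, 0 < p.1 :=
    Measure.quasiMeasurePreserving_fst.ae (ae_restrict_mem (measurableSet_Ioi (a := (0 : ℝ))))
  filter_upwards [bracket_sigma t T, bracket_sigma t Φ, ae_quadrant_add t h, hT, hΦ, hpos]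
    with p h1 h2 h3 h4 h5 h6 hp
  rw [h1, h2, ← h3 (by simpa using hp)]
  congr 1
  have hle : volume.restrict (Ioi p.1) ≤ halfLine :=
    Measure.restrict_mono (Ioi_subset_Ioi h6.le) le_rfl
  have e : ∫ z in Ioi p.1, (sigma t T).bracket (p.1, z) * (sigma t Φ).bracket (z, p.2) =
      ∫ z in Ioi p.1, T.bracket (p.1 + t, z + t) * Φ.bracket (z + t, p.2 + t) := by
    refine integral_congr_ae ?_
    filter_upwards [ae_mono hle h4, ae_mono hle h5] with z hz1 hz2
    rw [hz1, hz2]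
  rw [e]
  have hmp := (measurePreserving_add_right (volume : Measure ℝ) (t : ℝ)).setIntegral_preimage_emb
    (measurableEmbedding_addRight (t : ℝ))
    (fun z => T.bracket (p.1 + t, z) * Φ.bracket (z, p.2 + t)) (Ioi (p.1 + t))
  simpa using hmp

/-! ### Functions on the half-line with an `L²` derivative -/

/-- The Cauchy–Schwarz inequality, for lower integrals on the right-hand side. -/
theorem enorm_sq_integral_mul_le_mul {μ : Measure ℝ} {r d : ℝ → ℂ}
    (hr : AEStronglyMeasurable r μ) (hd : AEStronglyMeasurable d μ) :
    ‖∫ x, r x * d x ∂μ‖ₑ ^ 2 ≤ (∫⁻ x, ‖r x‖ₑ ^ 2 ∂μ) * ∫⁻ x, ‖d x‖ₑ ^ 2 ∂μ := by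
  have h1 : ‖∫ x, r x * d x ∂μ‖ₑ ≤ ∫⁻ x, (fun x => ‖r x‖ₑ) x * (fun x => ‖d x‖ₑ) x ∂μ := by
    refine (enorm_integral_le_lintegral_enorm _).trans (le_of_eq ?_)
    simp only [enorm_mul]
  have h2 := ENNReal.lintegral_mul_le_Lp_mul_Lq μ
    (p := 2) (q := 2) ((Real.holderConjugate_iff).2 (by norm_num)) hr.enorm hd.enorm
  simp only [ENNReal.rpow_two] at h2
  calc ‖∫ x, r x * d x ∂μ‖ₑ ^ 2 ≤ ((∫⁻ x, ‖r x‖ₑ ^ 2 ∂μ) ^ (1 / 2 : ℝ) *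
        (∫⁻ x, ‖d x‖ₑ ^ 2 ∂μ) ^ (1 / 2 : ℝ)) ^ 2 := by
        gcongr
        exact h1.trans h2
    _ = _ := by
      rw [mul_pow, ← ENNReal.rpow_natCast, ← ENNReal.rpow_natCast, ← ENNReal.rpow_mul,
        ← ENNReal.rpow_mul]
      norm_num

theorem memLp_exp_neg : MemLp (fun x : ℝ => ((Real.exp (-x) : ℝ) : ℂ)) 2 halfLine := by
  have hm : AEStronglyMeasurable (fun x : ℝ => ((Real.exp (-x) : ℝ) : ℂ)) halfLine := by fun_prop
  rw [memLp_two_iff_integrable_sq_norm hm]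
  have h := integrableOn_Ioi_comp_mul_left_iff (fun x => Real.exp (-x)) 0 (a := 2) (by norm_num)
  rw [mul_zero] at h
  refine (h.2 (integrableOn_exp_neg_Ioi 0)).congr (Eventually.of_forall fun x => ?_)
  simp only [Complex.norm_real, Real.norm_eq_abs, Real.abs_exp]
  rw [← Real.exp_nat_mul]
  congr 1
  push_cast; ring

theorem integrable_exp_neg_mul {f : ℝ → ℂ} (hf : MemLp f 2 halfLine) :
    Integrable (fun x => ((Real.exp (-x) : ℝ) : ℂ) * f x) halfLine :=
  memLp_exp_neg.integrable_mul hf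

/-- If the difference quotients of `f` converge to `g` in `L²(0, ∞)` along a sequence, then `f` is
recovered from `f - g` by the resolvent formula `f(c) = e^c ∫_c^∞ e^{-r} (f - g)(r) dr`. -/
theorem ae_eq_exp_mul_integral {f g : ℝ → ℂ} (hf : MemLp f 2 halfLine) (hg : MemLp g 2 halfLine)
    {h : ℕ → ℝ≥0} (hpos : ∀ n, 0 < h n) (h0 : Tendsto h atTop (𝓝 0))
    (hlim : Tendsto (fun n => ∫⁻ s, ‖((h n : ℝ) : ℂ)⁻¹ * (f (s + h n) - f s) - g s‖ₑ ^ 2 ∂halfLine)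
      atTop (𝓝 0)) :
    ∀ᵐ c ∂halfLine, f c = (Real.exp c : ℂ) *
      ∫ r in Ioi c, ((Real.exp (-r) : ℝ) : ℂ) * (f r - g r) := by
  set e : ℝ → ℂ := fun x => ((Real.exp (-x) : ℝ) : ℂ) with he
  set E : ℝ → ℂ := fun x => e x * f x with hE
  have hEi : IntegrableOn E (Ioi 0) := integrable_exp_neg_mul hf
  have hGi : IntegrableOn (fun x => e x * g x) (Ioi 0) := integrable_exp_neg_mul hg
  have hloc : LocallyIntegrable ((Ioi (0 : ℝ)).indicator E) :=
    (hEi.integrable_indicator measurableSet_Ioi).locallyIntegrable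
  have hdiff := LocallyIntegrable.ae_hasDerivAt_integral hloc
  rw [ae_restrict_iff' measurableSet_Ioi]
  filter_upwards [hdiff] with c hc hc0
  have hc0' : (0 : ℝ) < c := hc0
  have hsub : Ioi c ⊆ Ioi (0 : ℝ) := Ioi_subset_Ioi hc0'.le
  set J : ℝ → ℂ := fun x => ∫ s in Ioi x, E s with hJ
  -- the tail integral is differentiable at `c`
  have hJd : HasDerivAt J (-E c) c := by
    have h1 := (hc 0).const_sub (∫ s in Ioi 0, E s)
    rw [indicator_of_mem hc0] at h1
    refine h1.congr_of_eventuallyEq ?_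
    filter_upwards [lt_mem_nhds hc0'] with x hx
    have h2 := intervalIntegral.integral_interval_add_Ioi hEi (hEi.mono_set (Ioi_subset_Ioi hx.le))
    have h3 : ∫ t in (0 : ℝ)..x, (Ioi (0 : ℝ)).indicator E t = ∫ t in (0 : ℝ)..x, E t := by
      rw [intervalIntegral.integral_of_le hx.le, intervalIntegral.integral_of_le hx.le]
      refine setIntegral_congr_fun measurableSet_Ioc fun t ht => ?_
      exact indicator_of_mem (mem_Ioi.2 ht.1) _
    rw [h3, ← h2]
    simp [hJ]
  have hprod : HasDerivAt (fun t : ℝ => (Real.exp t : ℂ) * J (c + t)) (J c - E c) 0 := by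
    have h1 : HasDerivAt (fun t : ℝ => (Real.exp t : ℂ)) (Real.exp 0 : ℝ) 0 :=
      (Real.hasDerivAt_exp 0).ofReal_comp
    have h2 : HasDerivAt (fun t : ℝ => J (c + t)) (-E c) 0 := by
      have : HasDerivAt J (-E c) (c + 0) := by simpa using hJd
      exact this.comp_const_add c 0
    refine (h1.mul h2).congr_deriv ?_
    simp; ring
  have hslope := hprod.tendsto_slope_zero
  have hseq : Tendsto (fun n => (h n : ℝ)) atTop (𝓝[≠] 0) := by
    refine tendsto_nhdsWithin_iff.2 ⟨?_, Eventually.of_forall fun n => ?_⟩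
    · exact (NNReal.tendsto_coe.2 h0)
    · exact (NNReal.coe_pos.2 (hpos n)).ne'
  have hl1 := hslope.comp hseq
  -- the difference quotients tested against `e^{-s}` on `(c, ∞)`
  have hshift : ∀ n, Integrable (fun s => e s * f (s + h n)) (volume.restrict (Ioi c)) := fun n =>
    ((integrable_exp_neg_mul (memLp_add (h n) hf))).mono_measure
      (Measure.restrict_mono hsub le_rfl)
  have hEc : Integrable E (volume.restrict (Ioi c)) := hEi.mono_set hsub
  have hGc : Integrable (fun x => e x * g x) (volume.restrict (Ioi c)) := hGi.mono_set hsub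
  have hval : ∀ n, ∫ s in Ioi c, e s * (((h n : ℝ) : ℂ)⁻¹ * (f (s + h n) - f s) - g s) =
      ((h n : ℝ))⁻¹ • ((Real.exp (0 + h n) : ℂ) * J (c + (0 + h n)) -
        (Real.exp 0 : ℂ) * J (c + 0)) - ∫ s in Ioi c, e s * g s := by
    intro n
    have h1 : ∫ s in Ioi c, e s * f (s + h n) = (Real.exp (h n) : ℂ) * J (c + h n) := by
      have hmp := (measurePreserving_add_right (volume : Measure ℝ) (h n : ℝ)).setIntegral_preimage_emb
        (measurableEmbedding_addRight (h n : ℝ))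
        (fun z => (Real.exp (h n) : ℂ) * E z) (Ioi (c + h n))
      have hJc : J (c + h n) = ∫ s in Ioi (c + h n), E s := rfl
      rw [hJc, ← integral_const_mul, ← hmp]
      simp only [preimage_add_const_Ioi, add_sub_cancel_right]
      refine integral_congr_ae (Eventually.of_forall fun s => ?_)
      simp only [hE, he]
      rw [← mul_assoc, ← Complex.ofReal_mul, ← Real.exp_add]
      congr 3; ring
    have e1 : ∀ s, e s * (((h n : ℝ) : ℂ)⁻¹ * (f (s + h n) - f s) - g s) =
        ((h n : ℝ) : ℂ)⁻¹ * (e s * f (s + h n) - E s) - e s * g s := fun s => by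
      simp only [hE]; ring
    simp only [e1]
    have hi : Integrable (fun s => ((h n : ℝ) : ℂ)⁻¹ * (e s * f (s + h n) - E s))
        (volume.restrict (Ioi c)) := ((hshift n).sub hEc).const_mul _
    rw [integral_sub hi hGc, integral_const_mul, integral_sub (hshift n) hEc, h1]
    simp [hJ]
  have hl2 : Tendsto (fun n => ∫ s in Ioi c,
      e s * (((h n : ℝ) : ℂ)⁻¹ * (f (s + h n) - f s) - g s)) atTop (𝓝 0) := by
    rw [tendsto_zero_iff_enorm_tendsto_zero]
    have hsq : Tendsto (fun n => ‖∫ s in Ioi c,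
        e s * (((h n : ℝ) : ℂ)⁻¹ * (f (s + h n) - f s) - g s)‖ₑ ^ 2) atTop (𝓝 0) := by
      have hfin := (memLp_two_iff_lintegral memLp_exp_neg.1).1 memLp_exp_neg
      have hb := ENNReal.Tendsto.const_mul hlim (Or.inr hfin)
      rw [mul_zero] at hb
      refine tendsto_of_tendsto_of_tendsto_of_le_of_le tendsto_const_nhds hb
        (fun _ => zero_le) fun n => ?_
      have hle : volume.restrict (Ioi c) ≤ halfLine := Measure.restrict_mono hsub le_rfl
      have hd : AEStronglyMeasurable
          (fun s => ((h n : ℝ) : ℂ)⁻¹ * (f (s + h n) - f s) - g s) halfLine :=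
        ((((memLp_add (h n) hf).1.sub hf.1).const_mul _).sub hg.1)
      refine (enorm_sq_integral_mul_le_mul (memLp_exp_neg.1.mono_measure hle)
        (hd.mono_measure hle)).trans ?_
      exact mul_le_mul' (lintegral_mono' hle le_rfl) (lintegral_mono' hle le_rfl)
    have := (ENNReal.continuous_rpow_const (y := 1 / 2)).tendsto 0 |>.comp hsq
    simp only [Function.comp_def] at this
    rw [ENNReal.zero_rpow_of_pos (by norm_num)] at this
    refine this.congr fun n => ?_
    rw [← ENNReal.rpow_natCast, ← ENNReal.rpow_mul]
    norm_num
  simp only [hval] at hl2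
  have hl3 := hl1.sub_const (∫ s in Ioi c, e s * g s)
  simp only [Function.comp_def] at hl3
  have key := tendsto_nhds_unique hl3 hl2
  have hfin : ∫ r in Ioi c, e r * (f r - g r) = E c := by
    have e1 : ∀ r, e r * (f r - g r) = E r - e r * g r := fun r => by simp only [hE]; ring
    simp only [e1]
    rw [integral_sub hEc hGc]
    have : ∫ s in Ioi c, E s = J c := rfl
    rw [this]
    linear_combination key
  rw [hfin]
  simp only [hE, he]
  rw [← mul_assoc, ← Complex.ofReal_mul, ← Real.exp_add]
  simp

/-- The value at `0` of a function `f` with derivative `g`, in terms of `m = f - g`, by the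
resolvent formula. -/
noncomputable def traceAtZero (m : ℝ → ℂ) : ℂ := ∫ r, ((Real.exp (-r) : ℝ) : ℂ) * m r ∂halfLine

/-- Near `0`, a function with an `L²` derivative stays within `O(h)`, in mean square over `(0, h)`,
of `e^s` times its value at `0`. -/
theorem lintegral_sub_exp_mul_traceAtZero_le {f g : ℝ → ℂ} (hf : MemLp f 2 halfLine)
    (hg : MemLp g 2 halfLine) {h : ℕ → ℝ≥0} (hpos : ∀ n, 0 < h n) (h0 : Tendsto h atTop (𝓝 0))
    (hlim : Tendsto (fun n => ∫⁻ s, ‖((h n : ℝ) : ℂ)⁻¹ * (f (s + h n) - f s) - g s‖ₑ ^ 2 ∂halfLine)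
      atTop (𝓝 0)) (r : ℝ) (hr : 0 ≤ r) :
    ∫⁻ s in Ioc 0 r, ‖f s - (Real.exp s : ℂ) * traceAtZero (fun x => f x - g x)‖ₑ ^ 2 ≤
      ENNReal.ofReal (r ^ 2 * Real.exp r ^ 2) * ∫⁻ s in Ioc 0 r, ‖f s - g s‖ₑ ^ 2 := by
  set M := ∫⁻ s in Ioc 0 r, ‖f s - g s‖ₑ ^ 2 with hM
  have hm : MemLp (fun x => f x - g x) 2 halfLine := hf.sub hg
  have hae := ae_eq_exp_mul_integral hf hg hpos h0 hlim
  have hb : ∀ᵐ s ∂(volume.restrict (Ioc 0 r)),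
      ‖f s - (Real.exp s : ℂ) * traceAtZero (fun x => f x - g x)‖ₑ ^ 2 ≤
        ENNReal.ofReal (r * Real.exp r ^ 2) * M := by
    have hae' : ∀ᵐ s ∂(volume.restrict (Ioc 0 r)), f s = (Real.exp s : ℂ) *
        ∫ x in Ioi s, ((Real.exp (-x) : ℝ) : ℂ) * (f x - g x) :=
      ae_mono (Measure.restrict_mono Ioc_subset_Ioi_self le_rfl) hae
    filter_upwards [hae', ae_restrict_mem measurableSet_Ioc] with s hs hsr
    have hi : IntegrableOn (fun x => ((Real.exp (-x) : ℝ) : ℂ) * (f x - g x)) (Ioi 0) :=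
      integrable_exp_neg_mul hm
    have hsplit := intervalIntegral.integral_interval_add_Ioi hi
      (hi.mono_set (Ioi_subset_Ioi hsr.1.le))
    have e1 : f s - (Real.exp s : ℂ) * traceAtZero (fun x => f x - g x) =
        -((Real.exp s : ℂ) * ∫ x in Ioc 0 s, ((Real.exp (-x) : ℝ) : ℂ) * (f x - g x)) := by
      rw [← intervalIntegral.integral_of_le hsr.1.le]
      rw [traceAtZero, ← hsplit]
      linear_combination hs
    have hle : volume.restrict (Ioc 0 s) ≤ halfLine :=
      Measure.restrict_mono Ioc_subset_Ioi_self le_rfl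
    have hcs := enorm_sq_integral_mul_le_mul (memLp_exp_neg.1.mono_measure hle)
      (hm.1.mono_measure hle)
    have h1 : ∫⁻ x in Ioc 0 s, ‖((Real.exp (-x) : ℝ) : ℂ)‖ₑ ^ 2 ≤ ENNReal.ofReal s := by
      have : ∫⁻ x in Ioc 0 s, ‖((Real.exp (-x) : ℝ) : ℂ)‖ₑ ^ 2 ≤ ∫⁻ x in Ioc 0 s, 1 := by
        refine lintegral_mono_ae ?_
        filter_upwards [ae_restrict_mem measurableSet_Ioc] with x hx
        refine pow_le_one₀ zero_le ?_
        rw [← ofReal_norm, ENNReal.ofReal_le_one, Complex.norm_real, Real.norm_eq_abs,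
          Real.abs_exp]
        exact Real.exp_le_one_iff.2 (by linarith [hx.1])
      simpa using this
    have h2 : ∫⁻ x in Ioc 0 s, ‖f x - g x‖ₑ ^ 2 ≤ M :=
      lintegral_mono_set (Ioc_subset_Ioc_right hsr.2)
    rw [e1, enorm_neg, enorm_mul, mul_pow]
    have h3 : ‖(Real.exp s : ℂ)‖ₑ ^ 2 ≤ ENNReal.ofReal (Real.exp r ^ 2) := by
      rw [← ofReal_norm, Complex.norm_real, Real.norm_eq_abs, Real.abs_exp,
        ← ENNReal.ofReal_pow (Real.exp_pos _).le]
      exact ENNReal.ofReal_le_ofReal (by gcongr; exact hsr.2)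
    calc _ ≤ ENNReal.ofReal (Real.exp r ^ 2) * (ENNReal.ofReal r * M) := by
          refine mul_le_mul' h3 (hcs.trans (mul_le_mul' (h1.trans ?_) h2))
          exact ENNReal.ofReal_le_ofReal hsr.2
      _ = _ := by
          rw [mul_comm r, ENNReal.ofReal_mul (by positivity), mul_assoc]
  calc _ ≤ ∫⁻ _ in Ioc 0 r, ENNReal.ofReal (r * Real.exp r ^ 2) * M := lintegral_mono_ae hb
    _ = _ := by
      rw [setLIntegral_const, Real.volume_Ioc, sub_zero]
      rw [mul_right_comm, ← ENNReal.ofReal_mul (by positivity)]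
      congr 2; ring

/-! ### The generators of the translations -/

/-- The orthogonal projection onto `L²(0, t)`. -/
noncomputable def cutoff (t : ℝ≥0) : L2 →L[ℂ] L2 := 1 - shift t * shiftAdj t

theorem cutoff_ae (t : ℝ≥0) (f : L2) :
    ∀ᵐ x ∂halfLine, cutoff t f x = (Ioc 0 (t : ℝ)).indicator f x := by
  have h1 := (measurePreserving_sub t).quasiMeasurePreserving.ae (shiftAdj_ae t f)
  rw [← restrict_halfLine, ae_restrict_iff' measurableSet_Ioi] at h1
  have e : cutoff t f = f - shift t (shiftAdj t f) := rfl
  filter_upwards [h1, shift_ae t (shiftAdj t f), Lp.coeFn_sub f (shift t (shiftAdj t f)),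
    ae_restrict_mem measurableSet_Ioi] with x h2 h3 h4 h5
  rw [e, h4, Pi.sub_apply, h3]
  by_cases hx : x ∈ Ioi (t : ℝ)
  · have : x ∉ Ioc 0 (t : ℝ) := fun h => absurd h.2 (not_le.2 hx)
    simp [shiftFun, hx, this, h2 hx]
  · have : x ∈ Ioc 0 (t : ℝ) := ⟨h5, not_lt.1 hx⟩
    simp [shiftFun, hx, this]

theorem enorm_cutoff_sq (t : ℝ≥0) (f : L2) :
    ‖cutoff t f‖ₑ ^ 2 = ∫⁻ x in Ioc 0 (t : ℝ), ‖f x‖ₑ ^ 2 := by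
  rw [Lp_enorm_sq]
  have h : ∀ᵐ x ∂halfLine, ‖cutoff t f x‖ₑ ^ 2 =
      (Ioc 0 (t : ℝ)).indicator (fun x => ‖f x‖ₑ ^ 2) x := by
    filter_upwards [cutoff_ae t f] with x hx
    rw [hx]
    by_cases h : x ∈ Ioc 0 (t : ℝ) <;> simp [h]
  rw [lintegral_congr_ae h, lintegral_indicator measurableSet_Ioc,
    Measure.restrict_restrict measurableSet_Ioc, inter_eq_left.2 Ioc_subset_Ioi_self]

theorem tendsto_cutoff (f : L2) : Tendsto (fun t => cutoff t f) (𝓝 0) (𝓝 0) := by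
  have e : ∀ t, cutoff t f = (f - shift t f) + shift t (f - shiftAdj t f) := fun t => by
    have : cutoff t f = f - shift t (shiftAdj t f) := rfl
    rw [this, map_sub]; abel
  simp only [e]
  have h1 : Tendsto (fun t => f - shift t f) (𝓝 0) (𝓝 0) := by
    simpa using (tendsto_shift_zero f).const_sub f
  have h2 : Tendsto (fun t => shift t (f - shiftAdj t f)) (𝓝 0) (𝓝 0) := by
    rw [tendsto_zero_iff_norm_tendsto_zero]
    simp only [norm_shift_apply]
    rw [← tendsto_zero_iff_norm_tendsto_zero]
    simpa using (tendsto_shiftAdj_zero f).const_sub f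
  simpa using h1.add h2

/-- The domain of the generator of the right translations: the functions with an `L²` derivative
that vanish at `0`. -/
noncomputable def shiftDomain : Submodule ℂ L2 :=
  (generator fun t => (shift t).toLinearMap).domain

/-- The domain of the generator of the left translations: the functions with an `L²` derivative,
without condition at `0`. -/
noncomputable def shiftAdjDomain : Submodule ℂ L2 :=
  (generator fun t => (shiftAdj t).toLinearMap).domain

/-- The generators of the right and of the left translations differ by a sign on the smaller domain.
-/
theorem HasOrbitDeriv.shiftAdj_of_shift {f f' : L2}
    (h : HasOrbitDeriv (fun t => (shift t).toLinearMap) f f') :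
    HasOrbitDeriv (fun t => (shiftAdj t).toLinearMap) f (-f') := by
  have h1 : Tendsto (fun t : ℝ≥0 => shiftAdj t (((t : ℝ) : ℂ)⁻¹ • (shift t f - f) - f'))
      (𝓝[>] 0) (𝓝 0) := by
    rw [tendsto_zero_iff_norm_tendsto_zero]
    exact squeeze_zero (fun _ => norm_nonneg _) (fun t => norm_shiftAdj_apply_le _ _)
      (tendsto_iff_norm_sub_tendsto_zero.1 h)
  have h2 := (tendsto_shiftAdj_zero f').mono_left (nhdsWithin_le_nhds (s := Ioi 0))
  have h3 := (h1.add h2).neg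
  rw [zero_add] at h3
  refine h3.congr fun t => ?_
  simp only [ContinuousLinearMap.coe_coe, map_sub, map_smul, shiftAdj_shift_apply]
  rw [← neg_sub f (shiftAdj t f), smul_neg]
  congr 1
  abel

theorem enorm_div_sub_sq (t : ℝ≥0) (f g : L2) :
    ‖((t : ℝ) : ℂ)⁻¹ • (shiftAdj t f - f) - g‖ₑ ^ 2 =
      ∫⁻ s, ‖((t : ℝ) : ℂ)⁻¹ * (f (s + t) - f s) - g s‖ₑ ^ 2 ∂halfLine := by
  rw [Lp_enorm_sq]
  refine lintegral_congr_ae ?_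
  filter_upwards [Lp.coeFn_sub (((t : ℝ) : ℂ)⁻¹ • (shiftAdj t f - f)) g,
    Lp.coeFn_smul (((t : ℝ) : ℂ)⁻¹) (shiftAdj t f - f), Lp.coeFn_sub (shiftAdj t f) f,
    shiftAdj_ae t f] with x h1 h2 h3 h4
  rw [h1, Pi.sub_apply, h2, Pi.smul_apply, h3, Pi.sub_apply, h4, smul_eq_mul]

theorem tendsto_inv_natCast_succ :
    Tendsto (fun n : ℕ => ((n : ℝ≥0) + 1)⁻¹) atTop (𝓝 0) := by
  rw [← NNReal.tendsto_coe]
  simpa using tendsto_one_div_add_atTop_nhds_zero_nat (𝕜 := ℝ)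

theorem tendsto_inv_natCast_succ' :
    Tendsto (fun n : ℕ => ((n : ℝ≥0) + 1)⁻¹) atTop (𝓝[>] 0) :=
  tendsto_nhdsWithin_iff.2 ⟨tendsto_inv_natCast_succ, Eventually.of_forall fun n => by
    simp only [mem_Ioi]; positivity⟩

/-- The right translations have deficiency index one: a function in the domain of the left
translations belongs to the domain of the right translations once its value at `0` vanishes. -/
theorem mem_shiftDomain_of_inner_eq_zero {f g : L2}
    (h : HasOrbitDeriv (fun t => (shiftAdj t).toLinearMap) f g)
    (h0 : inner ℂ (memLp_exp_neg.toLp _) (f - g) = 0) : f ∈ shiftDomain := by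
  have htr : traceAtZero (fun x => f x - g x) = 0 := by
    rw [← h0, L2.inner_def, traceAtZero]
    refine integral_congr_ae ?_
    filter_upwards [memLp_exp_neg.coeFn_toLp, Lp.coeFn_sub f g] with x h1 h2
    rw [h1, h2]
    simp only [RCLike.inner_apply, Complex.conj_ofReal, Pi.sub_apply, mul_comm]
  have hseq := (tendsto_iff_norm_sub_tendsto_zero.1 h).comp tendsto_inv_natCast_succ'
  have hlim : Tendsto (fun n : ℕ => ∫⁻ s, ‖((((n : ℝ≥0) + 1)⁻¹ : ℝ≥0) : ℂ)⁻¹ *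
      (f (s + ((n : ℝ≥0) + 1)⁻¹) - f s) - g s‖ₑ ^ 2 ∂halfLine) atTop (𝓝 0) := by
    have h1 := (ENNReal.tendsto_ofReal hseq)
    have h2 := ENNReal.Tendsto.pow (n := 2) h1
    simp only [ENNReal.ofReal_zero, zero_pow two_ne_zero] at h2
    refine h2.congr fun n => ?_
    rw [Function.comp_apply, ofReal_norm]
    exact enorm_div_sub_sq _ f g
  have hbound : ∀ t : ℝ≥0, ‖cutoff t f‖ ≤ t * Real.exp t * ‖cutoff t (f - g)‖ := by
    intro t
    have h1 := lintegral_sub_exp_mul_traceAtZero_le (Lp.memLp f) (Lp.memLp g)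
      (h := fun n : ℕ => ((n : ℝ≥0) + 1)⁻¹) (fun n => by positivity) tendsto_inv_natCast_succ
      hlim t t.coe_nonneg
    rw [htr] at h1
    simp only [mul_zero, sub_zero] at h1
    have h2 : ∫⁻ s in Ioc 0 (t : ℝ), ‖f s - g s‖ₑ ^ 2 =
        ∫⁻ s in Ioc 0 (t : ℝ), ‖(f - g : L2) s‖ₑ ^ 2 := by
      refine lintegral_congr_ae ?_
      filter_upwards [ae_mono (Measure.restrict_mono Ioc_subset_Ioi_self le_rfl)
        (Lp.coeFn_sub f g)] with x hx
      rw [hx, Pi.sub_apply]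
    rw [h2, ← enorm_cutoff_sq, ← enorm_cutoff_sq] at h1
    have h3 := ENNReal.toReal_mono (by finiteness) h1
    simp only [ENNReal.toReal_mul, ENNReal.toReal_pow, toReal_enorm] at h3
    rw [ENNReal.toReal_ofReal (by positivity), ← mul_pow, ← mul_pow] at h3
    exact le_of_sq_le_sq h3 (by positivity)
  have hsmall : Tendsto (fun t : ℝ≥0 => ((t : ℝ) : ℂ)⁻¹ • cutoff t f) (𝓝[>] 0) (𝓝 0) := by
    rw [tendsto_zero_iff_norm_tendsto_zero]
    have h1 : Tendsto (fun t : ℝ≥0 => Real.exp t * ‖cutoff t (f - g)‖) (𝓝[>] 0) (𝓝 0) := by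
      have hc : Continuous fun t : ℝ≥0 => Real.exp t := by fun_prop
      have := (hc.tendsto 0).mul (tendsto_cutoff (f - g)).norm
      simp only [norm_zero, mul_zero] at this
      exact this.mono_left nhdsWithin_le_nhds
    refine squeeze_zero' (Eventually.of_forall fun _ => norm_nonneg _) ?_ h1
    filter_upwards [self_mem_nhdsWithin] with t ht
    have ht' : (0 : ℝ) < t := NNReal.coe_pos.2 ht
    rw [norm_smul, norm_inv, Complex.norm_real, Real.norm_of_nonneg ht'.le, inv_mul_le_iff₀ ht']
    calc _ ≤ _ := hbound t
      _ = _ := by ring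
  refine ⟨-g, ?_⟩
  have h1 : Tendsto (fun t : ℝ≥0 => shift t (((t : ℝ) : ℂ)⁻¹ • (shiftAdj t f - f) - g))
      (𝓝[>] 0) (𝓝 0) := by
    rw [tendsto_zero_iff_norm_tendsto_zero]
    simp only [norm_shift_apply]
    exact tendsto_iff_norm_sub_tendsto_zero.1 h
  have h2 := (tendsto_shift_zero g).mono_left (nhdsWithin_le_nhds (s := Ioi 0))
  have h3 := ((h1.add h2).add hsmall).neg
  rw [zero_add, add_zero] at h3
  refine h3.congr fun t => ?_
  have e : cutoff t f = f - shift t (shiftAdj t f) := rfl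
  simp only [ContinuousLinearMap.coe_coe, map_sub, map_smul, e, smul_sub]
  abel

/-! ### Boundary values of kernels differentiable along the diagonal -/

theorem enorm_add_sq_le (x y : ℂ) : ‖x + y‖ₑ ^ 2 ≤ 2 * ‖x‖ₑ ^ 2 + 2 * ‖y‖ₑ ^ 2 := by
  have h : ‖x + y‖ ^ 2 ≤ 2 * ‖x‖ ^ 2 + 2 * ‖y‖ ^ 2 := by
    have := norm_add_le x y
    nlinarith [norm_nonneg (x + y), norm_nonneg x, norm_nonneg y, sq_nonneg (‖x‖ - ‖y‖)]
  have h2 := ENNReal.ofReal_le_ofReal h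
  rw [ENNReal.ofReal_add (by positivity) (by positivity), ENNReal.ofReal_mul (by norm_num),
    ENNReal.ofReal_mul (by norm_num), ENNReal.ofReal_pow (norm_nonneg _),
    ENNReal.ofReal_pow (norm_nonneg _), ENNReal.ofReal_pow (norm_nonneg _)] at h2
  simpa using h2

/-- Averages over `(0, h)` of a function that tends to `0` at `0` tend to `0`. -/
theorem tendsto_average_zero {ω : ℝ → ℝ≥0∞} (hω : Tendsto ω (𝓝[>] 0) (𝓝 0)) :
    Tendsto (fun h : ℝ => (ENNReal.ofReal h)⁻¹ * ∫⁻ y in Ioc 0 h, ω y) (𝓝[>] 0) (𝓝 0) := by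
  rw [ENNReal.tendsto_nhds_zero] at hω ⊢
  intro ε hε
  obtain ⟨δ, hδ, h⟩ := mem_nhdsGT_iff_exists_Ioo_subset.1 (hω ε hε)
  filter_upwards [Ioo_mem_nhdsGT hδ] with t ht
  have h1 : ∫⁻ y in Ioc 0 t, ω y ≤ ∫⁻ _ in Ioc 0 t, ε :=
    setLIntegral_mono measurable_const fun y hy => h ⟨hy.1, hy.2.trans_lt ht.2⟩
  rw [setLIntegral_const, Real.volume_Ioc, sub_zero] at h1
  calc _ ≤ (ENNReal.ofReal t)⁻¹ * (ε * ENNReal.ofReal t) := by gcongr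
    _ = ε := by
      rw [mul_comm ε, ← mul_assoc, ENNReal.inv_mul_cancel (by simpa using ht.1)
        ENNReal.ofReal_ne_top, one_mul]

theorem lintegral_add_halfLine {s : ℝ} (hs : 0 ≤ s) {q : ℝ → ℝ≥0∞} (hq : Measurable q) :
    ∫⁻ u, q (u + s) ∂halfLine = ∫⁻ x in Ioi s, q x :=
  (measurePreserving_add ⟨s, hs⟩).lintegral_comp hq

/-- The quadrant is swept out by the diagonal half-lines that start at its two edges. -/
theorem lintegral_quadrant_eq {q : ℝ × ℝ → ℝ≥0∞} (hq : Measurable q) :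
    ∫⁻ y, ∫⁻ x, q (x, y) ∂halfLine ∂halfLine =
      (∫⁻ u, ∫⁻ s, q (u + s, s) ∂halfLine ∂halfLine) +
        ∫⁻ u, ∫⁻ s, q (s, u + s) ∂halfLine ∂halfLine := by
  have hle : MeasurableSet {p : ℝ × ℝ | p.1 ≤ p.2} := measurableSet_le measurable_fst measurable_snd
  have h1 : ∀ᵐ y ∂halfLine, ∫⁻ x, q (x, y) ∂halfLine =
      (∫⁻ u, q (u + y, y) ∂halfLine) +
        ∫⁻ x, {p : ℝ × ℝ | p.1 ≤ p.2}.indicator q (x, y) ∂halfLine := by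
    filter_upwards [ae_restrict_mem measurableSet_Ioi] with y hy
    have hy' : (0 : ℝ) < y := hy
    have e : ∫⁻ u, q (u + y, y) ∂halfLine = ∫⁻ x in Ioi y, q (x, y) :=
      lintegral_add_halfLine hy'.le (q := fun x => q (x, y)) (by fun_prop)
    rw [← lintegral_add_compl (μ := halfLine) (fun x => q (x, y)) (measurableSet_Ioi (a := y)),
      Measure.restrict_restrict measurableSet_Ioi, inter_eq_left.2 (Ioi_subset_Ioi hy'.le), ← e,
      ← lintegral_indicator measurableSet_Ioi.compl]
    congr 1
    refine lintegral_congr fun x => ?_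
    by_cases hx : x ≤ y
    · rw [indicator_of_mem (by simpa using hx), indicator_of_mem (by simpa using hx)]
    · rw [indicator_of_notMem (by simpa using hx), indicator_of_notMem (by simpa using hx)]
  have hm : Measurable fun p : ℝ × ℝ => q (p.1 + p.2, p.2) := by fun_prop
  have hm' : Measurable fun p : ℝ × ℝ => q (p.2, p.1 + p.2) := by fun_prop
  have hmy : Measurable fun y => ∫⁻ u, q (u + y, y) ∂halfLine := hm.lintegral_prod_left'
  rw [lintegral_congr_ae h1, lintegral_add_left hmy]
  congr 1
  · exact lintegral_lintegral_swap (f := fun y u => q (u + y, y))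
      (hm.comp measurable_swap).aemeasurable
  · rw [lintegral_lintegral_swap (f := fun y x => {p : ℝ × ℝ | p.1 ≤ p.2}.indicator q (x, y))
      ((hq.indicator hle).comp measurable_swap).aemeasurable,
      lintegral_lintegral_swap (f := fun u s => q (s, u + s)) hm'.aemeasurable]
    refine lintegral_congr_ae ?_
    filter_upwards [ae_restrict_mem measurableSet_Ioi] with x hx
    have hx' : (0 : ℝ) < x := hx
    have e : ∫⁻ u, q (x, u + x) ∂halfLine = ∫⁻ y in Ioi x, q (x, y) :=
      lintegral_add_halfLine hx'.le (q := fun y => q (x, y)) (by fun_prop)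
    rw [e, Measure.restrict_congr_set Ioi_ae_eq_Ici, ← inter_eq_left.2 (Ici_subset_Ioi.2 hx'),
      ← Measure.restrict_restrict measurableSet_Ici, ← lintegral_indicator measurableSet_Ici]
    refine lintegral_congr fun y => ?_
    by_cases hy : x ≤ y
    · rw [indicator_of_mem (by simpa using hy), indicator_of_mem (by simpa using hy)]
    · rw [indicator_of_notMem (by simpa using hy), indicator_of_notMem (by simpa using hy)]

theorem lintegral_slice_le {q : ℝ × ℝ → ℝ≥0∞} (hq : Measurable q) :
    ∫⁻ u, ∫⁻ s, q (u + s, s) ∂halfLine ∂halfLine ≤ ∫⁻ p, q p ∂quadrant := by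
  rw [lintegral_prod_symm _ hq.aemeasurable, lintegral_quadrant_eq hq]
  exact le_self_add

/-- A sequence of nonnegative functions whose integrals tend to `0` has a subsequence that tends
to `0` almost everywhere. -/
theorem exists_subseq_ae_tendsto_zero {q : ℕ → ℝ → ℝ≥0∞} {μ : Measure ℝ}
    (hq : ∀ n, AEMeasurable (q n) μ)
    (h : Tendsto (fun n => ∫⁻ u, q n u ∂μ) atTop (𝓝 0)) :
    ∃ φ : ℕ → ℕ, StrictMono φ ∧ ∀ᵐ u ∂μ, Tendsto (fun n => q (φ n) u) atTop (𝓝 0) := by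
  rw [ENNReal.tendsto_nhds_zero] at h
  obtain ⟨φ, hφ, hφ'⟩ := extraction_forall_of_eventually
    (P := fun n k => ∫⁻ u, q k u ∂μ ≤ (2 : ℝ≥0∞)⁻¹ ^ n)
    (fun n => h _ (ENNReal.pow_pos (by simp) n))
  refine ⟨φ, hφ, ?_⟩
  have hsum : ∫⁻ u, ∑' n, q (φ n) u ∂μ ≠ ∞ := by
    rw [lintegral_tsum fun n => hq _]
    refine ne_top_of_le_ne_top ?_ (ENNReal.tsum_le_tsum hφ')
    rw [ENNReal.tsum_geometric]
    simp [ENNReal.one_sub_inv_two]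
  filter_upwards [ae_lt_top' (AEMeasurable.tsum fun n => hq _) hsum] with u hu
  exact ENNReal.tendsto_atTop_zero_of_tsum_ne_top hu.ne

/-- A square-integrable kernel with a square-integrable derivative along the diagonal is close,
near the edge `y = 0` and along the diagonals starting there, to its trace `a` on that edge. -/
theorem exists_trace_slices {k g : ℝ × ℝ → ℂ} (hkm : Measurable k) (hgm : Measurable g)
    (hk : MemLp k 2 quadrant) (hg : MemLp g 2 quadrant) {h : ℕ → ℝ≥0} (hpos : ∀ n, 0 < h n)
    (h0 : Tendsto h atTop (𝓝 0))
    (hlim : Tendsto (fun n => ∫⁻ p, ‖((h n : ℝ) : ℂ)⁻¹ * (k (p.1 + h n, p.2 + h n) - k p) - g p‖ₑ ^ 2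
      ∂quadrant) atTop (𝓝 0)) :
    ∃ a : ℝ → ℂ, Measurable a ∧ MemLp a 2 halfLine ∧ ∀ r : ℝ, 0 ≤ r →
      ∫⁻ u, (∫⁻ s in Ioc 0 r, ‖k (u + s, s) - (Real.exp s : ℂ) * a u‖ₑ ^ 2) ∂halfLine ≤
        ENNReal.ofReal (r ^ 2 * Real.exp r ^ 2) * ∫⁻ p, ‖k p - g p‖ₑ ^ 2 ∂quadrant := by
  have hkf : ∀ u, Measurable fun s => k (u + s, s) := fun u => by fun_prop
  have hgf : ∀ u, Measurable fun s => g (u + s, s) := fun u => by fun_prop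
  have hkS : ∀ᵐ u ∂halfLine, MemLp (fun s => k (u + s, s)) 2 halfLine := by
    have h1 := ne_top_of_le_ne_top ((memLp_two_iff_lintegral hk.1).1 hk)
      (lintegral_slice_le (q := fun p => ‖k p‖ₑ ^ 2) (by fun_prop))
    have hm : Measurable fun p : ℝ × ℝ => ‖k (p.1 + p.2, p.2)‖ₑ ^ 2 := by fun_prop
    filter_upwards [ae_lt_top (Measurable.lintegral_prod_right' hm) h1] with u hu
    exact (memLp_two_iff_lintegral (hkf u).aestronglyMeasurable).2 hu.ne
  have hgS : ∀ᵐ u ∂halfLine, MemLp (fun s => g (u + s, s)) 2 halfLine := by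
    have h1 := ne_top_of_le_ne_top ((memLp_two_iff_lintegral hg.1).1 hg)
      (lintegral_slice_le (q := fun p => ‖g p‖ₑ ^ 2) (by fun_prop))
    have hm : Measurable fun p : ℝ × ℝ => ‖g (p.1 + p.2, p.2)‖ₑ ^ 2 := by fun_prop
    filter_upwards [ae_lt_top (Measurable.lintegral_prod_right' hm) h1] with u hu
    exact (memLp_two_iff_lintegral (hgf u).aestronglyMeasurable).2 hu.ne
  have hM : ∫⁻ p, ‖k p - g p‖ₑ ^ 2 ∂quadrant ≠ ∞ :=
    (memLp_two_iff_lintegral (hk.sub hg).1).1 (hk.sub hg)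
  have hMs := lintegral_slice_le (q := fun p => ‖k p - g p‖ₑ ^ 2) (by fun_prop)
  -- along a subsequence, the difference quotients converge on almost every slice
  obtain ⟨φ, hφ, hae⟩ := exists_subseq_ae_tendsto_zero (μ := halfLine)
    (q := fun n u => ∫⁻ s, ‖((h n : ℝ) : ℂ)⁻¹ * (k (u + s + h n, s + h n) - k (u + s, s)) -
      g (u + s, s)‖ₑ ^ 2 ∂halfLine)
    (fun n => (Measurable.lintegral_prod_right' (f := fun p : ℝ × ℝ =>
      ‖((h n : ℝ) : ℂ)⁻¹ * (k (p.1 + p.2 + h n, p.2 + h n) - k (p.1 + p.2, p.2)) -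
      g (p.1 + p.2, p.2)‖ₑ ^ 2) (by fun_prop)).aemeasurable)
    (tendsto_of_tendsto_of_tendsto_of_le_of_le tendsto_const_nhds hlim (fun _ => zero_le)
      fun n => lintegral_slice_le (q := fun p => ‖((h n : ℝ) : ℂ)⁻¹ *
        (k (p.1 + h n, p.2 + h n) - k p) - g p‖ₑ ^ 2) (by fun_prop))
  have ham : Measurable fun u => traceAtZero fun s => k (u + s, s) - g (u + s, s) := by
    have hm : StronglyMeasurable fun p : ℝ × ℝ =>
        ((Real.exp (-p.2) : ℝ) : ℂ) * (k (p.1 + p.2, p.2) - g (p.1 + p.2, p.2)) :=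
      Measurable.stronglyMeasurable (by fun_prop)
    exact (hm.integral_prod_right' (ν := halfLine)).measurable
  refine ⟨fun u => traceAtZero fun s => k (u + s, s) - g (u + s, s), ham, ?_, fun r hr => ?_⟩
  · rw [memLp_two_iff_lintegral ham.aestronglyMeasurable]
    have hE := (memLp_two_iff_lintegral memLp_exp_neg.1).1 memLp_exp_neg
    refine ne_top_of_le_ne_top (ENNReal.mul_ne_top hE (ne_top_of_le_ne_top hM hMs)) ?_
    rw [← lintegral_const_mul' _ _ hE]
    refine lintegral_mono fun u => ?_
    exact enorm_sq_integral_mul_le_mul memLp_exp_neg.1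
      ((hkf u).sub (hgf u)).aestronglyMeasurable
  · calc _ ≤ ∫⁻ u, ENNReal.ofReal (r ^ 2 * Real.exp r ^ 2) *
          ∫⁻ s, ‖k (u + s, s) - g (u + s, s)‖ₑ ^ 2 ∂halfLine ∂halfLine := by
          refine lintegral_mono_ae ?_
          filter_upwards [hkS, hgS, hae] with u h1 h2 h3
          refine (lintegral_sub_exp_mul_traceAtZero_le h1 h2 (h := fun n => h (φ n))
            (fun n => hpos _) (h0.comp hφ.tendsto_atTop) ?_ r hr).trans ?_
          · simpa only [add_assoc] using h3
          · exact mul_le_mul' le_rfl (lintegral_mono'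
              (Measure.restrict_mono Ioc_subset_Ioi_self le_rfl) le_rfl)
      _ ≤ _ := by
          rw [lintegral_const_mul' _ _ ENNReal.ofReal_ne_top]
          gcongr

theorem tendsto_setLIntegral_Ioc_zero {b : ℝ → ℂ} (hb : MemLp b 2 halfLine) :
    Tendsto (fun h : ℝ => ∫⁻ u in Ioc 0 h, ‖b u‖ₑ ^ 2) (𝓝[>] 0) (𝓝 0) := by
  have h1 : Tendsto (fun t : ℝ => ‖cutoff t.toNNReal (hb.toLp b)‖ₑ ^ 2) (𝓝[>] 0) (𝓝 0) := by
    have h2 : Tendsto (fun t : ℝ => t.toNNReal) (𝓝[>] 0) (𝓝 0) := by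
      have := continuous_real_toNNReal.tendsto 0
      rw [Real.toNNReal_zero] at this
      exact this.mono_left nhdsWithin_le_nhds
    have h3 := ((tendsto_cutoff (hb.toLp b)).comp h2).enorm
    simpa using ENNReal.Tendsto.pow (n := 2) h3
  refine h1.congr' ?_
  filter_upwards [self_mem_nhdsWithin] with t ht
  rw [enorm_cutoff_sq, Real.coe_toNNReal t (le_of_lt ht)]
  refine lintegral_congr_ae ?_
  filter_upwards [ae_mono (Measure.restrict_mono Ioc_subset_Ioi_self le_rfl) hb.coeFn_toLp] with x hx
  rw [hx]

/-- A square-integrable kernel with a square-integrable derivative along the diagonal has a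
boundary value on the edge `y = 0`. In the part `x > y` of the strip `0 < y ≤ t` the diagonals start
on that edge, at the boundary value `a`. In the part `x ≤ y` they start on the edge `x = 0`, and the
integrals of `|k|²` and `|a|²` over that part are `o(t)`. -/
theorem exists_trace {k g : ℝ × ℝ → ℂ} (hkm : Measurable k) (hgm : Measurable g)
    (hk : MemLp k 2 quadrant) (hg : MemLp g 2 quadrant) {h : ℕ → ℝ≥0} (hpos : ∀ n, 0 < h n)
    (h0 : Tendsto h atTop (𝓝 0))
    (hlim : Tendsto (fun n => ∫⁻ p, ‖((h n : ℝ) : ℂ)⁻¹ * (k (p.1 + h n, p.2 + h n) - k p) - g p‖ₑ ^ 2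
      ∂quadrant) atTop (𝓝 0)) :
    ∃ a : L2, Tendsto (fun h : ℝ => (ENNReal.ofReal h)⁻¹ *
      ∫⁻ y in Ioc 0 h, ∫⁻ x, ‖k (x, y) - a x‖ₑ ^ 2 ∂halfLine) (𝓝[>] 0) (𝓝 0) := by
  obtain ⟨a, ham, ha, hA⟩ := exists_trace_slices hkm hgm hk hg hpos h0 hlim
  have hswap : MeasurePreserving Prod.swap quadrant quadrant := Measure.measurePreserving_swap
  obtain ⟨b, hbm, hb, hB⟩ := exists_trace_slices (k := fun p => k p.swap) (g := fun p => g p.swap)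
    (by fun_prop) (by fun_prop) (hk.comp_measurePreserving hswap)
    (hg.comp_measurePreserving hswap) hpos h0 (hlim.congr fun n => by
      rw [← HS.lintegral_swap_quadrant]; rfl)
  set M := ∫⁻ p, ‖k p - g p‖ₑ ^ 2 ∂quadrant with hMdef
  have hM : M ≠ ∞ := (memLp_two_iff_lintegral (hk.sub hg).1).1 (hk.sub hg)
  have hM' : ∫⁻ p : ℝ × ℝ, ‖k p.swap - g p.swap‖ₑ ^ 2 ∂quadrant = M :=
    HS.lintegral_swap_quadrant fun p => ‖k p - g p‖ₑ ^ 2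
  rw [hM'] at hB
  set A : L2 := ha.toLp a with hAdef
  refine ⟨A, ?_⟩
  set ω : ℝ → ℝ≥0∞ := fun y => ∫⁻ u, ‖(Real.exp y : ℂ) * a u - a (u + y)‖ₑ ^ 2 ∂halfLine with hω
  have hωlim : Tendsto ω (𝓝[>] 0) (𝓝 0) := by
    have h2 : Tendsto (fun t : ℝ => t.toNNReal) (𝓝[>] 0) (𝓝 0) := by
      have := continuous_real_toNNReal.tendsto 0
      rw [Real.toNNReal_zero] at this
      exact this.mono_left nhdsWithin_le_nhds
    have h3 : Tendsto (fun t : ℝ => (Real.exp t : ℂ) • A) (𝓝[>] 0) (𝓝 A) := by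
      have hc : Continuous fun t : ℝ => (Real.exp t : ℂ) • A := by fun_prop
      have := hc.tendsto 0
      simp only [Real.exp_zero, Complex.ofReal_one, one_smul] at this
      exact this.mono_left nhdsWithin_le_nhds
    have h4 := (h3.sub ((tendsto_shiftAdj_zero A).comp h2)).enorm
    have h5 := ENNReal.Tendsto.pow (n := 2) h4
    rw [sub_self, enorm_zero, zero_pow two_ne_zero] at h5
    refine h5.congr' ?_
    filter_upwards [self_mem_nhdsWithin] with t ht
    have ht' : ((t.toNNReal : ℝ≥0) : ℝ) = t := Real.coe_toNNReal t (le_of_lt ht)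
    rw [Lp_enorm_sq]
    refine lintegral_congr_ae ?_
    filter_upwards [Lp.coeFn_sub ((Real.exp t : ℂ) • A) (shiftAdj t.toNNReal A),
      Lp.coeFn_smul (Real.exp t : ℂ) A, shiftAdj_ae t.toNNReal A, ha.coeFn_toLp,
      ae_halfLine_of_ae_Ioi t.toNNReal ha.coeFn_toLp] with x h6 h7 h8 h9 h10
    rw [Function.comp_apply, h6, Pi.sub_apply, h7, Pi.smul_apply, h8, smul_eq_mul, hAdef, h9, h10,
      ht']
  have hωm : Measurable ω := by
    have hm : Measurable fun p : ℝ × ℝ => ‖(Real.exp p.1 : ℂ) * a p.2 - a (p.2 + p.1)‖ₑ ^ 2 := by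
      fun_prop
    exact hm.lintegral_prod_right'
  -- the two triangles of the strip `0 < y ≤ t`
  have hbound : ∀ t : ℝ, 0 < t → ∫⁻ y in Ioc 0 t, ∫⁻ x, ‖k (x, y) - A x‖ₑ ^ 2 ∂halfLine ≤
      (2 * (ENNReal.ofReal (t ^ 2 * Real.exp t ^ 2) * M) + 2 * ∫⁻ y in Ioc 0 t, ω y) +
      (2 * (2 * (ENNReal.ofReal (t ^ 2 * Real.exp t ^ 2) * M) +
        2 * (ENNReal.ofReal (t * Real.exp t ^ 2) * ∫⁻ u in Ioc 0 t, ‖b u‖ₑ ^ 2)) +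
        2 * (ENNReal.ofReal t * ∫⁻ u in Ioc 0 t, ‖a u‖ₑ ^ 2)) := by
    intro t ht
    have hres : halfLine.restrict (Ioc 0 t) = volume.restrict (Ioc 0 t) := by
      rw [Measure.restrict_restrict measurableSet_Ioc, inter_eq_left.2 Ioc_subset_Ioi_self]
    set q : ℝ × ℝ → ℝ≥0∞ := (univ ×ˢ Ioc 0 t).indicator fun p => ‖k p - a p.1‖ₑ ^ 2 with hq
    have hqm : Measurable q :=
      Measurable.indicator (by fun_prop) (MeasurableSet.univ.prod measurableSet_Ioc)
    have hqv : ∀ x y, q (x, y) = (Ioc 0 t).indicator (fun y => ‖k (x, y) - a x‖ₑ ^ 2) y := by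
      intro x y
      by_cases hy : y ∈ Ioc 0 t
      · rw [hq, indicator_of_mem (by simpa using hy), indicator_of_mem hy]
      · rw [hq, indicator_of_notMem (by simpa using hy), indicator_of_notMem hy]
    have e1 : ∫⁻ y in Ioc 0 t, ∫⁻ x, ‖k (x, y) - A x‖ₑ ^ 2 ∂halfLine =
        ∫⁻ y, ∫⁻ x, q (x, y) ∂halfLine ∂halfLine := by
      rw [← hres, ← lintegral_indicator measurableSet_Ioc]
      refine lintegral_congr fun y => ?_
      simp only [hqv]
      by_cases hy : y ∈ Ioc 0 t
      · simp only [indicator_of_mem hy]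
        refine lintegral_congr_ae ?_
        filter_upwards [ha.coeFn_toLp] with x hx
        rw [hAdef, hx]
      · simp only [indicator_of_notMem hy, lintegral_zero]
    rw [e1, lintegral_quadrant_eq hqm]
    refine add_le_add ?_ ?_
    · have e2 : ∀ u, ∫⁻ s, q (u + s, s) ∂halfLine =
          ∫⁻ s in Ioc 0 t, ‖k (u + s, s) - a (u + s)‖ₑ ^ 2 := fun u => by
        rw [← hres, ← lintegral_indicator measurableSet_Ioc]
        refine lintegral_congr fun s => ?_
        rw [hqv]
        by_cases hs : s ∈ Ioc 0 t
        · simp only [indicator_of_mem hs]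
        · simp only [indicator_of_notMem hs]
      simp only [e2]
      have hm1 : Measurable fun p : ℝ × ℝ =>
          ‖k (p.1 + p.2, p.2) - (Real.exp p.2 : ℂ) * a p.1‖ₑ ^ 2 := by fun_prop
      have hm2 : Measurable fun p : ℝ × ℝ =>
          ‖(Real.exp p.2 : ℂ) * a p.1 - a (p.1 + p.2)‖ₑ ^ 2 := by fun_prop
      calc _ ≤ ∫⁻ u, ((2 * ∫⁻ s in Ioc 0 t, ‖k (u + s, s) - (Real.exp s : ℂ) * a u‖ₑ ^ 2) +
            2 * ∫⁻ s in Ioc 0 t, ‖(Real.exp s : ℂ) * a u - a (u + s)‖ₑ ^ 2) ∂halfLine := by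
            refine lintegral_mono fun u => ?_
            simp only
            rw [← lintegral_const_mul' _ _ (by norm_num), ← lintegral_const_mul' _ _ (by norm_num),
              ← lintegral_add_left (by fun_prop)]
            refine lintegral_mono fun s => ?_
            have := enorm_add_sq_le (k (u + s, s) - (Real.exp s : ℂ) * a u)
              ((Real.exp s : ℂ) * a u - a (u + s))
            rwa [sub_add_sub_cancel] at this
        _ ≤ _ := by
            have hm1' : Measurable fun u =>
                ∫⁻ s in Ioc 0 t, ‖k (u + s, s) - (Real.exp s : ℂ) * a u‖ₑ ^ 2 :=
              hm1.lintegral_prod_right'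
            rw [lintegral_add_left (hm1'.const_mul 2), lintegral_const_mul' _ _ (by norm_num),
              lintegral_const_mul' _ _ (by norm_num)]
            refine add_le_add (mul_le_mul' le_rfl (hA t ht.le)) (mul_le_mul' le_rfl (le_of_eq ?_))
            exact lintegral_lintegral_swap (f := fun u s =>
              ‖(Real.exp s : ℂ) * a u - a (u + s)‖ₑ ^ 2) hm2.aemeasurable
    · have e2 : ∀ u ∈ Ioi (0 : ℝ), ∫⁻ s, q (s, u + s) ∂halfLine ≤ (Ioc 0 t).indicator
          (fun u => ∫⁻ s in Ioc 0 t, ‖k (s, u + s) - a s‖ₑ ^ 2) u := fun u hu => by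
        have hu' : (0 : ℝ) < u := hu
        by_cases hut : u ≤ t
        · rw [indicator_of_mem (by exact ⟨hu', hut⟩), ← hres,
            ← lintegral_indicator measurableSet_Ioc]
          refine lintegral_mono_ae ?_
          filter_upwards [ae_restrict_mem measurableSet_Ioi] with s hs
          have hs' : (0 : ℝ) < s := hs
          rw [hqv]
          by_cases hus : u + s ∈ Ioc 0 t
          · have : s ∈ Ioc 0 t := ⟨hs', by linarith [hus.2]⟩
            rw [indicator_of_mem hus, indicator_of_mem this]
          · rw [indicator_of_notMem hus]; exact zero_le
        · rw [indicator_of_notMem (fun h => hut h.2), nonpos_iff_eq_zero]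
          refine lintegral_eq_zero_of_ae_eq_zero ?_
          filter_upwards [ae_restrict_mem measurableSet_Ioi] with s hs
          have hs' : (0 : ℝ) < s := hs
          rw [hqv, indicator_of_notMem]
          · rfl
          · exact fun h => hut (by linarith [h.2])
      have hm1 : Measurable fun p : ℝ × ℝ =>
          ‖k (p.2, p.1 + p.2) - (Real.exp p.2 : ℂ) * b p.1‖ₑ ^ 2 := by fun_prop
      have hm1' : Measurable fun u =>
          ∫⁻ s in Ioc 0 t, ‖k (s, u + s) - (Real.exp s : ℂ) * b u‖ₑ ^ 2 :=
        hm1.lintegral_prod_right'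
      calc _ ≤ ∫⁻ u, (Ioc 0 t).indicator
            (fun u => ∫⁻ s in Ioc 0 t, ‖k (s, u + s) - a s‖ₑ ^ 2) u ∂halfLine := by
            refine lintegral_mono_ae ?_
            filter_upwards [ae_restrict_mem measurableSet_Ioi] with u hu using e2 u hu
        _ = ∫⁻ u in Ioc 0 t, ∫⁻ s in Ioc 0 t, ‖k (s, u + s) - a s‖ₑ ^ 2 := by
            rw [lintegral_indicator measurableSet_Ioc, hres]
        _ ≤ ∫⁻ u in Ioc 0 t, (2 * (2 * (∫⁻ s in Ioc 0 t,
              ‖k (s, u + s) - (Real.exp s : ℂ) * b u‖ₑ ^ 2) +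
              2 * (ENNReal.ofReal (t * Real.exp t ^ 2) * ‖b u‖ₑ ^ 2)) +
              2 * ∫⁻ s in Ioc 0 t, ‖a s‖ₑ ^ 2) := by
            refine lintegral_mono fun u => ?_
            have e3 : ENNReal.ofReal (t * Real.exp t ^ 2) * ‖b u‖ₑ ^ 2 =
                ∫⁻ _ in Ioc 0 t, ENNReal.ofReal (Real.exp t ^ 2) * ‖b u‖ₑ ^ 2 := by
              rw [setLIntegral_const, Real.volume_Ioc, sub_zero, mul_comm t,
                ENNReal.ofReal_mul (by positivity)]
              ring
            simp only
            rw [e3, ← lintegral_const_mul' _ _ (by norm_num),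
              ← lintegral_const_mul' _ _ (by norm_num), ← lintegral_const_mul' _ _ (by norm_num),
              ← lintegral_add_left (by fun_prop), ← lintegral_const_mul' _ _ (by norm_num),
              ← lintegral_add_left (by fun_prop)]
            refine setLIntegral_mono (by fun_prop) fun s hs => ?_
            have h1 := enorm_add_sq_le (k (s, u + s)) (-a s)
            have h2 := enorm_add_sq_le (k (s, u + s) - (Real.exp s : ℂ) * b u)
              ((Real.exp s : ℂ) * b u)
            rw [sub_add_cancel] at h2
            rw [← sub_eq_add_neg, enorm_neg] at h1
            have h3 : ‖(Real.exp s : ℂ) * b u‖ₑ ^ 2 ≤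
                ENNReal.ofReal (Real.exp t ^ 2) * ‖b u‖ₑ ^ 2 := by
              rw [enorm_mul, mul_pow]
              refine mul_le_mul' ?_ le_rfl
              rw [← ofReal_norm, Complex.norm_real, Real.norm_eq_abs, Real.abs_exp,
                ← ENNReal.ofReal_pow (Real.exp_pos _).le]
              exact ENNReal.ofReal_le_ofReal (by gcongr; exact hs.2)
            calc _ ≤ _ := h1
              _ ≤ _ := by gcongr; exact h2.trans (by gcongr)
        _ ≤ _ := by
            rw [lintegral_add_right _ measurable_const, lintegral_const_mul' _ _ (by norm_num),
              lintegral_add_right _ (by fun_prop), lintegral_const_mul' _ _ (by norm_num),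
              lintegral_const_mul' _ _ (by norm_num),
              lintegral_const_mul' _ _ ENNReal.ofReal_ne_top, setLIntegral_const, Real.volume_Ioc,
              sub_zero, mul_assoc 2 _ (ENNReal.ofReal t), mul_comm _ (ENNReal.ofReal t)]
            gcongr
            refine le_trans ?_ (hB t ht.le)
            exact lintegral_mono' (Measure.restrict_mono Ioc_subset_Ioi_self le_rfl) le_rfl
  -- every term of the bound is `o(t)`
  have hT : Tendsto (fun t : ℝ => (2 * (ENNReal.ofReal (t * Real.exp t ^ 2) * M) +
      2 * ((ENNReal.ofReal t)⁻¹ * ∫⁻ y in Ioc 0 t, ω y)) +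
      (2 * (2 * (ENNReal.ofReal (t * Real.exp t ^ 2) * M) +
        2 * (ENNReal.ofReal (Real.exp t ^ 2) * ∫⁻ u in Ioc 0 t, ‖b u‖ₑ ^ 2)) +
        2 * (∫⁻ u in Ioc 0 t, ‖a u‖ₑ ^ 2))) (𝓝[>] 0) (𝓝 0) := by
    have hc1 : Tendsto (fun t : ℝ => ENNReal.ofReal (t * Real.exp t ^ 2)) (𝓝[>] 0) (𝓝 0) := by
      have hc : Continuous fun t : ℝ => ENNReal.ofReal (t * Real.exp t ^ 2) :=
        ENNReal.continuous_ofReal.comp (by fun_prop)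
      have := hc.tendsto 0
      rw [zero_mul, ENNReal.ofReal_zero] at this
      exact this.mono_left nhdsWithin_le_nhds
    have hc2 : Tendsto (fun t : ℝ => ENNReal.ofReal (Real.exp t ^ 2)) (𝓝[>] 0) (𝓝 1) := by
      have hc : Continuous fun t : ℝ => ENNReal.ofReal (Real.exp t ^ 2) :=
        ENNReal.continuous_ofReal.comp (by fun_prop)
      have := hc.tendsto 0
      rw [Real.exp_zero, one_pow, ENNReal.ofReal_one] at this
      exact this.mono_left nhdsWithin_le_nhds
    have h2 : (2 : ℝ≥0∞) ≠ ∞ := by norm_num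
    have t1 : Tendsto (fun t : ℝ => ENNReal.ofReal (t * Real.exp t ^ 2) * M) (𝓝[>] 0) (𝓝 0) := by
      simpa using ENNReal.Tendsto.mul_const hc1 (Or.inr hM)
    have t2 := tendsto_average_zero hωlim
    have t3 : Tendsto (fun t : ℝ => ENNReal.ofReal (Real.exp t ^ 2) *
        ∫⁻ u in Ioc 0 t, ‖b u‖ₑ ^ 2) (𝓝[>] 0) (𝓝 0) := by
      simpa using ENNReal.Tendsto.mul hc2 (Or.inl one_ne_zero) (tendsto_setLIntegral_Ioc_zero hb)
        (Or.inr ENNReal.one_ne_top)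
    have t4 := tendsto_setLIntegral_Ioc_zero ha
    have d : ∀ {F : ℝ → ℝ≥0∞}, Tendsto F (𝓝[>] 0) (𝓝 0) →
        Tendsto (fun t => 2 * F t) (𝓝[>] 0) (𝓝 0) := fun hF => by
      simpa using ENNReal.Tendsto.const_mul hF (Or.inr h2)
    have t5 := (d t1).add (d t3)
    rw [add_zero] at t5
    simpa using ((d t1).add (d t2)).add ((d t5).add (d t4))
  refine tendsto_of_tendsto_of_tendsto_of_le_of_le' tendsto_const_nhds hT
    (Eventually.of_forall fun _ => zero_le) ?_
  filter_upwards [self_mem_nhdsWithin] with t ht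
  have ht' : (0 : ℝ) < t := ht
  refine (mul_le_mul' le_rfl (hbound t ht')).trans (le_of_eq ?_)
  have hc : (ENNReal.ofReal t)⁻¹ * ENNReal.ofReal t = 1 :=
    ENNReal.inv_mul_cancel (by simpa using ht') ENNReal.ofReal_ne_top
  have e1 : ENNReal.ofReal (t ^ 2 * Real.exp t ^ 2) =
      ENNReal.ofReal t * ENNReal.ofReal (t * Real.exp t ^ 2) := by
    rw [← ENNReal.ofReal_mul ht'.le]; congr 1; ring
  have e2 : ENNReal.ofReal (t * Real.exp t ^ 2) =
      ENNReal.ofReal t * ENNReal.ofReal (Real.exp t ^ 2) := by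
    rw [← ENNReal.ofReal_mul ht'.le]
  rw [e1, e2]
  have key : ∀ X : ℝ≥0∞, (ENNReal.ofReal t)⁻¹ * (ENNReal.ofReal t * X) = X := fun X => by
    rw [← mul_assoc, hc, one_mul]
  have comm : ∀ X : ℝ≥0∞, (ENNReal.ofReal t)⁻¹ * (2 * X) = 2 * ((ENNReal.ofReal t)⁻¹ * X) :=
    fun X => by ring
  simp only [mul_add, comm, mul_assoc, key]

/-! ### Boundary values as Hilbert–Schmidt limits -/

theorem HS.norm_rankOne (a b : L2) : ‖HS.rankOne a b‖ = ‖a‖ * ‖b‖ := by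
  obtain ⟨ι, e, -⟩ := HS.exists_basis
  have h : ‖HS.rankOne a b‖ₑ ^ 2 = (‖a‖ₑ * ‖b‖ₑ) ^ 2 := by
    rw [HS.enorm_sq_eq_tsum e, mul_pow, mul_comm, ← tsum_enorm_inner_sq e b, ← ENNReal.tsum_mul_right]
    refine tsum_congr fun i => ?_
    rw [HS.op_rankOne, InnerProductSpace.rankOne_apply, enorm_smul, mul_pow]
  have h2 : ‖HS.rankOne a b‖ₑ = ‖a‖ₑ * ‖b‖ₑ := le_antisymm
    ((ENNReal.pow_le_pow_left_iff two_ne_zero).1 h.le)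
    ((ENNReal.pow_le_pow_left_iff two_ne_zero).1 h.ge)
  simpa using congrArg ENNReal.toReal h2

/-- The family of bounded operators `z h` is Hilbert–Schmidt for small `h > 0` and converges to `Z`
in Hilbert–Schmidt norm as `h → 0+`. -/
def HSTendsto (z : ℝ≥0 → L2 →L[ℂ] L2) (Z : HS) : Prop :=
  ∃ X : ℝ≥0 → HS, (∀ᶠ h in 𝓝[>] 0, (X h).op = z h) ∧ Tendsto X (𝓝[>] 0) (𝓝 Z)

namespace HSTendsto

theorem tendsto {X : ℝ≥0 → HS} {Z : HS} (h : HSTendsto (fun h => (X h).op) Z) :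
    Tendsto X (𝓝[>] 0) (𝓝 Z) := by
  obtain ⟨Y, hY, hlim⟩ := h
  exact hlim.congr' (hY.mono fun t ht => HS.op_injective ht)

theorem congr {z w : ℝ≥0 → L2 →L[ℂ] L2} {Z : HS} (hz : HSTendsto z Z)
    (h : ∀ᶠ t in 𝓝[>] 0, z t = w t) : HSTendsto w Z := by
  obtain ⟨X, hX, hlim⟩ := hz
  exact ⟨X, by filter_upwards [hX, h] with t h1 h2; rw [h1, h2], hlim⟩

theorem add {z w : ℝ≥0 → L2 →L[ℂ] L2} {Z W : HS} (hz : HSTendsto z Z) (hw : HSTendsto w W) :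
    HSTendsto (fun t => z t + w t) (Z + W) := by
  obtain ⟨X, hX, hXl⟩ := hz
  obtain ⟨Y, hY, hYl⟩ := hw
  exact ⟨fun t => X t + Y t, by filter_upwards [hX, hY] with t h1 h2; rw [HS.op_add, h1, h2],
    hXl.add hYl⟩

theorem sub {z w : ℝ≥0 → L2 →L[ℂ] L2} {Z W : HS} (hz : HSTendsto z Z) (hw : HSTendsto w W) :
    HSTendsto (fun t => z t - w t) (Z - W) := by
  obtain ⟨X, hX, hXl⟩ := hz
  obtain ⟨Y, hY, hYl⟩ := hw
  exact ⟨fun t => X t - Y t, by filter_upwards [hX, hY] with t h1 h2; rw [HS.op_sub, h1, h2],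
    hXl.sub hYl⟩

theorem lmul {z : ℝ≥0 → L2 →L[ℂ] L2} {Z : HS} (hz : HSTendsto z Z) {B : ℝ≥0 → L2 →L[ℂ] L2}
    {B₀ : L2 →L[ℂ] L2} {C : ℝ} (hC : ∀ t, ‖B t‖ ≤ C)
    (hB : ∀ f, Tendsto (fun t => B t f) (𝓝[>] 0) (𝓝 (B₀ f))) :
    HSTendsto (fun t => B t * z t) (HS.lmul B₀ Z) := by
  obtain ⟨X, hX, hXl⟩ := hz
  exact ⟨fun t => HS.lmul (B t) (X t), by filter_upwards [hX] with t h1; rw [HS.op_lmul, h1],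
    HS.tendsto_lmul hC hB hXl⟩

theorem rmul {z : ℝ≥0 → L2 →L[ℂ] L2} {Z : HS} (hz : HSTendsto z Z) {B : ℝ≥0 → L2 →L[ℂ] L2}
    {B₀ : L2 →L[ℂ] L2} {C : ℝ} (hC : ∀ t, ‖B t‖ ≤ C)
    (hB : ∀ f, Tendsto (fun t => ContinuousLinearMap.adjoint (B t) f) (𝓝[>] 0)
      (𝓝 (ContinuousLinearMap.adjoint B₀ f))) :
    HSTendsto (fun t => z t * B t) (HS.rmul Z B₀) := by
  obtain ⟨X, hX, hXl⟩ := hz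
  exact ⟨fun t => HS.rmul (X t) (B t), by filter_upwards [hX] with t h1; rw [HS.op_rmul, h1],
    HS.tendsto_rmul hC hB hXl⟩

theorem const_lmul {z : ℝ≥0 → L2 →L[ℂ] L2} {Z : HS} (hz : HSTendsto z Z) (B : L2 →L[ℂ] L2) :
    HSTendsto (fun t => B * z t) (HS.lmul B Z) :=
  hz.lmul (B := fun _ => B) (fun _ => le_rfl) fun _ => tendsto_const_nhds

theorem const_rmul {z : ℝ≥0 → L2 →L[ℂ] L2} {Z : HS} (hz : HSTendsto z Z) (B : L2 →L[ℂ] L2) :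
    HSTendsto (fun t => z t * B) (HS.rmul Z B) :=
  hz.rmul (B := fun _ => B) (fun _ => le_rfl) fun _ => tendsto_const_nhds

end HSTendsto

/-- The normalised indicator function `h^{-1/2} 1_{(0, h]}`. -/
noncomputable def unitBox (h : ℝ≥0) : L2 :=
  (((√(h : ℝ))⁻¹ : ℝ) : ℂ) • indicatorConstLp (μ := halfLine) 2 (measurableSet_Ioc (a := (0 : ℝ)) (b := h))
    (ne_top_of_le_ne_top (by simp) (Measure.restrict_apply_le _ _)) (1 : ℂ)

theorem unitBox_ae (h : ℝ≥0) : ∀ᵐ y ∂halfLine, unitBox h y =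
    (((√(h : ℝ))⁻¹ : ℝ) : ℂ) * (Ioc 0 (h : ℝ)).indicator (fun _ => (1 : ℂ)) y := by
  rw [unitBox]
  filter_upwards [Lp.coeFn_smul (((√(h : ℝ))⁻¹ : ℝ) : ℂ)
    (indicatorConstLp (μ := halfLine) 2 (measurableSet_Ioc (a := (0 : ℝ)) (b := h))
    (ne_top_of_le_ne_top (by simp) (Measure.restrict_apply_le _ _)) (1 : ℂ)),
    indicatorConstLp_coeFn (μ := halfLine) (p := 2) (s := Ioc 0 (h : ℝ)) (hs := measurableSet_Ioc)
      (hμs := ne_top_of_le_ne_top (by simp) (Measure.restrict_apply_le _ _)) (c := (1 : ℂ))]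
    with y h1 h2
  rw [h1, Pi.smul_apply, h2, smul_eq_mul]

theorem norm_unitBox {h : ℝ≥0} (hh : 0 < h) : ‖unitBox h‖ = 1 := by
  have h0 : (0 : ℝ) < h := hh
  rw [unitBox, norm_smul, norm_indicatorConstLp (by norm_num) (by norm_num), measureReal_restrict_apply
    measurableSet_Ioc, inter_eq_left.2 Ioc_subset_Ioi_self, Real.volume_real_Ioc_of_le h0.le,
    Complex.norm_real, Real.norm_of_nonneg (by positivity), norm_one, one_mul, sub_zero]
  simp only [ENNReal.toReal_ofNat]
  rw [← Real.sqrt_eq_rpow]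
  exact inv_mul_cancel₀ (Real.sqrt_ne_zero'.2 h0)

/-- The operator `A` has boundary value `a` on the edge `y = 0`, in operator form:
`h^{-1/2} A P_h - a ⊗ h^{-1/2} 1_{(0, h]} → 0` in Hilbert–Schmidt norm, with `P_h` the cutoff. Here
`A` itself need not be Hilbert–Schmidt. -/
def HasTraceRight (A : L2 →L[ℂ] L2) (a : L2) : Prop :=
  HSTendsto (fun h => (((√(h : ℝ))⁻¹ : ℝ) : ℂ) • (A * cutoff h) -
    InnerProductSpace.rankOne ℂ a (unitBox h)) 0

/-- The operator `B` has boundary value `conj b` on the edge `x = 0`, in operator form. The conjugate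
comes from `rankOne`, which is antilinear in its second argument. -/
def HasTraceLeft (B : L2 →L[ℂ] L2) (b : L2) : Prop :=
  HSTendsto (fun h => (((√(h : ℝ))⁻¹ : ℝ) : ℂ) • (cutoff h * B) -
    InnerProductSpace.rankOne ℂ (unitBox h) b) 0

theorem HSTendsto.lmul_zero {z : ℝ≥0 → L2 →L[ℂ] L2} (hz : HSTendsto z 0) (B : L2 →L[ℂ] L2) :
    HSTendsto (fun t => B * z t) 0 := by
  have h := hz.const_lmul B
  have e : HS.lmul B 0 = 0 := HS.op_injective (by simp)
  rwa [e] at h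

theorem HSTendsto.rmul_zero {z : ℝ≥0 → L2 →L[ℂ] L2} (hz : HSTendsto z 0) (B : L2 →L[ℂ] L2) :
    HSTendsto (fun t => z t * B) 0 := by
  have h := hz.const_rmul B
  have e : HS.rmul 0 B = 0 := HS.op_injective (by simp)
  rwa [e] at h

theorem HasTraceRight.lmul {A : L2 →L[ℂ] L2} {a : L2} (h : HasTraceRight A a) (B : L2 →L[ℂ] L2) :
    HasTraceRight (B * A) (B a) := by
  refine (HSTendsto.lmul_zero h B).congr (Eventually.of_forall fun t => ?_)
  rw [mul_sub, mul_smul_comm, ← mul_assoc]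
  congr 1
  exact InnerProductSpace.comp_rankOne _ _ _

theorem rankOne_mul (a b : L2) (B : L2 →L[ℂ] L2) : InnerProductSpace.rankOne ℂ a b * B =
    InnerProductSpace.rankOne ℂ a (ContinuousLinearMap.adjoint B b) := by
  ext1 f
  rw [mul_apply_eq_comp, InnerProductSpace.rankOne_apply, InnerProductSpace.rankOne_apply,
    ContinuousLinearMap.adjoint_inner_left]

theorem HasTraceLeft.rmul {A : L2 →L[ℂ] L2} {b : L2} (h : HasTraceLeft A b) (B : L2 →L[ℂ] L2) :
    HasTraceLeft (A * B) (ContinuousLinearMap.adjoint B b) := by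
  refine (HSTendsto.rmul_zero h B).congr (Eventually.of_forall fun t => ?_)
  rw [sub_mul, smul_mul_assoc, ← mul_assoc, rankOne_mul]

theorem cutoff_mul_cutoff (t : ℝ≥0) : cutoff t * cutoff t = cutoff t := by
  have h : shift t * shiftAdj t * (shift t * shiftAdj t) = shift t * shiftAdj t := by
    rw [mul_assoc, ← mul_assoc (shiftAdj t), shiftAdj_mul_shift, one_mul]
  simp only [cutoff, mul_sub, sub_mul, one_mul, mul_one, h]
  abel

/-- As `h → 0+`, the projection `h⁻¹ P_h` acts as `δ₀ ⊗ δ₀` between operators with boundary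
values. -/
theorem HasTraceRight.hsTendsto_mul {A B : L2 →L[ℂ] L2} {a b : L2} (hA : HasTraceRight A a)
    (hB : HasTraceLeft B b) :
    HSTendsto (fun h => ((h : ℝ) : ℂ)⁻¹ • (A * cutoff h * B)) (HS.rankOne a b) := by
  obtain ⟨X, hX, hXl⟩ := hA
  obtain ⟨Y, hY, hYl⟩ := hB
  refine ⟨fun h => X h * Y h + X h * HS.rankOne (unitBox h) b + HS.rankOne a (unitBox h) * Y h +
    HS.rankOne a b, ?_, ?_⟩
  · filter_upwards [hX, hY, self_mem_nhdsWithin] with t h1 h2 h3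
    have h0 : (0 : ℝ) < t := NNReal.coe_pos.2 h3
    have e1 : (((√(t : ℝ))⁻¹ : ℝ) : ℂ) * (((√(t : ℝ))⁻¹ : ℝ) : ℂ) = ((t : ℝ) : ℂ)⁻¹ := by
      rw [← Complex.ofReal_mul, ← mul_inv, Real.mul_self_sqrt h0.le, Complex.ofReal_inv]
    have e2 : InnerProductSpace.rankOne ℂ a (unitBox t) * InnerProductSpace.rankOne ℂ (unitBox t) b =
        InnerProductSpace.rankOne ℂ a b := by
      have := InnerProductSpace.rankOne_comp_rankOne (𝕜 := ℂ) a (unitBox t) (unitBox t) b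
      rw [inner_self_eq_norm_sq_to_K, norm_unitBox h3] at this
      simpa [ContinuousLinearMap.mul_def] using this
    have e3 : ((t : ℝ) : ℂ)⁻¹ • (A * cutoff t * B) =
        ((((√(t : ℝ))⁻¹ : ℝ) : ℂ) • (A * cutoff t)) * ((((√(t : ℝ))⁻¹ : ℝ) : ℂ) • (cutoff t * B)) := by
      rw [smul_mul_smul_comm, e1, mul_assoc A (cutoff t) (cutoff t * B),
        ← mul_assoc (cutoff t) (cutoff t) B, cutoff_mul_cutoff, mul_assoc]
    have e4 : (((√(t : ℝ))⁻¹ : ℝ) : ℂ) • (A * cutoff t) =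
        (X t).op + InnerProductSpace.rankOne ℂ a (unitBox t) := by rw [h1]; abel
    have e5 : (((√(t : ℝ))⁻¹ : ℝ) : ℂ) • (cutoff t * B) =
        (Y t).op + InnerProductSpace.rankOne ℂ (unitBox t) b := by rw [h2]; abel
    rw [e3, e4, e5, add_mul, mul_add, mul_add, e2]
    simp only [HS.op_add, HS.op_mul, HS.op_rankOne]
    abel
  · have hpos : ∀ᶠ t : ℝ≥0 in 𝓝[>] 0, 0 < t := self_mem_nhdsWithin
    have h1 : Tendsto (fun h => X h * HS.rankOne (unitBox h) b) (𝓝[>] 0) (𝓝 0) := by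
      rw [tendsto_zero_iff_norm_tendsto_zero] at hXl ⊢
      refine squeeze_zero' (Eventually.of_forall fun _ => norm_nonneg _) ?_
        (by simpa using hXl.mul_const ‖b‖)
      filter_upwards [hpos] with t ht
      refine (HS.norm_mul_le' _ _).trans (le_of_eq ?_)
      rw [HS.norm_rankOne, norm_unitBox ht, one_mul]
    have h2 : Tendsto (fun h => HS.rankOne a (unitBox h) * Y h) (𝓝[>] 0) (𝓝 0) := by
      have hYl' := tendsto_zero_iff_norm_tendsto_zero.1 hYl
      rw [tendsto_zero_iff_norm_tendsto_zero]
      refine squeeze_zero' (Eventually.of_forall fun _ => norm_nonneg _) ?_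
        (by simpa using hYl'.const_mul ‖a‖)
      filter_upwards [hpos] with t ht
      refine (HS.norm_mul_le' _ _).trans (le_of_eq ?_)
      rw [HS.norm_rankOne, norm_unitBox ht, mul_one]
    have h3 := HS.tendsto_mul hXl hYl
    have e0 : (0 : HS) * 0 = 0 := mul_zero 0
    rw [e0] at h3
    simpa using ((h3.add h1).add h2).add_const (HS.rankOne a b)

/-- The kernel of `h^{-1/2} A P_h - a ⊗ h^{-1/2} 1_{(0, h]}`. -/
noncomputable def traceKernel (k : ℝ × ℝ → ℂ) (a : ℝ → ℂ) (h : ℝ≥0) : ℝ × ℝ → ℂ :=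
  fun p => (((√(h : ℝ))⁻¹ : ℝ) : ℂ) * (Ioc 0 (h : ℝ)).indicator (fun _ => k p - a p.1) p.2

theorem aestronglyMeasurable_traceKernel {k : ℝ × ℝ → ℂ} (hk : AEStronglyMeasurable k quadrant)
    {a : ℝ → ℂ} (ha : AEStronglyMeasurable a halfLine) (h : ℝ≥0) :
    AEStronglyMeasurable (traceKernel k a h) quadrant := by
  have e : traceKernel k a h = fun p => (((√(h : ℝ))⁻¹ : ℝ) : ℂ) *
      (Prod.snd ⁻¹' Ioc 0 (h : ℝ)).indicator (fun p => k p - a p.1) p := by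
    ext p
    rw [traceKernel]
    congr 1
  rw [e]
  exact ((hk.sub (ha.comp_quasiMeasurePreserving Measure.quasiMeasurePreserving_fst)).indicator
    (measurable_snd measurableSet_Ioc)).const_mul _

theorem enorm_inv_sqrt_sq {h : ℝ≥0} (hh : 0 < h) :
    ‖(((√(h : ℝ))⁻¹ : ℝ) : ℂ)‖ₑ ^ 2 = (ENNReal.ofReal h)⁻¹ := by
  have h0 : (0 : ℝ) < h := hh
  rw [← ofReal_norm, Complex.norm_real, Real.norm_of_nonneg (by positivity),
    ← ENNReal.ofReal_pow (by positivity), inv_pow, Real.sq_sqrt h0.le, ENNReal.ofReal_inv_of_pos h0]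

theorem lintegral_traceKernel {k : ℝ × ℝ → ℂ} (hk : AEStronglyMeasurable k quadrant)
    {a : ℝ → ℂ} (ha : AEStronglyMeasurable a halfLine) {h : ℝ≥0} (hh : 0 < h) :
    ∫⁻ p, ‖traceKernel k a h p‖ₑ ^ 2 ∂quadrant =
      (ENNReal.ofReal h)⁻¹ * ∫⁻ y in Ioc 0 (h : ℝ), ∫⁻ x, ‖k (x, y) - a x‖ₑ ^ 2 ∂halfLine := by
  have hne : (ENNReal.ofReal h)⁻¹ ≠ ∞ := by
    rw [ENNReal.inv_ne_top]; simpa using hh.ne'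
  rw [lintegral_prod_symm _ ((aestronglyMeasurable_traceKernel hk ha h).enorm.pow_const 2),
    ← lintegral_const_mul' _ _ hne]
  have hres : halfLine.restrict (Ioc 0 (h : ℝ)) = volume.restrict (Ioc 0 (h : ℝ)) := by
    rw [Measure.restrict_restrict measurableSet_Ioc, inter_eq_left.2 Ioc_subset_Ioi_self]
  rw [← hres, ← lintegral_indicator measurableSet_Ioc]
  refine lintegral_congr fun y => ?_
  by_cases hy : y ∈ Ioc 0 (h : ℝ)
  · simp only [traceKernel, indicator_of_mem hy, enorm_mul, mul_pow, enorm_inv_sqrt_sq hh]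
    rw [lintegral_const_mul' _ _ hne]
  · simp [traceKernel, indicator_of_notMem hy]

theorem hasKernel_traceKernel {A : L2 →L[ℂ] L2} {k : ℝ × ℝ → ℂ} (hA : HasKernel A k) (a : L2)
    (h : ℝ≥0) : HasKernel ((((√(h : ℝ))⁻¹ : ℝ) : ℂ) • (A * cutoff h) -
      InnerProductSpace.rankOne ℂ a (unitBox h)) (traceKernel k a h) := by
  intro f
  set c : ℂ := (((√(h : ℝ))⁻¹ : ℝ) : ℂ) with hc
  have e : (c • (A * cutoff h) - InnerProductSpace.rankOne ℂ a (unitBox h)) f =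
      c • A (cutoff h f) - InnerProductSpace.rankOne ℂ a (unitBox h) f := rfl
  filter_upwards [hA (cutoff h f), HS.hasKernel_rankOne a (unitBox h) f,
    Lp.coeFn_sub (c • A (cutoff h f)) (InnerProductSpace.rankOne ℂ a (unitBox h) f),
    Lp.coeFn_smul c (A (cutoff h f))] with x h1 h2 h3 h4
  have hi := (h1.1.const_mul c).sub h2.1
  have hae : (fun y => c * (k (x, y) * cutoff h f y) - a x * star (unitBox h y) * f y) =ᵐ[halfLine]
      fun y => traceKernel k a h (x, y) * f y := by
    filter_upwards [cutoff_ae h f, unitBox_ae h] with y h5 h6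
    rw [h5, h6, traceKernel]
    by_cases hy : y ∈ Ioc 0 (h : ℝ)
    · simp only [indicator_of_mem hy, mul_one]
      rw [hc, RCLike.star_def, Complex.conj_ofReal]; ring
    · simp [indicator_of_notMem hy]
  refine ⟨hi.congr hae, ?_⟩
  rw [← integral_congr_ae hae, integral_sub (h1.1.const_mul c) h2.1, integral_const_mul, e, h3,
    Pi.sub_apply, h4, Pi.smul_apply, h1.2, h2.2, smul_eq_mul]

theorem hasKernel_traceKernel_left {B : L2 →L[ℂ] L2} {k : ℝ × ℝ → ℂ} (hB : HasKernel B k) (b : L2)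
    (h : ℝ≥0) : HasKernel ((((√(h : ℝ))⁻¹ : ℝ) : ℂ) • (cutoff h * B) -
      InnerProductSpace.rankOne ℂ (unitBox h) b)
      (fun p => traceKernel (fun q => k q.swap) (fun y => star (b y)) h p.swap) := by
  intro f
  set c : ℂ := (((√(h : ℝ))⁻¹ : ℝ) : ℂ) with hc
  have e : (c • (cutoff h * B) - InnerProductSpace.rankOne ℂ (unitBox h) b) f =
      c • cutoff h (B f) - InnerProductSpace.rankOne ℂ (unitBox h) b f := rfl
  filter_upwards [hB f, HS.hasKernel_rankOne (unitBox h) b f,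
    Lp.coeFn_sub (c • cutoff h (B f)) (InnerProductSpace.rankOne ℂ (unitBox h) b f),
    Lp.coeFn_smul c (cutoff h (B f)), cutoff_ae h (B f), unitBox_ae h] with x h1 h2 h3 h4 h5 h6
  have e2 : ∀ y, traceKernel (fun q => k q.swap) (fun y => star (b y)) h (x, y).swap * f y =
      (c * (Ioc 0 (h : ℝ)).indicator (fun _ => (1 : ℂ)) x) * (k (x, y) * f y) -
        unitBox h x * star (b y) * f y := by
    intro y
    rw [h6, traceKernel]
    by_cases hx : x ∈ Ioc 0 (h : ℝ)
    · simp only [indicator_of_mem hx, Prod.swap_prod_mk]; ring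
    · simp [indicator_of_notMem hx]
  simp only [e2]
  refine ⟨(h1.1.const_mul _).sub h2.1, ?_⟩
  rw [integral_sub (h1.1.const_mul _) h2.1, integral_const_mul, e, h3, Pi.sub_apply, h4,
    Pi.smul_apply, h5, h2.2, smul_eq_mul, ← h1.2]
  by_cases hx : x ∈ Ioc 0 (h : ℝ) <;> simp [hx]

theorem hsTendsto_zero_of_kernel {z : ℝ≥0 → L2 →L[ℂ] L2} {κ : ℝ≥0 → ℝ × ℝ → ℂ}
    (hm : ∀ h, AEStronglyMeasurable (κ h) quadrant) (hz : ∀ h, HasKernel (z h) (κ h))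
    (hlim : Tendsto (fun h => ∫⁻ p, ‖κ h p‖ₑ ^ 2 ∂quadrant) (𝓝[>] 0) (𝓝 0)) : HSTendsto z 0 := by
  classical
  have hfin : ∀ᶠ h in 𝓝[>] (0 : ℝ≥0), MemLp (κ h) 2 quadrant := by
    filter_upwards [ENNReal.tendsto_nhds_zero.1 hlim 1 one_pos] with h hh
    rw [memLp_two_iff_lintegral (hm h)]
    exact ne_top_of_le_ne_top ENNReal.one_ne_top hh
  refine ⟨fun h => if hh : MemLp (κ h) 2 quadrant then HS.mk (z h) (κ h) hh (hz h) else 0, ?_, ?_⟩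
  · filter_upwards [hfin] with h hh
    rw [dif_pos hh, HS.op_mk]
  · rw [tendsto_zero_iff_enorm_tendsto_zero]
    have h1 := (ENNReal.continuous_rpow_const (y := 1 / 2)).tendsto 0 |>.comp hlim
    rw [ENNReal.zero_rpow_of_pos (by norm_num)] at h1
    refine h1.congr' ?_
    filter_upwards [hfin] with h hh
    rw [dif_pos hh, Function.comp_apply, ← HS.enorm_sq_of_kernel (Φ := HS.mk (z h) (κ h) hh (hz h))
      hh (hz h), ← ENNReal.rpow_natCast, ← ENNReal.rpow_mul]
    norm_num

theorem tendsto_coe_nhdsGT : Tendsto (fun h : ℝ≥0 => (h : ℝ)) (𝓝[>] 0) (𝓝[>] 0) := by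
  refine tendsto_nhdsWithin_iff.2 ⟨?_, ?_⟩
  · exact (NNReal.continuous_coe.tendsto 0).mono_left nhdsWithin_le_nhds
  · filter_upwards [self_mem_nhdsWithin] with h hh
    exact NNReal.coe_pos.2 hh

theorem tendsto_toNNReal_nhdsGT : Tendsto (fun h : ℝ => h.toNNReal) (𝓝[>] 0) (𝓝[>] 0) := by
  refine tendsto_nhdsWithin_iff.2 ⟨?_, ?_⟩
  · have := continuous_real_toNNReal.tendsto 0
    rw [Real.toNNReal_zero] at this
    exact this.mono_left nhdsWithin_le_nhds
  · filter_upwards [self_mem_nhdsWithin] with h hh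
    exact Real.toNNReal_pos.2 hh

theorem hasTraceRight_of_kernel {A : L2 →L[ℂ] L2} {k : ℝ × ℝ → ℂ} (hA : HasKernel A k)
    (hk : AEStronglyMeasurable k quadrant) {a : L2}
    (h : Tendsto (fun h : ℝ => (ENNReal.ofReal h)⁻¹ *
      ∫⁻ y in Ioc 0 h, ∫⁻ x, ‖k (x, y) - a x‖ₑ ^ 2 ∂halfLine) (𝓝[>] 0) (𝓝 0)) :
    HasTraceRight A a := by
  refine hsTendsto_zero_of_kernel
    (fun t => aestronglyMeasurable_traceKernel hk (Lp.memLp a).1 t)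
    (fun t => hasKernel_traceKernel hA a t) ?_
  refine (h.comp tendsto_coe_nhdsGT).congr' ?_
  filter_upwards [self_mem_nhdsWithin] with t ht
  rw [lintegral_traceKernel hk (Lp.memLp a).1 ht, Function.comp_apply]

theorem aestronglyMeasurable_swap {k : ℝ × ℝ → ℂ} (hk : AEStronglyMeasurable k quadrant) :
    AEStronglyMeasurable (fun p : ℝ × ℝ => k p.swap) quadrant :=
  hk.comp_quasiMeasurePreserving Measure.measurePreserving_swap.quasiMeasurePreserving

theorem hasTraceLeft_of_kernel {B : L2 →L[ℂ] L2} {k : ℝ × ℝ → ℂ} (hB : HasKernel B k)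
    (hk : AEStronglyMeasurable k quadrant) {b : L2}
    (h : Tendsto (fun h : ℝ => (ENNReal.ofReal h)⁻¹ *
      ∫⁻ x in Ioc 0 h, ∫⁻ y, ‖k (x, y) - star (b y)‖ₑ ^ 2 ∂halfLine) (𝓝[>] 0) (𝓝 0)) :
    HasTraceLeft B b := by
  have hb : AEStronglyMeasurable (fun y => star (b y)) halfLine := (Lp.memLp b).star.1
  refine hsTendsto_zero_of_kernel
    (fun t => aestronglyMeasurable_swap
      (aestronglyMeasurable_traceKernel (aestronglyMeasurable_swap hk) hb t))
    (fun t => hasKernel_traceKernel_left hB b t) ?_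
  refine (h.comp tendsto_coe_nhdsGT).congr' ?_
  filter_upwards [self_mem_nhdsWithin] with t ht
  rw [HS.lintegral_swap_quadrant fun p =>
      ‖traceKernel (fun q => k q.swap) (fun y => star (b y)) t p‖ₑ ^ 2,
    lintegral_traceKernel (aestronglyMeasurable_swap hk) hb ht, Function.comp_apply]
  rfl

theorem memLp_traceKernel {k : ℝ × ℝ → ℂ} (hk : MemLp k 2 quadrant) {a : ℝ → ℂ}
    (ha : MemLp a 2 halfLine) {h : ℝ≥0} (hh : 0 < h) : MemLp (traceKernel k a h) 2 quadrant := by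
  rw [memLp_two_iff_lintegral (aestronglyMeasurable_traceKernel hk.1 ha.1 h),
    lintegral_traceKernel hk.1 ha.1 hh]
  have hne : (ENNReal.ofReal h)⁻¹ ≠ ∞ := by
    rw [ENNReal.inv_ne_top]; simpa using hh.ne'
  refine ENNReal.mul_ne_top hne ?_
  have hK := (memLp_two_iff_lintegral hk.1).1 hk
  rw [lintegral_prod_symm _ (hk.1.enorm.pow_const 2)] at hK
  have hA := (memLp_two_iff_lintegral ha.1).1 ha
  have hle : volume.restrict (Ioc 0 (h : ℝ)) ≤ halfLine :=
    Measure.restrict_mono Ioc_subset_Ioi_self le_rfl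
  have hb : ∫⁻ y in Ioc 0 (h : ℝ), ∫⁻ x, ‖k (x, y) - a x‖ₑ ^ 2 ∂halfLine ≤
      ∫⁻ y in Ioc 0 (h : ℝ), ((2 * ∫⁻ x, ‖k (x, y)‖ₑ ^ 2 ∂halfLine) +
        2 * ∫⁻ x, ‖a x‖ₑ ^ 2 ∂halfLine) := by
    refine lintegral_mono fun y => ?_
    simp only
    rw [← lintegral_const_mul' _ _ (by norm_num), ← lintegral_const_mul' _ _ (by norm_num),
      ← lintegral_add_right' _ ((ha.1.enorm.pow_const 2).const_mul 2)]
    refine lintegral_mono fun x => ?_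
    have := enorm_add_sq_le (k (x, y)) (-a x)
    rwa [← sub_eq_add_neg, enorm_neg] at this
  refine ne_top_of_le_ne_top ?_ hb
  rw [lintegral_add_right _ measurable_const, lintegral_const_mul' _ _ (by norm_num),
    setLIntegral_const, Real.volume_Ioc]
  refine ENNReal.add_ne_top.2 ⟨ENNReal.mul_ne_top (by norm_num)
    (ne_top_of_le_ne_top hK (lintegral_mono' hle le_rfl)),
    ENNReal.mul_ne_top (ENNReal.mul_ne_top (by norm_num) hA) ENNReal.ofReal_ne_top⟩

theorem HasTraceRight.hasBoundaryValueRight {Φ : HS} {a : L2} (h : HasTraceRight Φ.op a) :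
    HasBoundaryValueRight Φ a := by
  obtain ⟨X, hX, hlim⟩ := h
  have h1 := ENNReal.Tendsto.pow (n := 2) (hlim.enorm.comp tendsto_toNNReal_nhdsGT)
  rw [enorm_zero, zero_pow two_ne_zero] at h1
  refine h1.congr' ?_
  filter_upwards [tendsto_toNNReal_nhdsGT.eventually hX, self_mem_nhdsWithin] with t ht ht0
  have ht0' : 0 < t.toNNReal := Real.toNNReal_pos.2 ht0
  have hk := hasKernel_traceKernel Φ.hasKernel_bracket a t.toNNReal
  rw [← ht] at hk
  rw [Function.comp_apply, HS.enorm_sq_of_kernel (memLp_traceKernel (Lp.memLp Φ.bracket)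
      (Lp.memLp a) ht0') hk, lintegral_traceKernel (Lp.memLp Φ.bracket).1 (Lp.memLp a).1 ht0',
    Real.coe_toNNReal t (le_of_lt ht0)]

theorem HasTraceLeft.hasBoundaryValueLeft {Φ : HS} {b : L2} (h : HasTraceLeft Φ.op b) :
    HasBoundaryValueLeft Φ (star b) := by
  obtain ⟨X, hX, hlim⟩ := h
  have h1 := ENNReal.Tendsto.pow (n := 2) (hlim.enorm.comp tendsto_toNNReal_nhdsGT)
  rw [enorm_zero, zero_pow two_ne_zero] at h1
  refine h1.congr' ?_
  filter_upwards [tendsto_toNNReal_nhdsGT.eventually hX, self_mem_nhdsWithin] with t ht ht0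
  have ht0' : 0 < t.toNNReal := Real.toNNReal_pos.2 ht0
  have hk := hasKernel_traceKernel_left Φ.hasKernel_bracket b t.toNNReal
  have hs : MeasurePreserving Prod.swap quadrant quadrant := Measure.measurePreserving_swap
  have hm : MemLp (fun p : ℝ × ℝ => Φ.bracket p.swap) 2 quadrant :=
    (Lp.memLp Φ.bracket).comp_measurePreserving hs
  have hb : MemLp (fun y => star (b y)) 2 halfLine := (Lp.memLp b).star
  rw [← ht] at hk
  rw [Function.comp_apply, HS.enorm_sq_of_kernel
      ((memLp_traceKernel hm hb ht0').comp_measurePreserving hs) hk]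
  simp only [Function.comp_apply]
  rw [HS.lintegral_swap_quadrant fun p =>
      ‖traceKernel (fun q => Φ.bracket q.swap) (fun y => star (b y)) t.toNNReal p‖ₑ ^ 2,
    lintegral_traceKernel hm.1 hb.1 ht0', Real.coe_toNNReal t (le_of_lt ht0)]
  congr 1
  refine lintegral_congr fun x => lintegral_congr_ae ?_
  filter_upwards [Lp.coeFn_star b] with y hy
  rw [hy]
  rfl

/-! ### The cocycle -/

theorem lintegral_orbitDeriv (t : ℝ≥0) (Φ Φ' : HS) :
    ∫⁻ p, ‖((t : ℝ) : ℂ)⁻¹ * (Φ.bracket (p.1 + t, p.2 + t) - Φ.bracket p) - Φ'.bracket p‖ₑ ^ 2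
      ∂quadrant = ‖((t : ℝ) : ℂ)⁻¹ • (sigma t Φ - Φ) - Φ'‖ₑ ^ 2 := by
  have e : (((t : ℝ) : ℂ)⁻¹ • (sigma t Φ - Φ) - Φ').bracket =
      ((t : ℝ) : ℂ)⁻¹ • ((sigma t Φ).bracket - Φ.bracket) - Φ'.bracket := by
    change HS.bracketₗ _ = _
    rw [map_sub, map_smul, map_sub]; rfl
  rw [HS.enorm_sq, e]
  refine lintegral_congr_ae ?_
  filter_upwards [Lp.coeFn_sub (((t : ℝ) : ℂ)⁻¹ • ((sigma t Φ).bracket - Φ.bracket)) Φ'.bracket,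
    Lp.coeFn_smul (((t : ℝ) : ℂ)⁻¹) ((sigma t Φ).bracket - Φ.bracket),
    Lp.coeFn_sub (sigma t Φ).bracket Φ.bracket, bracket_sigma t Φ] with p h1 h2 h3 h4
  rw [h1, Pi.sub_apply, h2, Pi.smul_apply, h3, Pi.sub_apply, h4, smul_eq_mul]

theorem tendsto_lintegral_orbitDeriv {Φ Φ' : HS} (h : HasOrbitDeriv sigma Φ Φ') :
    Tendsto (fun n : ℕ => ∫⁻ p, ‖((((n : ℝ≥0) + 1)⁻¹ : ℝ≥0) : ℂ)⁻¹ *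
      (Φ.bracket (p.1 + (((n : ℝ≥0) + 1)⁻¹ : ℝ≥0), p.2 + (((n : ℝ≥0) + 1)⁻¹ : ℝ≥0)) - Φ.bracket p) -
      Φ'.bracket p‖ₑ ^ 2 ∂quadrant) atTop (𝓝 0) := by
  have hseq := (tendsto_iff_norm_sub_tendsto_zero.1 h).comp tendsto_inv_natCast_succ'
  have h2 := ENNReal.Tendsto.pow (n := 2) (ENNReal.tendsto_ofReal hseq)
  simp only [ENNReal.ofReal_zero, zero_pow two_ne_zero] at h2
  refine h2.congr fun n => ?_
  rw [Function.comp_apply, ofReal_norm]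
  exact (lintegral_orbitDeriv _ Φ Φ').symm

theorem exists_hasTraceRight {Φ Φ' : HS} (h : HasOrbitDeriv sigma Φ Φ') :
    ∃ a : L2, HasTraceRight Φ.op a := by
  obtain ⟨a, ha⟩ := exists_trace (Lp.stronglyMeasurable Φ.bracket).measurable
    (Lp.stronglyMeasurable Φ'.bracket).measurable (Lp.memLp _) (Lp.memLp _)
    (h := fun n : ℕ => ((n : ℝ≥0) + 1)⁻¹) (fun n => by positivity) tendsto_inv_natCast_succ
    (tendsto_lintegral_orbitDeriv h)
  exact ⟨a, hasTraceRight_of_kernel Φ.hasKernel_bracket (Lp.memLp _).1 ha⟩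

theorem exists_hasTraceLeft {Φ Φ' : HS} (h : HasOrbitDeriv sigma Φ Φ') :
    ∃ b : L2, HasTraceLeft Φ.op b := by
  have hs : MeasurePreserving Prod.swap quadrant quadrant := Measure.measurePreserving_swap
  obtain ⟨b, hb⟩ := exists_trace (k := fun p => Φ.bracket p.swap) (g := fun p => Φ'.bracket p.swap)
    ((Lp.stronglyMeasurable Φ.bracket).measurable.comp measurable_swap)
    ((Lp.stronglyMeasurable Φ'.bracket).measurable.comp measurable_swap)
    ((Lp.memLp _).comp_measurePreserving hs) ((Lp.memLp _).comp_measurePreserving hs)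
    (h := fun n : ℕ => ((n : ℝ≥0) + 1)⁻¹) (fun n => by positivity) tendsto_inv_natCast_succ
    ((tendsto_lintegral_orbitDeriv h).congr fun n => by
      rw [← HS.lintegral_swap_quadrant]; rfl)
  refine ⟨star b, hasTraceLeft_of_kernel Φ.hasKernel_bracket (Lp.memLp _).1 (hb.congr fun t => ?_)⟩
  congr 1
  refine lintegral_congr fun x => lintegral_congr_ae ?_
  filter_upwards [Lp.coeFn_star b] with y hy
  rw [hy, Pi.star_apply, star_star]
  rfl

/-- The failure of the Leibniz rule is the rank one operator formed from the boundary values. -/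
theorem cocycle_eq_rankOne {Φ Ψ : HS} (hΦ : Φ ∈ (generator sigma).domain)
    (hΨ : Ψ ∈ (generator sigma).domain) (hΦΨ : Φ * Ψ ∈ (generator sigma).domain) {a b : L2}
    (ha : HasTraceRight Φ.op a) (hb : HasTraceLeft Ψ.op b) :
    cocycle (generator sigma) Φ Ψ hΦ hΨ hΦΨ = HS.rankOne a b := by
  have h1 := hasOrbitDeriv_generator sigma ⟨Φ, hΦ⟩
  have h2 := hasOrbitDeriv_generator sigma ⟨Ψ, hΨ⟩
  have h3 := hasOrbitDeriv_generator sigma ⟨Φ * Ψ, hΦΨ⟩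
  have h0 : Tendsto (fun h : ℝ≥0 => sigma h Ψ) (𝓝[>] 0) (𝓝 Ψ) :=
    tendsto_sigma nhdsWithin_le_nhds tendsto_const_nhds
  have hL : Tendsto (fun h : ℝ≥0 => ((h : ℝ) : ℂ)⁻¹ • (sigma h (Φ * Ψ) - sigma h Φ * sigma h Ψ))
      (𝓝[>] 0) (𝓝 (cocycle (generator sigma) Φ Ψ hΦ hΨ hΦΨ)) := by
    refine ((Tendsto.sub h3 (HS.tendsto_mul h1 h0)).sub
      (HS.tendsto_mul (tendsto_const_nhds (x := Φ)) h2)).congr fun h => ?_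
    rw [HS.mul_smul', HS.smul_mul', ← smul_sub, ← smul_sub]
    congr 1
    noncomm_ring
  obtain ⟨Z, hZ, hZl⟩ := ha.hsTendsto_mul hb
  have hR := tendsto_sigma nhdsWithin_le_nhds hZl
  refine tendsto_nhds_unique hL (hR.congr' ?_)
  filter_upwards [hZ] with t ht
  refine HS.op_injective ?_
  rw [sigma_op, ht]
  simp only [HS.op_smul, HS.op_sub, HS.op_mul, sigma_op]
  rw [mul_smul_comm, smul_mul_assoc, cutoff]
  congr 1
  simp only [mul_sub, sub_mul, mul_one, mul_assoc]

/-- Pöppe's identity: sandwiching the rank one cocycle between `Υ` and `Λ` transforms its two factors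
into the boundary values of `Υ Φ` and `Ψ Λ`. -/
theorem exists_boundaryValues {Φ Ψ : HS} (hΦ : Φ ∈ (generator sigma).domain)
    (hΨ : Ψ ∈ (generator sigma).domain) (hΦΨ : Φ * Ψ ∈ (generator sigma).domain) (Υ Λ : HS) :
    ∃ a b : L2, HasBoundaryValueRight (Υ * Φ) a ∧ HasBoundaryValueLeft (Ψ * Λ) b ∧
      ∀ᵐ p ∂quadrant,
        (Υ * cocycle (generator sigma) Φ Ψ hΦ hΨ hΦΨ * Λ).bracket p = a p.1 * b p.2 := by
  obtain ⟨a, ha⟩ := exists_hasTraceRight (hasOrbitDeriv_generator sigma ⟨Φ, hΦ⟩)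
  obtain ⟨b, hb⟩ := exists_hasTraceLeft (hasOrbitDeriv_generator sigma ⟨Ψ, hΨ⟩)
  refine ⟨Υ.op a, star (ContinuousLinearMap.adjoint Λ.op b),
    HasTraceRight.hasBoundaryValueRight (Φ := Υ * Φ) (ha.lmul Υ.op),
    HasTraceLeft.hasBoundaryValueLeft (Φ := Ψ * Λ) (hb.rmul Λ.op), ?_⟩
  rw [cocycle_eq_rankOne hΦ hΨ hΦΨ ha hb]
  have e : Υ * HS.rankOne a b * Λ =
      HS.rankOne (Υ.op a) (ContinuousLinearMap.adjoint Λ.op b) := by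
    refine HS.op_injective ?_
    simp only [HS.op_mul, HS.op_rankOne]
    rw [← rankOne_mul]
    congr 1
    exact InnerProductSpace.comp_rankOne _ _ _
  rw [e]
  have hs := (Measure.quasiMeasurePreserving_snd (μ := halfLine) (ν := halfLine)).ae
    (Lp.coeFn_star (ContinuousLinearMap.adjoint Λ.op b))
  filter_upwards [HS.bracket_ae_eq (Φ := HS.rankOne (Υ.op a) (ContinuousLinearMap.adjoint Λ.op b))
    (HS.memLp_rankOne _ _) (HS.hasKernel_rankOne _ _), hs] with p h1 h2
  rw [h1, h2, Pi.star_apply]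

/-- The Hochschild cocycle relation holds for any partially defined linear operator. -/
theorem cocycle_relation (D : HS →ₗ.[ℂ] HS) (Υ Φ Ψ : HS) (hΥ : Υ ∈ D.domain) (hΦ : Φ ∈ D.domain)
    (hΨ : Ψ ∈ D.domain) (hΥΦ : Υ * Φ ∈ D.domain) (hΦΨ : Φ * Ψ ∈ D.domain)
    (hl : (Υ * Φ) * Ψ ∈ D.domain) (hr : Υ * (Φ * Ψ) ∈ D.domain) :
    Υ * cocycle D Φ Ψ hΦ hΨ hΦΨ - cocycle D (Υ * Φ) Ψ hΥΦ hΨ hl +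
      cocycle D Υ (Φ * Ψ) hΥ hΦΨ hr - cocycle D Υ Φ hΥ hΦ hΥΦ * Ψ = 0 := by
  have e : D ⟨(Υ * Φ) * Ψ, hl⟩ = D ⟨Υ * (Φ * Ψ), hr⟩ :=
    congrArg D (Subtype.ext (mul_assoc Υ Φ Ψ))
  simp only [cocycle, e]
  noncomm_ring

/-! ### The generator at a product of Hankel operators has finite rank -/

/-- A Hankel operator intertwines the left and the right translations, because its kernel depends
only on `x + y`. -/
theorem IsHankel.shiftAdj_mul {Γ : L2 →L[ℂ] L2} {φ : ℝ → ℂ} (h : IsHankel Γ φ) (t : ℝ≥0) :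
    shiftAdj t * Γ = Γ * shift t := by
  ext1 f
  refine Lp.ext ?_
  filter_upwards [h (shift t f), ae_halfLine_of_ae_Ioi t (h f), shiftAdj_ae t (Γ f)] with x h1 h2 h3
  rw [mul_apply_eq_comp, mul_apply_eq_comp, h3, h2.2, h1.2]
  have e : (fun y => φ (x + y) * shift t f y) =ᵐ[halfLine]
      fun y => φ (x + y) * shiftFun t f y := by
    filter_upwards [shift_ae t f] with y hy
    rw [hy]
  rw [integral_congr_ae e, integral_shiftFun_mul]
  refine integral_congr_ae (Eventually.of_forall fun y => ?_)
  simp only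
  congr 2; ring

theorem adjoint_mul_shift {Γ : L2 →L[ℂ] L2} (h : ∀ t, shiftAdj t * Γ = Γ * shift t) (t : ℝ≥0)
    (f : L2) : ContinuousLinearMap.adjoint Γ (shift t f) =
      shiftAdj t (ContinuousLinearMap.adjoint Γ f) := by
  have h1 := congrArg star (h t)
  rw [star_mul, star_mul] at h1
  have h2 : star (shiftAdj t) = shift t := adjoint_shiftAdj t
  have h3 : star (shift t) = shiftAdj t := rfl
  rw [h2, h3] at h1
  exact congrArg (fun A : L2 →L[ℂ] L2 => A f) h1

theorem adjoint_mem_shiftAdjDomain {Γ : L2 →L[ℂ] L2} (h : ∀ t, shiftAdj t * Γ = Γ * shift t)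
    {f : L2} (hf : f ∈ shiftDomain) :
    ContinuousLinearMap.adjoint Γ f ∈ shiftAdjDomain := by
  obtain ⟨f', hf'⟩ := hf
  refine ⟨ContinuousLinearMap.adjoint Γ f', ?_⟩
  refine (((ContinuousLinearMap.adjoint Γ).continuous.tendsto f').comp hf').congr fun t => ?_
  simp only [Function.comp_apply, ContinuousLinearMap.coe_coe, map_smul, map_sub,
    adjoint_mul_shift h]

/-- The domain of the generator of the right translations is dense: it contains the averages
`∫₀^a S_r x dr`. -/
theorem shiftDomain_orthogonal : shiftDomainᗮ = ⊥ := by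
  rw [eq_bot_iff]
  intro x hx
  rw [Submodule.mem_bot]
  have hC0 : Continuous fun t : ℝ≥0 => shift t x :=
    (IsC0Semigroup.of_contraction (T := fun t => (shift t).toLinearMap)
      (by rw [shift_zero]; rfl) (fun s t => by rw [shift_add]; rfl)
      (fun t f => (norm_shift_apply t f).le) tendsto_shift_zero).strongly_continuous x
  set c : ℝ → L2 := fun r => shift r.toNNReal x with hc
  have hcc : Continuous c := hC0.comp continuous_real_toNNReal
  set W : ℝ → L2 := fun u => ∫ r in (0 : ℝ)..u, c r with hW
  have hderiv : ∀ u, HasDerivAt W (c u) u := fun u =>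
    intervalIntegral.integral_hasDerivAt_right (hcc.intervalIntegrable _ _)
      hcc.stronglyMeasurable.stronglyMeasurableAtFilter hcc.continuousAt
  have hW0 : W 0 = 0 := intervalIntegral.integral_same
  have hshift : ∀ (a : ℝ) (ε : ℝ≥0), 0 ≤ a → shift ε (W a) = W (a + ε) - W ε := by
    intro a ε ha
    have h1 : shift ε (W a) = ∫ r in (0 : ℝ)..a, shift ε (c r) :=
      ((shift ε).intervalIntegral_comp_comm (hcc.intervalIntegrable _ _)).symm
    have h2 : ∫ r in (0 : ℝ)..a, shift ε (c r) = ∫ r in (0 : ℝ)..a, c (r + ε) := by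
      refine intervalIntegral.integral_congr fun r hr => ?_
      rw [uIcc_of_le ha] at hr
      simp only [hc]
      rw [Real.toNNReal_add hr.1 ε.coe_nonneg, Real.toNNReal_coe, add_comm, shift_add]
      rfl
    rw [h1, h2, intervalIntegral.integral_comp_add_right, zero_add, hW,
      eq_sub_iff_add_eq, add_comm]
    exact intervalIntegral.integral_add_adjacent_intervals (hcc.intervalIntegrable _ _)
      (hcc.intervalIntegrable _ _)
  have hseq : Tendsto (fun ε : ℝ≥0 => (ε : ℝ)) (𝓝[>] 0) (𝓝[≠] 0) :=
    tendsto_coe_nhdsGT.mono_right (nhdsWithin_mono _ fun y hy => ne_of_gt hy)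
  have hdom : ∀ a : ℝ, 0 ≤ a → W a ∈ shiftDomain := by
    intro a ha
    refine ⟨c a - c 0, ?_⟩
    have h1 := ((hderiv a).tendsto_slope_zero.comp hseq).sub
      ((hderiv 0).tendsto_slope_zero.comp hseq)
    refine h1.congr fun ε => ?_
    simp only [Function.comp_apply, ContinuousLinearMap.coe_coe]
    rw [hshift a ε ha, zero_add, hW0, sub_zero, ← smul_sub, ← Complex.ofReal_inv,
      Complex.coe_smul]
    congr 1
    abel
  have h1 : Tendsto (fun ε : ℝ≥0 => inner ℂ ((ε : ℝ)⁻¹ • W ε) x) (𝓝[>] 0) (𝓝 (inner ℂ (c 0) x)) := by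
    have h2 := (hderiv 0).tendsto_slope_zero.comp hseq
    refine (h2.inner tendsto_const_nhds).congr fun ε => ?_
    simp [hW0]
  have h2 : ∀ ε : ℝ≥0, inner ℂ ((ε : ℝ)⁻¹ • W ε) x = 0 := by
    intro ε
    have h3 := (Submodule.mem_orthogonal _ _).1 hx (W ε) (hdom ε ε.coe_nonneg)
    have e : (ε : ℝ)⁻¹ • W ε = (((ε : ℝ)⁻¹ : ℝ) : ℂ) • W ε := (Complex.coe_smul _ _).symm
    rw [e, inner_smul_left, h3, mul_zero]
  simp only [h2] at h1
  have h3 : inner ℂ (c 0) x = 0 := tendsto_nhds_unique h1 tendsto_const_nhds |>.symm ▸ rfl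
  have h4 : c 0 = x := by
    simp only [hc, Real.toNNReal_zero, shift_zero]
    rfl
  rw [h4] at h3
  exact inner_self_eq_zero.1 h3

/-- A subspace that contains the kernel of a map of finite rank on `D` has a finite-dimensional
complement in `D`. -/
theorem exists_finiteDimensional_sup {E Y : Type*} [AddCommGroup E] [Module ℂ E] [AddCommGroup Y]
    [Module ℂ Y] {D D' : Submodule ℂ E} (g : D →ₗ[ℂ] Y) [FiniteDimensional ℂ (LinearMap.range g)]
    (h : ∀ x : D, g x = 0 → (x : E) ∈ D') :
    ∃ F : Submodule ℂ E, FiniteDimensional ℂ F ∧ D ≤ D' ⊔ F := by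
  obtain ⟨s, hs⟩ := LinearMap.exists_rightInverse_of_surjective g.rangeRestrict
    (LinearMap.range_rangeRestrict g)
  refine ⟨LinearMap.range (D.subtype ∘ₗ s), inferInstance, fun x hx => ?_⟩
  set y : D := s (g.rangeRestrict ⟨x, hx⟩) with hy
  have h1 : g y = g ⟨x, hx⟩ := congrArg Subtype.val
    (LinearMap.congr_fun hs (g.rangeRestrict ⟨x, hx⟩))
  have h2 : ((⟨x, hx⟩ - y : D) : E) ∈ D' := h _ (by rw [map_sub, h1, sub_self])
  have h3 : (y : E) ∈ LinearMap.range (D.subtype ∘ₗ s) := ⟨_, rfl⟩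
  have e : x = ((⟨x, hx⟩ - y : D) : E) + y := by simp
  rw [e]
  exact Submodule.add_mem_sup h2 h3

/-- The boundary condition at `0` is a single linear condition. -/
theorem exists_shiftAdjDomain_le :
    ∃ F : Submodule ℂ L2, FiniteDimensional ℂ F ∧ shiftAdjDomain ≤ shiftDomain ⊔ F := by
  let T : ℝ≥0 → L2 →ₗ[ℂ] L2 := fun t => (shiftAdj t).toLinearMap
  let g : (generator T).domain →ₗ[ℂ] ℂ :=
    (innerSL ℂ (memLp_exp_neg.toLp _ : L2)).toLinearMap ∘ₗ
      ((generator T).domain.subtype - (generator T).toFun)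
  refine exists_finiteDimensional_sup g fun x hx => ?_
  exact mem_shiftDomain_of_inner_eq_zero (hasOrbitDeriv_generator T x) hx

/-- The `f` such that `f`, `Γ₁†f`, `Γ₂†Γ₁†f`, … all belong to the domain of the generator of the
right translations. -/
noncomputable def chainDomain : List (L2 →L[ℂ] L2) → Submodule ℂ L2
  | [] => shiftDomain
  | Γ :: L => shiftDomain ⊓
      (chainDomain L).comap (ContinuousLinearMap.adjoint Γ).toLinearMap

/-- Each adjoint Hankel operator costs at most one dimension, because it maps the domain of the
generator of the right translations into that of the left translations. -/
theorem exists_shiftDomain_le_chainDomain (L : List (L2 →L[ℂ] L2))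
    (hL : ∀ Γ ∈ L, ∀ t, shiftAdj t * Γ = Γ * shift t) :
    ∃ F : Submodule ℂ L2, FiniteDimensional ℂ F ∧ shiftDomain ≤ chainDomain L ⊔ F := by
  induction L with
  | nil => exact ⟨⊥, inferInstance, le_sup_left⟩
  | cons Γ L ih =>
    obtain ⟨F, hF, hle⟩ := ih fun Γ' h => hL Γ' (List.mem_cons_of_mem _ h)
    obtain ⟨F', hF', hle'⟩ := exists_shiftAdjDomain_le
    let g : shiftDomain →ₗ[ℂ] L2 ⧸ chainDomain L :=
      (chainDomain L).mkQ ∘ₗ (ContinuousLinearMap.adjoint Γ).toLinearMap ∘ₗ shiftDomain.subtype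
    have hrange : LinearMap.range g ≤ (F ⊔ F').map (chainDomain L).mkQ := by
      rintro _ ⟨x, rfl⟩
      have h1 := hle' (adjoint_mem_shiftAdjDomain (hL Γ List.mem_cons_self) x.2)
      have h2 : shiftDomain ⊔ F' ≤ chainDomain L ⊔ (F ⊔ F') := by
        rw [← sup_assoc]
        exact sup_le_sup_right hle F'
      obtain ⟨y, hy, z, hz, hyz⟩ := Submodule.mem_sup.1 (h2 h1)
      refine ⟨z, hz, ?_⟩
      change (chainDomain L).mkQ z = (chainDomain L).mkQ (ContinuousLinearMap.adjoint Γ (x : L2))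
      rw [← hyz, map_add]
      have : (chainDomain L).mkQ y = 0 := (Submodule.Quotient.mk_eq_zero _).2 hy
      rw [this, zero_add]
    have : FiniteDimensional ℂ (LinearMap.range g) := Submodule.finiteDimensional_of_le hrange
    refine exists_finiteDimensional_sup g fun x hx => ?_
    have hx' : (chainDomain L).mkQ (ContinuousLinearMap.adjoint Γ (x : L2)) = 0 := hx
    exact ⟨x.2, (Submodule.Quotient.mk_eq_zero (chainDomain L)).1 hx'⟩

/-- `u(h) = o(h)` as `h → 0+`. -/
def LittleO (u : ℝ≥0 → L2) : Prop :=
  Tendsto (fun h : ℝ≥0 => ((h : ℝ) : ℂ)⁻¹ • u h) (𝓝[>] 0) (𝓝 0)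

theorem LittleO.add {u v : ℝ≥0 → L2} (hu : LittleO u) (hv : LittleO v) :
    LittleO fun h => u h + v h := by
  have := Tendsto.add hu hv
  rw [add_zero] at this
  exact this.congr fun h => (smul_add _ _ _).symm

theorem LittleO.map {u : ℝ≥0 → L2} (hu : LittleO u) (B : L2 →L[ℂ] L2) :
    LittleO fun h => B (u h) := by
  have := (B.continuous.tendsto 0).comp hu
  rw [map_zero] at this
  exact this.congr fun h => by simp

theorem LittleO.congr {u v : ℝ≥0 → L2} (hu : LittleO u) (h : ∀ t, u t = v t) : LittleO v := by
  have e : u = v := funext h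
  rwa [← e]

theorem littleO_shift_add_shiftAdj {p : L2} (hp : p ∈ shiftDomain) :
    LittleO fun h => (shift h p - p) + (shiftAdj h p - p) := by
  obtain ⟨p', hp'⟩ := hp
  have := Tendsto.add hp' hp'.shiftAdj_of_shift
  rw [add_neg_cancel] at this
  exact this.congr fun h => (smul_add _ _ _).symm

/-- On `chainDomain L`, the adjoint of a product of an even number of Hankel operators commutes
with the right translations to first order. -/
theorem littleO_commutator : ∀ (L : List (L2 →L[ℂ] L2)), Even L.length →
    (∀ Γ ∈ L, ∀ t, shiftAdj t * Γ = Γ * shift t) → ∀ f ∈ chainDomain L,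
      LittleO fun h => ContinuousLinearMap.adjoint L.prod (shift h f) -
        shift h (ContinuousLinearMap.adjoint L.prod f)
  | [], _, _, f, _ => by
    simp [LittleO, adjoint_one]
  | [_], h, _, _, _ => by simp at h
  | A :: B :: L, h, hL, f, hf => by
    have hLe : Even L.length := by
      simpa [Nat.even_add_one, Nat.even_add] using h
    have hA := hL A List.mem_cons_self
    have hB := hL B (List.mem_cons_of_mem _ List.mem_cons_self)
    have hL' : ∀ Γ ∈ L, ∀ t, shiftAdj t * Γ = Γ * shift t := fun Γ hΓ =>
      hL Γ (List.mem_cons_of_mem _ (List.mem_cons_of_mem _ hΓ))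
    set p := ContinuousLinearMap.adjoint A f with hp
    set q := ContinuousLinearMap.adjoint B p with hq
    have hp0 : p ∈ shiftDomain := hf.2.1
    have hqc : q ∈ chainDomain L := hf.2.2
    have hq0 : q ∈ shiftDomain := by
      cases L with
      | nil => exact hqc
      | cons _ _ => exact hqc.1
    set R := ContinuousLinearMap.adjoint L.prod with hR
    have hprod : ∀ g, ContinuousLinearMap.adjoint (A :: B :: L).prod g =
        R (ContinuousLinearMap.adjoint B (ContinuousLinearMap.adjoint A g)) := fun g => by
      rw [List.prod_cons, List.prod_cons, ContinuousLinearMap.mul_def, ContinuousLinearMap.mul_def,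
        ContinuousLinearMap.adjoint_comp, ContinuousLinearMap.adjoint_comp]
      rfl
    -- `B†A†S_h f = B†S_h†p = B†(2p - S_h p) + o(h) = 2q - S_h†q + o(h) = S_h q + o(h)`
    have h1 : LittleO fun t => ContinuousLinearMap.adjoint B (ContinuousLinearMap.adjoint A (shift t f)) -
        shift t q := by
      have h2 := ((littleO_shift_add_shiftAdj hp0).map (ContinuousLinearMap.adjoint B)).add
        ((littleO_shift_add_shiftAdj hq0).map (-1))
      refine h2.congr fun t => ?_
      rw [adjoint_mul_shift hA, ← hp]
      simp only [map_add, map_sub, adjoint_mul_shift hB, ← hq, neg_apply,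
        one_apply_eq_self]
      abel
    have h3 := (h1.map R).add (littleO_commutator L hLe hL' q hqc)
    refine h3.congr fun t => ?_
    rw [hprod, hprod, map_sub]
    abel

/-- Finite codimension relative to a dense subspace bounds the orthogonal complement. -/
theorem finiteDimensional_orthogonal {K F : Submodule ℂ L2} [FiniteDimensional ℂ F]
    (h : shiftDomain ≤ K ⊔ F) : FiniteDimensional ℂ Kᗮ := by
  let g : Kᗮ →ₗ[ℂ] F := F.orthogonalProjectionOnto.toLinearMap ∘ₗ Kᗮ.subtype
  refine FiniteDimensional.of_injective g ?_
  rw [← LinearMap.ker_eq_bot, eq_bot_iff]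
  intro x hx
  have hx' : F.orthogonalProjectionOnto (x : L2) = 0 := hx
  have h1 : (x : L2) ∈ Fᗮ := by
    rwa [← Submodule.ker_orthogonalProjectionOnto]
  have h2 : (x : L2) ∈ (K ⊔ F)ᗮ := by
    rw [← Submodule.inf_orthogonal]
    exact ⟨x.2, h1⟩
  have h3 := Submodule.orthogonal_le h h2
  rw [shiftDomain_orthogonal, Submodule.mem_bot] at h3
  rw [Submodule.mem_bot]
  exact Subtype.ext h3

/-- The generator at a product of an even number of Hankel operators has finite rank. -/
theorem finiteDimensional_range_of_hankel (L : List (L2 →L[ℂ] L2)) (hlen : Even L.length)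
    (hL : ∀ Γ ∈ L, ∀ t, shiftAdj t * Γ = Γ * shift t) {G G' : HS} (hG : G.op = L.prod)
    (h : HasOrbitDeriv sigma G G') : FiniteDimensional ℂ (LinearMap.range G'.op.toLinearMap) := by
  obtain ⟨F, hF, hle⟩ := exists_shiftDomain_le_chainDomain L hL
  have hfin := finiteDimensional_orthogonal hle
  refine Submodule.finiteDimensional_of_le (S₂ := (chainDomain L)ᗮ) ?_
  rintro _ ⟨g, rfl⟩
  rw [Submodule.mem_orthogonal]
  intro f hf
  have h1 : Tendsto (fun t : ℝ≥0 => inner ℂ f ((((t : ℝ) : ℂ)⁻¹ • (sigma t G - G)).op g)) (𝓝[>] 0)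
      (𝓝 (inner ℂ f (G'.op g))) :=
    tendsto_const_nhds.inner (HS.tendsto_op_apply h g)
  set R := ContinuousLinearMap.adjoint L.prod with hR
  have h2 : ∀ t : ℝ≥0, inner ℂ f ((((t : ℝ) : ℂ)⁻¹ • (sigma t G - G)).op g) =
      inner ℂ (shiftAdj t (((t : ℝ) : ℂ)⁻¹ • (R (shift t f) - shift t (R f)))) g := by
    intro t
    have e1 : (((t : ℝ) : ℂ)⁻¹ • (sigma t G - G)).op g =
        ((t : ℝ) : ℂ)⁻¹ • (shiftAdj t (L.prod (shift t g)) - L.prod g) := by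
      rw [← hG]; rfl
    have e2 : inner ℂ f (shiftAdj t (L.prod (shift t g))) =
        inner ℂ (shiftAdj t (R (shift t f))) g := by
      rw [← adjoint_shift, ContinuousLinearMap.adjoint_inner_right,
        ContinuousLinearMap.adjoint_inner_left, hR, ContinuousLinearMap.adjoint_inner_left]
    have e3 : inner ℂ f (L.prod g) = inner ℂ (R f) g := by
      rw [hR, ContinuousLinearMap.adjoint_inner_left]
    rw [e1, inner_smul_right, inner_sub_right, e2, e3, map_smul, map_sub, shiftAdj_shift_apply,
      inner_smul_left, inner_sub_left, ← Complex.ofReal_inv, Complex.conj_ofReal]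
  have h3 : Tendsto (fun t : ℝ≥0 => inner ℂ (shiftAdj t (((t : ℝ) : ℂ)⁻¹ •
      (R (shift t f) - shift t (R f)))) g) (𝓝[>] 0) (𝓝 0) := by
    have h4 : Tendsto (fun t : ℝ≥0 => shiftAdj t (((t : ℝ) : ℂ)⁻¹ •
        (R (shift t f) - shift t (R f)))) (𝓝[>] 0) (𝓝 0) := by
      rw [tendsto_zero_iff_norm_tendsto_zero]
      exact squeeze_zero (fun _ => norm_nonneg _) (fun t => norm_shiftAdj_apply_le _ _)
        (tendsto_zero_iff_norm_tendsto_zero.1 (littleO_commutator L hlen hL f hf))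
    simpa using h4.inner (tendsto_const_nhds (x := g))
  simp only [h2] at h1
  exact tendsto_nhds_unique h1 h3

/-! ### Products of Hankel operators with square-integrable symbols -/

theorem IsHankel.congr {Γ : L2 →L[ℂ] L2} {φ ψ : ℝ → ℂ} (h : IsHankel Γ φ) (e : φ =ᵐ[halfLine] ψ) :
    IsHankel Γ ψ := by
  intro f
  filter_upwards [h f, ae_restrict_mem measurableSet_Ioi] with x hx hx0
  have e' : (fun y => φ (x + y) * f y) =ᵐ[halfLine] fun y => ψ (x + y) * f y := by
    filter_upwards [ae_halfLine_of_ae_Ioi x.toNNReal e] with y hy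
    rw [Real.coe_toNNReal x (le_of_lt hx0), add_comm] at hy
    rw [hy]
  exact ⟨hx.1.congr e', hx.2.trans (integral_congr_ae e')⟩

theorem tendsto_lintegral_translate_sub (f : L2) :
    Tendsto (fun y : ℝ => ∫⁻ x, ‖f (x + y) - f x‖ₑ ^ 2 ∂halfLine) (𝓝[>] 0) (𝓝 0) := by
  have h1 : Tendsto (fun t : ℝ≥0 => ‖shiftAdj t f - f‖ₑ ^ 2) (𝓝[>] 0) (𝓝 0) := by
    have h2 := (tendsto_shiftAdj_zero f).sub_const f
    rw [sub_self] at h2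
    have h3 := ENNReal.Tendsto.pow (n := 2) (h2.mono_left (nhdsWithin_le_nhds (s := Ioi 0))).enorm
    rwa [enorm_zero, zero_pow two_ne_zero] at h3
  refine (h1.comp tendsto_toNNReal_nhdsGT).congr' ?_
  filter_upwards [self_mem_nhdsWithin] with y hy
  rw [Function.comp_apply, Lp_enorm_sq]
  refine lintegral_congr_ae ?_
  filter_upwards [Lp.coeFn_sub (shiftAdj y.toNNReal f) f, shiftAdj_ae y.toNNReal f] with x h2 h3
  rw [h2, Pi.sub_apply, h3, Real.coe_toNNReal y (le_of_lt hy)]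

theorem aestronglyMeasurable_hankelKernel (f : L2) :
    AEStronglyMeasurable (fun p : ℝ × ℝ => f (p.1 + p.2)) quadrant :=
  ((Lp.stronglyMeasurable f).comp_measurable
    (measurable_fst.add measurable_snd)).aestronglyMeasurable

/-- The kernel `f(x + y)` has boundary value `f` on the edge `y = 0`, by continuity of translation
in `L²`. -/
theorem IsHankel.hasTraceRight {Γ : L2 →L[ℂ] L2} {f : L2} (h : IsHankel Γ f) :
    HasTraceRight Γ f :=
  hasTraceRight_of_kernel h (aestronglyMeasurable_hankelKernel f)
    (tendsto_average_zero (tendsto_lintegral_translate_sub f))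

theorem IsHankel.hasTraceLeft {Γ : L2 →L[ℂ] L2} {f : L2} (h : IsHankel Γ f) :
    HasTraceLeft Γ (star f) := by
  refine hasTraceLeft_of_kernel h (aestronglyMeasurable_hankelKernel f)
    ((tendsto_average_zero (tendsto_lintegral_translate_sub f)).congr fun t => ?_)
  congr 1
  refine lintegral_congr fun x => lintegral_congr_ae ?_
  filter_upwards [Lp.coeFn_star f] with y hy
  rw [hy, Pi.star_apply, star_star, add_comm]

theorem cutoff_mul_shift (t : ℝ≥0) : cutoff t * shift t = 0 := by
  rw [cutoff, sub_mul, one_mul, mul_assoc, shiftAdj_mul_shift, mul_one, sub_self]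

/-- Conjugating a product `A B R`, where `A` and `B` are Hankel operators, by the translations:
the defect against `A B (S_t† R S_t)` consists of two terms with a factor `A P_t B` or `B P_t R`,
where `P_t` is `cutoff t`. -/
theorem shiftAdj_mul_mul_shift_sub {A B : L2 →L[ℂ] L2} (t : ℝ≥0)
    (hA : shiftAdj t * A = A * shift t) (hB : shiftAdj t * B = B * shift t) (R : L2 →L[ℂ] L2) :
    shiftAdj t * (A * (B * R)) * shift t - A * (B * R) =
      A * B * (shiftAdj t * R * shift t - R) - A * cutoff t * B * shiftAdj t * R * shift t +
        shiftAdj t * A * (B * cutoff t * R) * shift t := by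
  have h1 : shiftAdj t * B * shiftAdj t = B - B * cutoff t := by
    rw [hB, cutoff, mul_sub, mul_one, mul_assoc]; abel
  have h2 : A * cutoff t * B * shiftAdj t = A * B * shiftAdj t - A * shift t * (B - B * cutoff t) := by
    rw [← h1, cutoff]; simp only [mul_sub, sub_mul, mul_one, mul_assoc]
  have h3 : shiftAdj t * (A * (B * R)) * shift t = A * shift t * B * R * shift t := by
    rw [← hA]; simp only [mul_assoc]
  rw [h2, h3, hA]
  simp only [mul_sub, sub_mul, mul_assoc]
  abel

theorem HSTendsto.rmul_shiftAdj {z : ℝ≥0 → L2 →L[ℂ] L2} {Z : HS} (hz : HSTendsto z Z) :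
    HSTendsto (fun t => z t * shiftAdj t) (HS.rmul Z 1) :=
  hz.rmul norm_shiftAdj_le fun f => by
    simp only [adjoint_shiftAdj, adjoint_one]
    exact (tendsto_shift_zero f).mono_left nhdsWithin_le_nhds

theorem HSTendsto.rmul_shift {z : ℝ≥0 → L2 →L[ℂ] L2} {Z : HS} (hz : HSTendsto z Z) :
    HSTendsto (fun t => z t * shift t) (HS.rmul Z 1) :=
  hz.rmul norm_shift_le fun f => by
    rw [adjoint_one]
    exact (tendsto_shiftAdj_zero f).mono_left nhdsWithin_le_nhds

theorem HSTendsto.lmul_shiftAdj {z : ℝ≥0 → L2 →L[ℂ] L2} {Z : HS} (hz : HSTendsto z Z) :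
    HSTendsto (fun t => shiftAdj t * z t) (HS.lmul 1 Z) :=
  hz.lmul norm_shiftAdj_le fun f => (tendsto_shiftAdj_zero f).mono_left nhdsWithin_le_nhds

/-- A product of an even number of Hankel operators with boundary values has an orbit under
`S_t† · S_t` that is differentiable at `0` in Hilbert–Schmidt norm, even where the partial products
are not themselves Hilbert–Schmidt. -/
theorem exists_hsTendsto_prod : ∀ (L : List (L2 →L[ℂ] L2)), Even L.length →
    (∀ Γ ∈ L, ∃ f : L2, IsHankel Γ f) →
      ∃ Z, HSTendsto (fun t => ((t : ℝ) : ℂ)⁻¹ • (shiftAdj t * L.prod * shift t - L.prod)) Z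
  | [], _, _ => ⟨0, fun _ => 0, Eventually.of_forall fun t => by simp, tendsto_const_nhds⟩
  | [_], h, _ => by simp at h
  | A :: B :: L, h, hL => by
    have hLe : Even L.length := by
      simpa [Nat.even_add_one, Nat.even_add] using h
    obtain ⟨f, hf⟩ := hL A List.mem_cons_self
    obtain ⟨g, hg⟩ := hL B (List.mem_cons_of_mem _ List.mem_cons_self)
    have hL' : ∀ Γ ∈ L, ∃ f : L2, IsHankel Γ f := fun Γ hΓ =>
      hL Γ (List.mem_cons_of_mem _ (List.mem_cons_of_mem _ hΓ))
    obtain ⟨Z, hZ⟩ := exists_hsTendsto_prod L hLe hL'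
    have t1 := hZ.const_lmul (A * B)
    have t2 := ((hf.hasTraceRight.hsTendsto_mul hg.hasTraceLeft).rmul_shiftAdj.const_rmul
      L.prod).rmul_shift
    obtain ⟨W, t3⟩ : ∃ W, HSTendsto (fun t => shiftAdj t * (A * (((t : ℝ) : ℂ)⁻¹ •
        (B * cutoff t * L.prod * shift t)))) W := by
      cases L with
      | nil =>
        refine ⟨0, fun _ => 0, Eventually.of_forall fun t => ?_, tendsto_const_nhds⟩
        simp [mul_assoc, cutoff_mul_shift]
      | cons C L =>
        obtain ⟨k, hk⟩ := hL' C List.mem_cons_self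
        refine ⟨_, (((((hg.hasTraceRight.hsTendsto_mul hk.hasTraceLeft).const_rmul
          L.prod).rmul_shift).const_lmul A).lmul_shiftAdj).congr
            (Eventually.of_forall fun t => ?_)⟩
        simp only [List.prod_cons, smul_mul_assoc, mul_assoc]
    refine ⟨_, ((t1.sub t2).add t3).congr (Eventually.of_forall fun t => ?_)⟩
    rw [List.prod_cons, List.prod_cons,
      shiftAdj_mul_mul_shift_sub t (hf.shiftAdj_mul t) (hg.shiftAdj_mul t)]
    simp only [smul_add, smul_sub, smul_mul_assoc, mul_smul_comm, mul_sub, mul_assoc]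

theorem mem_domain_of_hankel (L : List (L2 →L[ℂ] L2)) (hlen : Even L.length)
    (hL : ∀ Γ ∈ L, ∃ f : L2, IsHankel Γ f) {G : HS} (hG : G.op = L.prod) :
    G ∈ (generator sigma).domain := by
  obtain ⟨Z, hZ⟩ := exists_hsTendsto_prod L hlen hL
  rw [← hG] at hZ
  exact ⟨Z, HSTendsto.tendsto (X := fun t => ((t : ℝ) : ℂ)⁻¹ • (sigma t G - G)) hZ⟩

end Poppe

theorem mainTheorem3 :
    -- `σ♯` is a `C₀`-semigroup of isometric algebra homomorphisms of `𝓛²`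
    (Poppe.IsC0Semigroup Poppe.sigmaSharp ∧
      (∀ t, Isometry (Poppe.sigmaSharp t)) ∧
      (∀ t (Φ Ψ : Poppe.HS),
        Poppe.sigmaSharp t (Φ * Ψ) = Poppe.sigmaSharp t Φ * Poppe.sigmaSharp t Ψ) ∧
      -- the domain of its generator is an algebra, on which the generator is a derivation
      (∀ Φ Ψ : (Poppe.generator Poppe.sigmaSharp).domain,
        ∃ h : (Φ : Poppe.HS) * Ψ ∈ (Poppe.generator Poppe.sigmaSharp).domain,
          Poppe.generator Poppe.sigmaSharp ⟨(Φ : Poppe.HS) * Ψ, h⟩ =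
            Poppe.generator Poppe.sigmaSharp Φ * Ψ + Φ * Poppe.generator Poppe.sigmaSharp Ψ)) ∧
    -- `σ` is a `C₀`-semigroup of contractions of `𝓛²` that preserves the upper-triangular form of
    -- the Gelfand–Levitan–Marchenko equation
    (Poppe.IsC0Semigroup Poppe.sigma ∧
      (∀ t (Φ : Poppe.HS), ‖Poppe.sigma t Φ‖ ≤ ‖Φ‖) ∧
      (∀ t (Φ T : Poppe.HS), Poppe.GLM Φ T → Poppe.GLM (Poppe.sigma t Φ) (Poppe.sigma t T)) ∧
      (∀ t (T : Poppe.HS), Poppe.IsUpperTriangular T →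
        Poppe.IsUpperTriangular (Poppe.sigma t T))) ∧
    -- `ϖ` satisfies the Hochschild cocycle relation
    ((∀ (Υ Φ Ψ : Poppe.HS)
        (hΥ : Υ ∈ (Poppe.generator Poppe.sigma).domain)
        (hΦ : Φ ∈ (Poppe.generator Poppe.sigma).domain)
        (hΨ : Ψ ∈ (Poppe.generator Poppe.sigma).domain)
        (hΥΦ : Υ * Φ ∈ (Poppe.generator Poppe.sigma).domain)
        (hΦΨ : Φ * Ψ ∈ (Poppe.generator Poppe.sigma).domain)
        (hl : (Υ * Φ) * Ψ ∈ (Poppe.generator Poppe.sigma).domain)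
        (hr : Υ * (Φ * Ψ) ∈ (Poppe.generator Poppe.sigma).domain),
        Υ * Poppe.cocycle (Poppe.generator Poppe.sigma) Φ Ψ hΦ hΨ hΦΨ
          - Poppe.cocycle (Poppe.generator Poppe.sigma) (Υ * Φ) Ψ hΥΦ hΨ hl
          + Poppe.cocycle (Poppe.generator Poppe.sigma) Υ (Φ * Ψ) hΥ hΦΨ hr
          - Poppe.cocycle (Poppe.generator Poppe.sigma) Υ Φ hΥ hΦ hΥΦ * Ψ = 0) ∧
      -- Pöppe's identity `[Υ ϖ(Φ, Ψ) Λ]_{x,y} = [Υ Φ]_{x,0} [Ψ Λ]_{0,y}`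
      (∀ (Φ Ψ : Poppe.HS)
        (hΦ : Φ ∈ (Poppe.generator Poppe.sigma).domain)
        (hΨ : Ψ ∈ (Poppe.generator Poppe.sigma).domain)
        (hΦΨ : Φ * Ψ ∈ (Poppe.generator Poppe.sigma).domain)
        (Υ Λ : Poppe.HS),
        ∃ a b : Poppe.L2, Poppe.HasBoundaryValueRight (Υ * Φ) a ∧
          Poppe.HasBoundaryValueLeft (Ψ * Λ) b ∧
          ∀ᵐ p ∂Poppe.quadrant,
            (Υ * Poppe.cocycle (Poppe.generator Poppe.sigma) Φ Ψ hΦ hΨ hΦΨ * Λ).bracket p =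
              a p.1 * b p.2)) ∧
    -- `∂` of a product of an even number of Hankel operators has finite rank; the product lies in
    -- the domain of `∂` as soon as the symbols are square-integrable
    (∀ (n : ℕ), 1 ≤ n → ∀ (φ : Fin (2 * n) → ℝ → ℂ) (Γ : Fin (2 * n) → (Poppe.L2 →L[ℂ] Poppe.L2)),
      (∀ j, Poppe.IsHankel (Γ j) (φ j)) →
      ∀ G : Poppe.HS, G.op = (List.ofFn Γ).prod →
        ((∀ j, MemLp (φ j) 2 Poppe.halfLine) → G ∈ (Poppe.generator Poppe.sigma).domain) ∧
        ∀ hG : G ∈ (Poppe.generator Poppe.sigma).domain,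
          FiniteDimensional ℂ (LinearMap.range (Poppe.generator Poppe.sigma ⟨G, hG⟩).op.toLinearMap)) := by
  refine ⟨⟨Poppe.isC0Semigroup_sigmaSharp, Poppe.isometry_sigmaSharp, Poppe.sigmaSharp_mul,
      fun Φ Ψ => ?_⟩,
    ⟨Poppe.isC0Semigroup_sigma, Poppe.norm_sigma_le, Poppe.glm_sigma,
      Poppe.isUpperTriangular_sigma⟩,
    ⟨Poppe.cocycle_relation _, fun _ _ hΦ hΨ hΦΨ => Poppe.exists_boundaryValues hΦ hΨ hΦΨ⟩,
    fun n _ φ Γ hΓ G hG => ?_⟩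
  · have h := Poppe.hasOrbitDeriv_sigmaSharp_mul (Poppe.hasOrbitDeriv_generator _ Φ)
      (Poppe.hasOrbitDeriv_generator _ Ψ)
    exact ⟨h.mem_domain, h.generator_eq _⟩
  · have hlen : Even (List.ofFn Γ).length := by
      rw [List.length_ofFn]
      exact even_two_mul n
    refine ⟨fun hφ => Poppe.mem_domain_of_hankel _ hlen ?_ hG, fun hGd =>
      Poppe.finiteDimensional_range_of_hankel _ hlen ?_ hG
        (Poppe.hasOrbitDeriv_generator _ ⟨G, hGd⟩)⟩
    · rw [List.forall_mem_ofFn_iff]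
      exact fun j => ⟨(hφ j).toLp _, (hΓ j).congr (hφ j).coeFn_toLp.symm⟩
    · rw [List.forall_mem_ofFn_iff]
      exact fun j => (hΓ j).shiftAdj_mul
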